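/- Let $d \ge 2$ and $n \ge 2$ be integers and put $\nu = \frac d2 - 1$. Let $X_1, \dots, X_n$ be independent random vectors, each uniformly distributed on the unit sphere of $\mathbb{R}^d$, so that $\|X_1 + \dots + X_n\|$ is the distance to the origin after $n$ uniform unit steps. With $\nu! = \Gamma(\nu+1)$, let $J_\nu$ be the Bessel function of the first kind and $$ j_\nu(x) = \nu!\left(\frac{2}{x}\right)^{\nu} J_\nu(x) = \nu! \sum_{m \ge 0} \frac{(-x^2/4)^m}{m!\,(m+\nu)!}, \qquad j_\nu(0) = 1 . $$ Then $\|X_1 + \dots + X_n\|$ has a probability density function $p_n(\nu;\cdot) \colon \mathbb{R} \to [0,\infty)$, vanishing on $(-\infty,0]$, which satisfies $$ p_n(\nu; x) = \frac{2^{-\nu}}{\nu!} \int_0^\infty (tx)^{\nu+1} J_\nu(tx)\, j_\nu(t)^n \, dt $$ for every $x > 0$ with $(d,n,x) \ne (2,2,2)$ and $(d,n,x) \ne (2,3,1)$. Here the integral is understood as a convergent improper integral $\lim_{T\to\infty} \int_0^T$. Moreover, $p_n(\nu;\cdot)$ is continuous at every $x > 0$, except possibly in the cases $(d,n,x) = (2,2,2)$,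 $(3,2,2)$, $(2,3,1)$, $(2,3,3)$. -/

import Mathlib

open MeasureTheory Filter Topology

noncomputable section

/-- The Bessel function of the first kind `J_ν(x)` of real order `ν`, for real arguments `x ≥ 0`
(the only arguments at which it is used), with `(m + ν)! = Γ(m + ν + 1)`. -/
def besselJ (ν x : ℝ) : ℝ :=
  (x / 2) ^ ν * ∑' m : ℕ, (-(x ^ 2 / 4)) ^ m / ((m.factorial : ℝ) * Real.Gamma (m + ν + 1))

/-- The normalized Bessel function
`j_ν(x) = ν! ∑_{m ≥ 0} (-x²/4)^m / (m! (m + ν)!)`, with `ν! = Γ(ν + 1)`. -/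
def normalizedBesselJ (ν x : ℝ) : ℝ :=
  Real.Gamma (ν + 1) *
    ∑' m : ℕ, (-(x ^ 2 / 4)) ^ m / ((m.factorial : ℝ) * Real.Gamma (m + ν + 1))

/-- For `x > 0`, `j_ν(x) = ν! (2/x)^ν J_ν(x)`. -/
theorem normalizedBesselJ_eq (ν : ℝ) {x : ℝ} (hx : 0 < x) :
    normalizedBesselJ ν x = Real.Gamma (ν + 1) * (2 / x) ^ ν * besselJ ν x := by
  have h : (2 / x) ^ ν * (x / 2) ^ ν = 1 := by
    rw [← Real.mul_rpow (by positivity) (by positivity)]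
    have : 2 / x * (x / 2) = 1 := by field_simp
    rw [this, Real.one_rpow]
  unfold normalizedBesselJ besselJ
  linear_combination (-(Real.Gamma (ν + 1) *
    ∑' m : ℕ, (-(x ^ 2 / 4)) ^ m / ((m.factorial : ℝ) * Real.Gamma (m + ν + 1)))) * h

/-- The unit sphere of `ℝ^d`. -/
abbrev UnitSphere (d : ℕ) : Type := Metric.sphere (0 : EuclideanSpace ℝ (Fin d)) 1

/-- The uniform distribution on the unit sphere of `ℝ^d`: surface measure divided by its total
mass. -/
def uniformSphere (d : ℕ) : Measure (UnitSphere d) :=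
  ((volume : Measure (EuclideanSpace ℝ (Fin d))).toSphere Set.univ)⁻¹ •
    (volume : Measure (EuclideanSpace ℝ (Fin d))).toSphere

/-- The law of the `n` steps of the walk: independent and uniform on the unit sphere. -/
def stepsLaw (d n : ℕ) : Measure (Fin n → UnitSphere d) :=
  Measure.pi fun _ => uniformSphere d

/-- The law of the distance to the origin after `n` steps of the walk in `ℝ^d`. -/
def walkDistanceLaw (d n : ℕ) : Measure ℝ :=
  (stepsLaw d n).map fun X => ‖∑ i, (X i : EuclideanSpace ℝ (Fin d))‖

/-- `p` is a probability density function of the distance to the origin after `n` steps of the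
walk in `ℝ^d`: a nonnegative measurable function, vanishing on `(-∞, 0]`, whose measure
`p(x) dx` is the law of that distance. -/
structure IsWalkDensity (d n : ℕ) (p : ℝ → ℝ) : Prop where
  measurable : Measurable p
  nonneg : ∀ x, 0 ≤ p x
  eq_zero : ∀ x ≤ 0, p x = 0
  law_eq : walkDistanceLaw d n = volume.withDensity fun x => ENNReal.ofReal (p x)

/-- The truncated integral
`(2^{-ν} / ν!) ∫_0^T (t x)^{ν+1} J_ν(t x) j_ν(t)^n dt`. -/
def besselIntegral (ν : ℝ) (n : ℕ) (x T : ℝ) : ℝ :=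
  (2 : ℝ) ^ (-ν) / Real.Gamma (ν + 1) *
    ∫ t in (0 : ℝ)..T, (t * x) ^ (ν + 1) * besselJ ν (t * x) * normalizedBesselJ ν t ^ n

end

/-!
The function `j_ν(‖ξ‖)` is the characteristic function of a uniform point of the sphere, so
`j_ν(‖ξ‖)^n` is that of the sum of the `n` steps (`integral_cexp_inner_stepsLaw`). Fourier
inversion in `ℝ^d`, applied to smooth radial test functions supported away from the origin and
rewritten in polar coordinates, shows that the truncated Bessel integrals, as functions of `x`,
converge weakly to the law of the distance on `(0, ∞)` as `T → ∞`
(`tendsto_integral_mul_besselIntegral`). What remains is to prove pointwise convergence, locally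
uniformly wherever the density is to be continuous.

The rate of convergence comes from Bessel's equation. The function `u(t) = t^{ν + 1/2} j_ν(t)`
satisfies `u'' = -u + (ν² - 1/4) u / t²`, hence `u(t) = a cos t + b sin t + O(1 / t)`
(`exists_besselU_asymptotic`), and up to a power of `x` the integrand is `t^{-s} u(x t) u(t)^n`
with `s = (n - 1) (ν + 1/2) = (n - 1) (d - 1) / 2`.

* If `s > 1`, the integral converges absolutely, locally uniformly in `x`
  (`exists_tailBound_of_one_lt`).
* Otherwise `(d, n)` is `(2, 2)`, `(3, 2)` or `(2, 3)`. The leading term is `t^{-s}` times a sum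
  of exponentials with frequencies `± x + 2 l - n`, where `0 ≤ l ≤ n`; integration by parts gives
  locally uniform convergence away from the resonances `x = 2 l - n`
  (`exists_tailBound_nonresonant`). The positive resonances are `x = 2`, `x = 2` and `x ∈ {1, 3}`,
  which are the exceptional points.
* At `x = n` for `(d, n) = (3, 2)` and `(2, 3)`, the integral still converges. The frequency zero
  occurs twice, with coefficients whose sum is a multiple of `C D^n + C^n D`, where
  `2 C = a - b i` and `2 D = a + b i`. This sum vanishes because `a = 0` for `ν = 1/2`, where
  `u = sin`, and because `a = b` for `ν = 0`. The latter (`besselU_zero_phase`) is the phase of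
  `J_0`, found by comparing two computations of the Laplace transform of `e^{-it} J_0(t)` near the
  origin.

On the open set of regular points (`regularSet`) the limit is therefore continuous. By the weak
convergence it is the density of the law there (`law_restrict_regularSet`), and it is nonnegative
because the law is. At a resonance of the third kind there need not be continuity, but the
*symmetric* sum of the limits at `n + h` and `n - h` is continuous at `h = 0`, since the slowly
oscillating terms cancel for every `h`; so the limit at `x = n` is nonnegative as well
(`hankelLimit_resonant`). Finally, the law gives no mass to the complement of the regular set
(`walkDistanceLaw_compl_regularSet`): conditionally on the other steps, the first step would have
to lie in a countable set.
-/


/-! ### The Bessel series and its differential equation -/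

/-- The entire function `G_ν(z) = ∑ (-z)^m / (m! Γ(m + ν + 1))`, in terms of which
`j_ν(x) = Γ(ν + 1) G_ν(x² / 4)`. -/
noncomputable def besselSeries (ν z : ℝ) : ℝ :=
  ∑' m : ℕ, (-z) ^ m / ((m.factorial : ℝ) * Real.Gamma (m + ν + 1))

theorem normalizedBesselJ_eq_besselSeries (ν x : ℝ) :
    normalizedBesselJ ν x = Real.Gamma (ν + 1) * besselSeries ν (x ^ 2 / 4) := rfl

theorem Gamma_add_one_le {ν : ℝ} (hν : 0 ≤ ν) (m : ℕ) :
    Real.Gamma (ν + 1) ≤ Real.Gamma (m + ν + 1) := by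
  induction m with
  | zero => simp
  | succ m ih =>
    have h : ((m + 1 : ℕ) : ℝ) + ν + 1 = (m + ν + 1) + 1 := by push_cast; ring
    have hm : (0 : ℝ) ≤ m := m.cast_nonneg
    rw [h, Real.Gamma_add_one (s := m + ν + 1) (by positivity)]
    have : 0 < Real.Gamma (m + ν + 1) := Real.Gamma_pos_of_pos (by positivity)
    nlinarith

theorem norm_besselSeries_term_le {ν : ℝ} (hν : 0 ≤ ν) (m : ℕ) {z R : ℝ} (hz : |z| ≤ R) :
    ‖(-z) ^ m / ((m.factorial : ℝ) * Real.Gamma (m + ν + 1))‖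
      ≤ (Real.Gamma (ν + 1))⁻¹ * (R ^ m / m.factorial) := by
  have h1 := Gamma_add_one_le hν m
  have h0 : 0 < Real.Gamma (ν + 1) := Real.Gamma_pos_of_pos (by positivity)
  have h2 : 0 < Real.Gamma (m + ν + 1) := h0.trans_le h1
  have hR : 0 ≤ R := (abs_nonneg z).trans hz
  rw [norm_div, norm_pow, norm_neg, Real.norm_eq_abs, Real.norm_eq_abs,
    abs_of_pos (a := (m.factorial : ℝ) * Real.Gamma (m + ν + 1)) (by positivity)]
  calc |z| ^ m / (m.factorial * Real.Gamma (m + ν + 1))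
      ≤ R ^ m / (m.factorial * Real.Gamma (ν + 1)) := by gcongr
    _ = _ := by field_simp

theorem summable_besselSeries {ν : ℝ} (hν : 0 ≤ ν) (z : ℝ) :
    Summable fun m : ℕ => (-z) ^ m / ((m.factorial : ℝ) * Real.Gamma (m + ν + 1)) :=
  Summable.of_norm_bounded ((Real.summable_pow_div_factorial |z|).mul_left _)
    fun m => norm_besselSeries_term_le hν m le_rfl

theorem hasDerivAt_besselSeries {ν : ℝ} (hν : 0 ≤ ν) (z : ℝ) :
    HasDerivAt (besselSeries ν) (-besselSeries (ν + 1) z) z := by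
  obtain ⟨R, hzR⟩ : ∃ R, |z| < R := exists_gt _
  let g' : ℕ → ℝ → ℝ := fun m y =>
    (m : ℝ) * (-y) ^ (m - 1) * (-1) / ((m.factorial : ℝ) * Real.Gamma (m + ν + 1))
  have hg' : ∀ m y, g' (m + 1) y
      = -((-y) ^ m / ((m.factorial : ℝ) * Real.Gamma (m + (ν + 1) + 1))) := by
    intro m y
    simp only [g', Nat.factorial_succ]
    have : ((m + 1 : ℕ) : ℝ) + ν + 1 = m + (ν + 1) + 1 := by push_cast; ring
    rw [this, Nat.add_sub_cancel]
    have h1 : (m.factorial : ℝ) ≠ 0 := by positivity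
    have h2 : ((m : ℝ) + 1) ≠ 0 := by positivity
    have h3 : Real.Gamma (m + (ν + 1) + 1) ≠ 0 := (Real.Gamma_pos_of_pos (by positivity)).ne'
    push_cast
    field_simp
  have hg0 : ∀ y, g' 0 y = 0 := by intro y; simp [g']
  let u : ℕ → ℝ := fun m => Nat.casesOn m 0
    fun m => (Real.Gamma (ν + 1 + 1))⁻¹ * (R ^ m / m.factorial)
  have hu : Summable u := by
    rw [← summable_nat_add_iff 1]
    exact (Real.summable_pow_div_factorial R).mul_left _
  have hd : ∀ m : ℕ, ∀ y ∈ Metric.ball (0 : ℝ) R, HasDerivAt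
      (fun y : ℝ => (-y) ^ m / ((m.factorial : ℝ) * Real.Gamma (m + ν + 1))) (g' m y) y :=
    fun m y _ => ((hasDerivAt_neg y).fun_pow m).div_const _
  clear_value g'
  have hle : ∀ m : ℕ, ∀ y ∈ Metric.ball (0 : ℝ) R, ‖g' m y‖ ≤ u m := by
    intro m y hy
    have hy' : |y| ≤ R := by simpa using (Metric.mem_ball.1 hy).le
    cases m with
    | zero => simp [hg0, u]
    | succ m =>
      rw [hg', norm_neg]
      exact norm_besselSeries_term_le (by positivity) m hy'
  clear_value u
  have hz : z ∈ Metric.ball (0 : ℝ) R := by simpa using hzR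
  have key := hasDerivAt_tsum_of_isPreconnected hu Metric.isOpen_ball
    (convex_ball (0 : ℝ) R).isPreconnected hd hle hz (summable_besselSeries hν z) hz
  have e : ∑' m, g' m z = -besselSeries (ν + 1) z := by
    have hs : Summable fun m => g' (m + 1) z := by
      simp_rw [hg']
      exact (summable_besselSeries (by positivity) z).neg
    rw [((summable_nat_add_iff 1).1 hs).tsum_eq_zero_add, hg0, zero_add]
    simp_rw [hg']
    rw [tsum_neg]; rfl
  rw [e] at key
  exact key

/-- The recurrence `J_{ν+2} = (2 (ν+1) / x) J_{ν+1} - J_ν`, in terms of the series. -/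
theorem besselSeries_recurrence {ν : ℝ} (hν : 0 ≤ ν) (z : ℝ) :
    besselSeries ν z
      = (ν + 1) * besselSeries (ν + 1) z - z * besselSeries (ν + 2) z := by
  have h1 := (summable_besselSeries (ν := ν + 1) (by positivity) z)
  have h2 := (summable_besselSeries (ν := ν + 2) (by positivity) z)
  -- the shifted series, with a zero term prepended
  let b : ℕ → ℝ := fun m => (m : ℝ) * ((-z) ^ m / (m.factorial * Real.Gamma (m + (ν + 1) + 1)))
  have hb : ∀ m, b (m + 1) =
      -z * ((-z) ^ m / ((m.factorial : ℝ) * Real.Gamma (m + (ν + 2) + 1))) := by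
    intro m
    simp only [b, Nat.factorial_succ]
    have : ((m + 1 : ℕ) : ℝ) + (ν + 1) + 1 = m + (ν + 2) + 1 := by push_cast; ring
    rw [this]
    have h1 : (m.factorial : ℝ) ≠ 0 := by positivity
    have h2 : ((m : ℝ) + 1) ≠ 0 := by positivity
    have h3 : Real.Gamma (m + (ν + 2) + 1) ≠ 0 := (Real.Gamma_pos_of_pos (by positivity)).ne'
    push_cast
    field_simp
    ring
  have hbs' : Summable fun m => b (m + 1) := by
    simp_rw [hb]; exact h2.mul_left _
  have hbs : Summable b := (summable_nat_add_iff 1).1 hbs'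
  have hbt : ∑' m, b m = -z * besselSeries (ν + 2) z := by
    rw [hbs.tsum_eq_zero_add]
    simp_rw [hb]
    rw [tsum_mul_left]
    simp [b, besselSeries]
  have : besselSeries ν z = (ν + 1) * besselSeries (ν + 1) z + ∑' m, b m := by
    unfold besselSeries
    rw [← tsum_mul_left, ← (h1.mul_left _).tsum_add hbs]
    congr 1; ext m
    have e : (m : ℝ) + (ν + 1) + 1 = (m + ν + 1) + 1 := by ring
    simp only [b]
    have hp : 0 < (m : ℝ) + ν + 1 := by positivity
    rw [e, Real.Gamma_add_one hp.ne']
    have h1 : (m.factorial : ℝ) ≠ 0 := by positivity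
    have h3 : Real.Gamma (m + ν + 1) ≠ 0 := (Real.Gamma_pos_of_pos (by positivity)).ne'
    field_simp
    ring
  rw [this, hbt]; ring

/-- The derivative of `j_ν`. -/
noncomputable def normalizedBesselJDeriv (ν x : ℝ) : ℝ :=
  -(Real.Gamma (ν + 1) * (x / 2) * besselSeries (ν + 1) (x ^ 2 / 4))

theorem hasDerivAt_normalizedBesselJ {ν : ℝ} (hν : 0 ≤ ν) (x : ℝ) :
    HasDerivAt (normalizedBesselJ ν) (normalizedBesselJDeriv ν x) x := by
  have h : HasDerivAt (fun x : ℝ => x ^ 2 / 4) (x / 2) x := by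
    have := (hasDerivAt_pow 2 x).div_const 4
    convert! this using 1; simp; ring
  have := ((hasDerivAt_besselSeries hν (x ^ 2 / 4)).comp x h).const_mul (Real.Gamma (ν + 1))
  convert! this using 1
  unfold normalizedBesselJDeriv; ring

theorem continuous_normalizedBesselJ {ν : ℝ} (hν : 0 ≤ ν) : Continuous (normalizedBesselJ ν) :=
  continuous_iff_continuousAt.2 fun x => (hasDerivAt_normalizedBesselJ hν x).continuousAt

/-- Bessel's differential equation in the form `j'' = -((2ν + 1) / x) j' - j`. -/
theorem hasDerivAt_normalizedBesselJDeriv {ν : ℝ} (hν : 0 ≤ ν) {x : ℝ} (hx : x ≠ 0) :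
    HasDerivAt (normalizedBesselJDeriv ν)
      (-((2 * ν + 1) / x * normalizedBesselJDeriv ν x) - normalizedBesselJ ν x) x := by
  have h : HasDerivAt (fun x : ℝ => x ^ 2 / 4) (x / 2) x := by
    have := (hasDerivAt_pow 2 x).div_const 4
    convert! this using 1; simp; ring
  have h1 := ((hasDerivAt_besselSeries (ν := ν + 1) (by positivity) (x ^ 2 / 4)).comp x h)
  have h2 := ((((hasDerivAt_id x).div_const 2).const_mul (Real.Gamma (ν + 1))).mul h1).neg
  convert! h2 using 1
  have e : ν + 1 + 1 = ν + 2 := by ring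
  simp only [normalizedBesselJ_eq_besselSeries, normalizedBesselJDeriv, id, Function.comp, e,
    besselSeries_recurrence hν]
  field_simp
  ring

theorem normalizedBesselJ_zero {ν : ℝ} (hν : 0 ≤ ν) : normalizedBesselJ ν 0 = 1 := by
  unfold normalizedBesselJ
  rw [tsum_eq_single 0]
  · have : Real.Gamma (ν + 1) ≠ 0 := (Real.Gamma_pos_of_pos (by positivity)).ne'
    simp [this]
  · intro m hm; simp [hm]

/-! ### Decay and asymptotics of the normalized Bessel function -/

/-- `u(t) = t^{ν + 1/2} j_ν(t)`, which solves `u'' = -u + (ν² - 1/4) / t² * u`. -/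
noncomputable def besselU (ν t : ℝ) : ℝ := t ^ (ν + 1 / 2) * normalizedBesselJ ν t

/-- The derivative of `besselU`. -/
noncomputable def besselUDeriv (ν t : ℝ) : ℝ :=
  t ^ (ν + 1 / 2) * (normalizedBesselJDeriv ν t + (ν + 1 / 2) / t * normalizedBesselJ ν t)

theorem hasDerivAt_besselU {ν : ℝ} (hν : 0 ≤ ν) {t : ℝ} (ht : 0 < t) :
    HasDerivAt (besselU ν) (besselUDeriv ν t) t := by
  have h := (Real.hasDerivAt_rpow_const (p := ν + 1 / 2) (Or.inl ht.ne')).mul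
    (hasDerivAt_normalizedBesselJ hν t)
  convert! h using 1
  rw [besselUDeriv, Real.rpow_sub_one ht.ne']
  ring

theorem hasDerivAt_besselUDeriv {ν : ℝ} (hν : 0 ≤ ν) {t : ℝ} (ht : 0 < t) :
    HasDerivAt (besselUDeriv ν)
      (-besselU ν t + (ν ^ 2 - 1 / 4) / t ^ 2 * besselU ν t) t := by
  have h1 : HasDerivAt (fun t : ℝ => (ν + 1 / 2) / t) (-(ν + 1 / 2) / t ^ 2) t := by
    have := (hasDerivAt_inv ht.ne').const_mul (ν + 1 / 2)
    convert! this using 1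
    field_simp
  have h := (Real.hasDerivAt_rpow_const (p := ν + 1 / 2) (Or.inl ht.ne')).mul
    ((hasDerivAt_normalizedBesselJDeriv hν ht.ne').add
      (h1.mul (hasDerivAt_normalizedBesselJ hν t)))
  convert! h using 1
  simp only [besselU, Real.rpow_sub_one ht.ne', Pi.add_apply, Pi.mul_apply]
  field_simp
  ring

/-- The energy `u² + u'²` stays bounded on `[1, ∞)`, because its logarithmic derivative is
`O(1 / t²)`. -/
theorem exists_besselU_energy_le {ν : ℝ} (hν : 0 ≤ ν) :
    ∃ M : ℝ, 0 ≤ M ∧ ∀ t : ℝ, 1 ≤ t → |besselU ν t| ≤ M ∧ |besselUDeriv ν t| ≤ M := by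
  set c := |ν ^ 2 - 1 / 4| with hc
  have hc0 : 0 ≤ c := abs_nonneg _
  -- the factor `exp (c / t)`, which is bounded on `[1, ∞)`, absorbs the growth of `u² + u'²`
  let E : ℝ → ℝ := fun t => (besselU ν t ^ 2 + besselUDeriv ν t ^ 2) * Real.exp (c / t)
  let E' : ℝ → ℝ := fun t =>
    (2 * (besselUDeriv ν t * besselU ν t) * ((ν ^ 2 - 1 / 4) / t ^ 2)
      - (besselU ν t ^ 2 + besselUDeriv ν t ^ 2) * (c / t ^ 2)) * Real.exp (c / t)
  have hd : ∀ t, 0 < t → HasDerivAt E (E' t) t := by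
    intro t ht
    have h1 := (hasDerivAt_besselU hν ht).pow 2
    have h2 := (hasDerivAt_besselUDeriv hν ht).pow 2
    have h3 : HasDerivAt (fun t : ℝ => Real.exp (c / t)) (Real.exp (c / t) * (-c / t ^ 2)) t := by
      refine HasDerivAt.exp ?_
      have := (hasDerivAt_inv ht.ne').const_mul c
      convert! this using 1
      field_simp
    convert! (h1.add h2).mul h3 using 1
    simp only [E', Pi.add_apply, Pi.pow_apply]
    field_simp
    ring
  have hanti : AntitoneOn E (Set.Ici 1) := by
    refine antitoneOn_of_deriv_nonpos (convex_Ici 1) ?_ ?_ ?_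
    · intro t ht
      exact (hd t (by linarith [Set.mem_Ici.1 ht])).continuousAt.continuousWithinAt
    · intro t ht
      rw [interior_Ici] at ht
      exact (hd t (by linarith [Set.mem_Ioi.1 ht])).differentiableAt.differentiableWithinAt
    · intro t ht
      rw [interior_Ici] at ht
      have ht' : 0 < t := by linarith [Set.mem_Ioi.1 ht]
      rw [(hd t ht').deriv]
      refine mul_nonpos_of_nonpos_of_nonneg ?_ (Real.exp_pos _).le
      have h1 : 2 * (besselUDeriv ν t * besselU ν t) * (ν ^ 2 - 1 / 4)
          ≤ (besselU ν t ^ 2 + besselUDeriv ν t ^ 2) * c := by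
        calc _ ≤ |2 * (besselUDeriv ν t * besselU ν t) * (ν ^ 2 - 1 / 4)| := le_abs_self _
          _ = |2 * (besselUDeriv ν t * besselU ν t)| * c := by rw [abs_mul]
          _ ≤ _ := by
            gcongr
            rw [abs_le]
            constructor <;> nlinarith [sq_nonneg (besselU ν t + besselUDeriv ν t),
              sq_nonneg (besselU ν t - besselUDeriv ν t)]
      have h2 : 0 < t ^ 2 := by positivity
      have : (2 * (besselUDeriv ν t * besselU ν t) * ((ν ^ 2 - 1 / 4) / t ^ 2)
          - (besselU ν t ^ 2 + besselUDeriv ν t ^ 2) * (c / t ^ 2))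
          = (2 * (besselUDeriv ν t * besselU ν t) * (ν ^ 2 - 1 / 4)
          - (besselU ν t ^ 2 + besselUDeriv ν t ^ 2) * c) / t ^ 2 := by ring
      rw [this]
      exact div_nonpos_of_nonpos_of_nonneg (by linarith) h2.le
  refine ⟨√(E 1), Real.sqrt_nonneg _, fun t ht => ?_⟩
  have h1 : E t ≤ E 1 := hanti (Set.mem_Ici.2 le_rfl) ht ht
  have h2 : besselU ν t ^ 2 + besselUDeriv ν t ^ 2 ≤ E t := by
    refine le_mul_of_one_le_right (by positivity) (Real.one_le_exp (by positivity))
  constructor <;> refine Real.abs_le_sqrt ?_ <;> nlinarith [sq_nonneg (besselU ν t),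
    sq_nonneg (besselUDeriv ν t)]

/-- A function whose derivative is `O(1 / t²)` converges at rate `O(1 / t)`. -/
theorem exists_abs_sub_le_of_abs_deriv_le {f f' : ℝ → ℝ} {C : ℝ} (hC : 0 ≤ C)
    (hf : ∀ t, 1 ≤ t → HasDerivAt f (f' t) t) (hf' : ∀ t, 1 ≤ t → |f' t| ≤ C / t ^ 2) :
    ∃ a : ℝ, ∀ t, 1 ≤ t → |f t - a| ≤ C / t := by
  have hinv : ∀ t : ℝ, 1 ≤ t → HasDerivAt (fun t : ℝ => C / t) (-C / t ^ 2) t := by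
    intro t ht
    have := (hasDerivAt_inv (by positivity : t ≠ 0)).const_mul C
    convert! this using 1
    field_simp
  have hmono : MonotoneOn (fun t => f t - C / t) (Set.Ici 1) := by
    have hd : ∀ t, 1 ≤ t → HasDerivAt (fun t => f t - C / t) (f' t - -C / t ^ 2) t :=
      fun t ht => (hf t ht).sub (hinv t ht)
    refine monotoneOn_of_deriv_nonneg (convex_Ici 1)
      (fun t ht => (hd t ht).continuousAt.continuousWithinAt)
      (fun t ht => (hd t (interior_subset ht)).differentiableAt.differentiableWithinAt)
      fun t ht => ?_
    rw [(hd t (interior_subset ht)).deriv]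
    have := neg_le_of_abs_le (hf' t (interior_subset ht))
    have e : -C / t ^ 2 = -(C / t ^ 2) := by ring
    linarith
  have hanti : AntitoneOn (fun t => f t + C / t) (Set.Ici 1) := by
    have hd : ∀ t, 1 ≤ t → HasDerivAt (fun t => f t + C / t) (f' t + -C / t ^ 2) t :=
      fun t ht => (hf t ht).add (hinv t ht)
    refine antitoneOn_of_deriv_nonpos (convex_Ici 1)
      (fun t ht => (hd t ht).continuousAt.continuousWithinAt)
      (fun t ht => (hd t (interior_subset ht)).differentiableAt.differentiableWithinAt)
      fun t ht => ?_
    rw [(hd t (interior_subset ht)).deriv]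
    have := le_of_abs_le (hf' t (interior_subset ht))
    have e : -C / t ^ 2 = -(C / t ^ 2) := by ring
    linarith
  have hle : ∀ s t : ℝ, 1 ≤ s → 1 ≤ t → f s - C / s ≤ f t + C / t := by
    intro s t hs ht
    have h1 := hmono hs (Set.mem_Ici.2 (hs.trans (le_max_left s t))) (le_max_left s t)
    have h2 := hanti ht (Set.mem_Ici.2 (hs.trans (le_max_left s t))) (le_max_right s t)
    have h3 : 0 ≤ C / max s t := by positivity
    simp only at h1 h2
    linarith
  let S : Set ℝ := (fun t => f t - C / t) '' Set.Ici 1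
  have hbdd : BddAbove S := ⟨f 1 + C / 1, by
    rintro _ ⟨s, hs, rfl⟩
    exact hle s 1 hs le_rfl⟩
  refine ⟨sSup S, fun t ht => ?_⟩
  have h1 : f t - C / t ≤ sSup S := le_csSup hbdd ⟨t, ht, rfl⟩
  have h2 : sSup S ≤ f t + C / t := csSup_le ⟨_, 1, Set.mem_Ici.2 le_rfl, rfl⟩ (by
    rintro _ ⟨s, hs, rfl⟩
    exact hle s t hs ht)
  rw [abs_le]; constructor <;> linarith

theorem continuous_besselU {ν : ℝ} (hν : 0 ≤ ν) : Continuous (besselU ν) :=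
  (Real.continuous_rpow_const (by positivity)).mul (continuous_normalizedBesselJ hν)

theorem exists_abs_besselU_le {ν : ℝ} (hν : 0 ≤ ν) :
    ∃ M : ℝ, 0 < M ∧ ∀ t : ℝ, 0 ≤ t → |besselU ν t| ≤ M := by
  obtain ⟨M, hM0, hM⟩ := exists_besselU_energy_le hν
  obtain ⟨N, hN⟩ := (isCompact_Icc (a := (0 : ℝ)) (b := 1)).exists_bound_of_continuousOn
    (continuous_besselU hν).continuousOn
  refine ⟨max M N + 1, by positivity, fun t ht => ?_⟩
  rcases le_total t 1 with h | h
  · have := hN t ⟨ht, h⟩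
    rw [Real.norm_eq_abs] at this
    linarith [le_max_right M N]
  · linarith [(hM t h).1, le_max_left M N]

/-- Leading asymptotics `u(t) = a cos t + b sin t + O(1 / t)`, by variation of constants. The bound
holds for all `t > 0`, since `u` is bounded. For `ν = 1 / 2` the function `u` is `sin`. -/
theorem exists_besselU_asymptotic {ν : ℝ} (hν : 0 ≤ ν) :
    ∃ a b M : ℝ, 0 < M ∧ (∀ t : ℝ, 0 < t →
      |besselU ν t - (a * Real.cos t + b * Real.sin t)| ≤ M / t) ∧
      (ν = 1 / 2 → a = 0) := by
  obtain ⟨M, hM0, hM⟩ := exists_besselU_energy_le hν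
  set c := ν ^ 2 - 1 / 4 with hc
  -- `A` and `B` would be constant if `u'' = -u`; here their derivatives are `O(1 / t²)`
  let A : ℝ → ℝ := fun t => besselU ν t * Real.cos t - besselUDeriv ν t * Real.sin t
  let B : ℝ → ℝ := fun t => besselU ν t * Real.sin t + besselUDeriv ν t * Real.cos t
  have hA : ∀ t, 0 < t → HasDerivAt A (-(c / t ^ 2 * besselU ν t * Real.sin t)) t := by
    intro t ht
    have := ((hasDerivAt_besselU hν ht).mul (Real.hasDerivAt_cos t)).sub
      ((hasDerivAt_besselUDeriv hν ht).mul (Real.hasDerivAt_sin t))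
    convert! this using 1
    ring
  have hB : ∀ t, 0 < t → HasDerivAt B (c / t ^ 2 * besselU ν t * Real.cos t) t := by
    intro t ht
    have := ((hasDerivAt_besselU hν ht).mul (Real.hasDerivAt_sin t)).add
      ((hasDerivAt_besselUDeriv hν ht).mul (Real.hasDerivAt_cos t))
    convert! this using 1
    ring
  have hbound : ∀ t v : ℝ, 1 ≤ t → |v| ≤ 1 → |c / t ^ 2 * besselU ν t * v| ≤ |c| * M / t ^ 2 := by
    intro t v ht hv
    rw [abs_mul, abs_mul, abs_div, abs_of_pos (by positivity : 0 < t ^ 2)]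
    calc |c| / t ^ 2 * |besselU ν t| * |v| ≤ |c| / t ^ 2 * M * 1 := by
          gcongr
          exact (hM t ht).1
      _ = _ := by ring
  obtain ⟨a, ha⟩ := exists_abs_sub_le_of_abs_deriv_le (f := A) (C := |c| * M) (by positivity)
    (fun t ht => hA t (by linarith))
    (fun t ht => by rw [abs_neg]; exact hbound t _ ht (Real.abs_sin_le_one t))
  obtain ⟨b, hb⟩ := exists_abs_sub_le_of_abs_deriv_le (f := B) (C := |c| * M) (by positivity)
    (fun t ht => hB t (by linarith)) (fun t ht => hbound t _ ht (Real.abs_cos_le_one t))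
  obtain ⟨N, hN0, hN⟩ := exists_abs_besselU_le hν
  refine ⟨a, b, 2 * (|c| * M) + N + |a| + |b|, by positivity, fun t ht => ?_, fun h => ?_⟩
  · rcases le_total 1 t with h | h
    · have e : besselU ν t - (a * Real.cos t + b * Real.sin t)
          = (A t - a) * Real.cos t + (B t - b) * Real.sin t := by
        simp only [A, B]
        linear_combination (-besselU ν t) * (Real.sin_sq_add_cos_sq t)
      rw [e]
      calc _ ≤ |A t - a| * |Real.cos t| + |B t - b| * |Real.sin t| := by
            rw [← abs_mul, ← abs_mul]; exact abs_add_le _ _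
        _ ≤ |c| * M / t * 1 + |c| * M / t * 1 := by
            gcongr
            · exact ha t h
            · exact Real.abs_cos_le_one t
            · exact hb t h
            · exact Real.abs_sin_le_one t
        _ = (2 * (|c| * M) + 0 + 0 + 0) / t := by ring
        _ ≤ _ := by gcongr <;> positivity
    · rw [le_div_iff₀ ht]
      have h1 : |besselU ν t - (a * Real.cos t + b * Real.sin t)| ≤ N + |a| + |b| := by
        calc _ ≤ |besselU ν t| + (|a| * |Real.cos t| + |b| * |Real.sin t|) := by
              rw [← abs_mul, ← abs_mul]
              exact (abs_sub _ _).trans (by gcongr; exact abs_add_le _ _)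
          _ ≤ N + (|a| * 1 + |b| * 1) := by
              gcongr
              · exact hN t ht.le
              · exact Real.abs_cos_le_one t
              · exact Real.abs_sin_le_one t
          _ = _ := by ring
      have h2 : 0 ≤ |c| * M := by positivity
      calc _ ≤ (N + |a| + |b|) * 1 := by gcongr
        _ ≤ _ := by linarith
  · -- for `ν = 1/2` the quantity `A` is constant, and it tends to `0` at the origin
    have hc0 : c = 0 := by rw [hc, h]; norm_num
    have hconst : ∀ t, 0 < t → A t = a := by
      have h1 : ∀ t, 0 < t → A t = A 1 := by
        intro t ht
        refine (convex_Ioi (0 : ℝ)).is_const_of_fderivWithin_eq_zero (𝕜 := ℝ) (f := A)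
          (fun s hs => (hA s hs).differentiableAt.differentiableWithinAt) (fun s hs => ?_)
          ht (Set.mem_Ioi.2 one_pos)
        rw [fderivWithin_of_isOpen isOpen_Ioi hs]
        have := (hA s hs).hasFDerivAt.fderiv
        rw [this, hc0]; ext; simp
      have h2 := ha 1 le_rfl
      rw [hc0] at h2
      have h3 : A 1 = a := by
        have : |A 1 - a| ≤ 0 := by simpa using h2
        linarith [abs_nonpos_iff.1 this]
      intro t ht; rw [h1 t ht, h3]
    have hlim : Tendsto (fun t => t * normalizedBesselJ ν t * Real.cos t
        - (t * normalizedBesselJDeriv ν t + normalizedBesselJ ν t) * Real.sin t)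
        (𝓝[>] 0) (𝓝 (0 * normalizedBesselJ ν 0 * Real.cos 0
        - (0 * normalizedBesselJDeriv ν 0 + normalizedBesselJ ν 0) * Real.sin 0)) := by
      have hc1 := continuous_normalizedBesselJ hν
      have hc2 : Continuous (normalizedBesselJDeriv ν) := by
        have : Continuous (besselSeries (ν + 1)) := continuous_iff_continuousAt.2 fun x =>
          (hasDerivAt_besselSeries (by positivity) x).continuousAt
        unfold normalizedBesselJDeriv
        fun_prop
      exact (Continuous.tendsto (by fun_prop) 0).mono_left nhdsWithin_le_nhds
    have hlim2 : Tendsto (fun _ : ℝ => a) (𝓝[>] (0 : ℝ)) (𝓝 0) := by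
      simp only [Real.sin_zero, mul_zero, zero_mul, sub_zero] at hlim
      refine hlim.congr' ?_
      filter_upwards [self_mem_nhdsWithin] with t ht
      have ht' : (0 : ℝ) < t := ht
      rw [← hconst t ht]
      simp only [A, besselU, besselUDeriv, h]
      norm_num
      field_simp
      exact Or.inl trivial
    exact tendsto_nhds_unique tendsto_const_nhds hlim2

/-! ### The characteristic function of the uniform distribution on the sphere -/

/-- A random variable with values in `[-1, 1]` whose moments are those of a coordinate of a uniform
point of the sphere has characteristic function `j_ν`. -/
theorem integral_cexp_eq_normalizedBesselJ {Ω : Type*} [MeasurableSpace Ω] (μ : Measure Ω)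
    [IsProbabilityMeasure μ] {Y : Ω → ℝ} (hY : Measurable Y) (hY1 : ∀ ω, |Y ω| ≤ 1)
    {ν : ℝ} (hν : 0 ≤ ν) (hodd : ∀ m : ℕ, ∫ ω, Y ω ^ (2 * m + 1) ∂μ = 0)
    (heven : ∀ m : ℕ, ∫ ω, Y ω ^ (2 * m) ∂μ = ((2 * m).factorial : ℝ) * Real.Gamma (ν + 1)
      / (4 ^ m * m.factorial * Real.Gamma (m + ν + 1))) (t : ℝ) :
    ∫ ω, Complex.exp (t * Y ω * Complex.I) ∂μ = (normalizedBesselJ ν t : ℂ) := by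
  have h := hasSum_integral_of_dominated_convergence (μ := μ)
    (F := fun (n : ℕ) ω => (t * Y ω * Complex.I) ^ n / (n.factorial : ℂ))
    (f := fun ω => Complex.exp (t * Y ω * Complex.I)) (fun n _ => |t| ^ n / n.factorial)
    (fun n => by fun_prop) (fun n => Eventually.of_forall fun ω => by
      rw [norm_div, norm_pow]
      simp only [norm_mul, Complex.norm_real, Complex.norm_I, mul_one, Complex.norm_natCast,
        Real.norm_eq_abs]
      gcongr
      exact mul_le_of_le_one_right (abs_nonneg t) (hY1 ω))
    (Eventually.of_forall fun _ => Real.summable_pow_div_factorial |t|)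
    (integrable_const _)
    (Eventually.of_forall fun ω => by
      rw [Complex.exp_eq_exp_ℂ]
      exact NormedSpace.expSeries_div_hasSum_exp _)
  have e : ∀ n : ℕ, ∫ ω, (t * Y ω * Complex.I) ^ n / (n.factorial : ℂ) ∂μ
      = (t * Complex.I) ^ n / n.factorial * ((∫ ω, Y ω ^ n ∂μ : ℝ) : ℂ) := by
    intro n
    rw [← integral_complex_ofReal, ← integral_const_mul]
    congr 1; ext ω; push_cast; ring
  simp_rw [e] at h
  have hinj : Function.Injective (fun m : ℕ => 2 * m) := fun a b hab => by simpa using hab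
  rw [← hinj.hasSum_iff] at h
  · have h2 : HasSum (fun m : ℕ => (((Real.Gamma (ν + 1) *
        ((-(t ^ 2 / 4)) ^ m / ((m.factorial : ℝ) * Real.Gamma (m + ν + 1)))) : ℝ) : ℂ))
        (normalizedBesselJ ν t : ℂ) := by
      rw [Complex.hasSum_ofReal]
      exact (summable_besselSeries hν (t ^ 2 / 4)).hasSum.mul_left _
    refine HasSum.unique (h.congr_fun ?_) h2
    intro m
    simp only [Function.comp, heven]
    have hG : Real.Gamma (m + ν + 1) ≠ 0 := (Real.Gamma_pos_of_pos (by positivity)).ne'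
    have hm : (m.factorial : ℂ) ≠ 0 := by exact_mod_cast m.factorial_ne_zero
    have hm2 : ((2 * m).factorial : ℂ) ≠ 0 := by exact_mod_cast (2 * m).factorial_ne_zero
    have hG' : ((Real.Gamma (m + ν + 1) : ℝ) : ℂ) ≠ 0 := by exact_mod_cast hG
    rw [pow_mul, mul_pow, Complex.I_sq]
    push_cast
    have e4 : (-((t : ℂ) ^ 2 / 4)) ^ m = ((t : ℂ) ^ 2 * -1) ^ m / 4 ^ m := by
      rw [← div_pow]; congr 1; ring
    rw [e4]
    field_simp
  · intro n hn
    rcases Nat.even_or_odd' n with ⟨m, rfl | rfl⟩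
    · exact absurd ⟨m, rfl⟩ hn
    · rw [hodd]; simp

/-- Polar coordinates, for functions that need not be radial. -/
theorem integral_eq_integral_toSphere_prod {E F : Type*} [NormedAddCommGroup E] [NormedSpace ℝ E]
    [MeasurableSpace E] [BorelSpace E] [FiniteDimensional ℝ E] [Nontrivial E]
    [NormedAddCommGroup F] [NormedSpace ℝ F]
    (μ : Measure E) [μ.IsAddHaarMeasure] (f : E → F) :
    ∫ x, f x ∂μ = ∫ p : Metric.sphere (0 : E) 1 × Set.Ioi (0 : ℝ), f ((p.2 : ℝ) • (p.1 : E))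
      ∂(μ.toSphere.prod (.volumeIoiPow (Module.finrank ℝ E - 1))) := by
  calc ∫ x, f x ∂μ = ∫ x : ({(0)}ᶜ : Set E), f x.1 ∂(μ.comap (↑)) := by
        rw [integral_subtype_comap (measurableSet_singleton _).compl fun x ↦ f x,
          restrict_compl_singleton]
    _ = _ := by
        rw [← μ.measurePreserving_homeomorphUnitSphereProd.integral_comp
          (Homeomorph.measurableEmbedding _)]
        congr 1; ext x
        congr 1
        have hx : ‖(x : E)‖ ≠ 0 := norm_ne_zero_iff.2 x.2
        simp [smul_smul, hx]

theorem integrable_iff_integrable_toSphere_prod {E F : Type*} [NormedAddCommGroup E]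
    [NormedSpace ℝ E] [MeasurableSpace E] [BorelSpace E] [FiniteDimensional ℝ E] [Nontrivial E]
    [NormedAddCommGroup F]
    (μ : Measure E) [μ.IsAddHaarMeasure] (f : E → F) :
    Integrable f μ ↔ Integrable
      (fun p : Metric.sphere (0 : E) 1 × Set.Ioi (0 : ℝ) => f ((p.2 : ℝ) • (p.1 : E)))
      (μ.toSphere.prod (.volumeIoiPow (Module.finrank ℝ E - 1))) := by
  have h : Integrable f μ ↔ IntegrableOn f {0}ᶜ μ := by
    rw [IntegrableOn, restrict_compl_singleton]
  rw [h, integrableOn_iff_comap_subtypeVal (measurableSet_singleton _).compl,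
    ← μ.measurePreserving_homeomorphUnitSphereProd.integrable_comp_emb
      (Homeomorph.measurableEmbedding _)]
  refine iff_of_eq ?_
  congr 1
  ext x
  have hx : ‖(x : E)‖ ≠ 0 := norm_ne_zero_iff.2 x.2
  simp [smul_smul, hx]

theorem integral_volumeIoiPow {F : Type*} [NormedAddCommGroup F] [NormedSpace ℝ F]
    (n : ℕ) (f : ℝ → F) :
    ∫ r : Set.Ioi (0 : ℝ), f r ∂(Measure.volumeIoiPow n) = ∫ r in Set.Ioi (0 : ℝ), r ^ n • f r := by
  simp only [Measure.volumeIoiPow, ENNReal.ofReal]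
  rw [integral_withDensity_eq_integral_smul,
    integral_subtype_comap measurableSet_Ioi fun a ↦ Real.toNNReal (a ^ n) • f a,
    setIntegral_congr_fun measurableSet_Ioi fun x hx ↦ ?_]
  · rw [NNReal.smul_def, Real.coe_toNNReal _ (pow_nonneg (Set.mem_Ioi.1 hx).le _)]
  · exact (measurable_subtype_coe.pow_const _).real_toNNReal

/-- The surface area of the unit sphere of `ℝ^d`. -/
noncomputable def sphereArea (d : ℕ) : ℝ :=
  (volume : Measure (EuclideanSpace ℝ (Fin d))).toSphere.real Set.univ

theorem sphereArea_pos {d : ℕ} (hd : 1 ≤ d) : 0 < sphereArea d := by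
  have : Nonempty (Fin d) := ⟨⟨0, hd⟩⟩
  rw [sphereArea, measureReal_def, ENNReal.toReal_pos_iff]
  refine ⟨?_, measure_lt_top _ _⟩
  rw [pos_iff_ne_zero, Ne, Measure.measure_univ_eq_zero]
  exact Measure.toSphere_ne_zero _

theorem isProbabilityMeasure_uniformSphere {d : ℕ} (hd : 1 ≤ d) :
    IsProbabilityMeasure (uniformSphere d) := by
  have : Nonempty (Fin d) := ⟨⟨0, hd⟩⟩
  constructor
  rw [uniformSphere, Measure.smul_apply, smul_eq_mul]
  refine ENNReal.inv_mul_cancel ?_ (measure_ne_top _ _)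
  rw [Ne, Measure.measure_univ_eq_zero]
  exact Measure.toSphere_ne_zero _

theorem integral_toSphere_eq {F : Type*} [NormedAddCommGroup F] [NormedSpace ℝ F]
    {d : ℕ} (hd : 1 ≤ d) (f : UnitSphere d → F) :
    ∫ x, f x ∂(volume : Measure (EuclideanSpace ℝ (Fin d))).toSphere
      = sphereArea d • ∫ x, f x ∂(uniformSphere d) := by
  rw [uniformSphere, integral_smul_measure, smul_smul, ENNReal.toReal_inv]
  have := sphereArea_pos hd
  rw [sphereArea, measureReal_def] at this ⊢
  rw [mul_inv_cancel₀ this.ne', one_smul]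

/-- Rotation invariance of the Gaussian weight: every direction `e` may be replaced by a coordinate
direction. -/
theorem integral_inner_pow_eq_coord {d : ℕ} (i : Fin d) {e : EuclideanSpace ℝ (Fin d)}
    (he : ‖e‖ = 1) (m : ℕ) :
    ∫ y : EuclideanSpace ℝ (Fin d), inner ℝ e y ^ m * Real.exp (-‖y‖ ^ 2)
      = ∫ y : EuclideanSpace ℝ (Fin d), y i ^ m * Real.exp (-‖y‖ ^ 2) := by
  obtain ⟨b, hb⟩ := Orthonormal.exists_orthonormalBasis_extension_of_card_eq
    (𝕜 := ℝ) (E := EuclideanSpace ℝ (Fin d)) (ι := Fin d) (by simp) (v := fun _ => e) (s := {i})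
    (by
      rw [orthonormal_iff_ite]
      rintro ⟨a, ha⟩ ⟨c, hc⟩
      obtain rfl : a = i := ha
      obtain rfl : c = a := hc
      simp [he])
  have hbi : b i = e := hb i rfl
  rw [← b.measurePreserving_repr.integral_comp b.repr.toHomeomorph.measurableEmbedding
    (fun y : EuclideanSpace ℝ (Fin d) => y i ^ m * Real.exp (-‖y‖ ^ 2))]
  congr 1; ext y
  rw [b.repr_apply_apply, hbi, LinearIsometryEquiv.norm_map]

theorem integral_pow_mul_exp_neg_sq (m : ℕ) :
    ∫ y : ℝ, y ^ (2 * m) * Real.exp (-y ^ 2) = Real.Gamma (m + 1 / 2) := by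
  have h := integral_rpow_mul_exp_neg_rpow (p := 2) (q := (2 * m : ℕ)) (by norm_num)
    (by have : (0 : ℝ) ≤ (2 * m : ℕ) := Nat.cast_nonneg _
        linarith)
  have h2 := integral_comp_abs (f := fun y : ℝ => y ^ (2 * m) * Real.exp (-y ^ 2))
  have e : ∀ y : ℝ, |y| ^ (2 * m) * Real.exp (-|y| ^ 2) = y ^ (2 * m) * Real.exp (-y ^ 2) := by
    intro y; rw [sq_abs, pow_mul, sq_abs, pow_mul]
  simp_rw [e] at h2
  rw [h2]
  simp_rw [Real.rpow_natCast, Real.rpow_two] at h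
  rw [h]
  have : (((2 * m : ℕ) : ℝ) + 1) / 2 = m + 1 / 2 := by push_cast; ring
  rw [this]; ring

theorem integral_coord_pow {d : ℕ} (i : Fin d) (m : ℕ) :
    ∫ y : EuclideanSpace ℝ (Fin d), y i ^ (2 * m) * Real.exp (-‖y‖ ^ 2)
      = Real.Gamma (m + 1 / 2) * Real.Gamma (1 / 2) ^ (d - 1) := by
  have h1 := (EuclideanSpace.volume_preserving_symm_measurableEquiv_toLp (Fin d)).symm.integral_comp
    (MeasurableEquiv.measurableEmbedding _)
    (fun y : EuclideanSpace ℝ (Fin d) => y i ^ (2 * m) * Real.exp (-‖y‖ ^ 2))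
  rw [← h1]
  have h2 : ∀ y : Fin d → ℝ,
      (((MeasurableEquiv.toLp 2 (Fin d → ℝ)).symm.symm y) i ^ (2 * m) *
        Real.exp (-‖(MeasurableEquiv.toLp 2 (Fin d → ℝ)).symm.symm y‖ ^ 2))
      = ∏ l, (y l ^ (2 * if l = i then m else 0) * Real.exp (-(y l) ^ 2)) := by
    intro y
    rw [Finset.prod_mul_distrib, ← Real.exp_sum, EuclideanSpace.norm_sq_eq]
    simp only [MeasurableEquiv.symm_symm, MeasurableEquiv.toLp_apply, Real.norm_eq_abs, sq_abs,
      Finset.sum_neg_distrib]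
    congr 1
    rw [Finset.prod_eq_single i]
    · simp
    · intro l _ hl; simp [hl]
    · simp
  simp_rw [h2]
  rw [integral_fintype_prod_volume_eq_prod
    (fun l (x : ℝ) => x ^ (2 * if l = i then m else 0) * Real.exp (-x ^ 2))]
  simp_rw [integral_pow_mul_exp_neg_sq]
  rw [← Finset.mul_prod_erase _ _ (Finset.mem_univ i)]
  simp only [if_true]
  congr 1
  rw [Finset.prod_congr rfl (g := fun _ => Real.Gamma (1 / 2))]
  · simp [Finset.prod_const, Finset.card_erase_of_mem]
  · intro l hl
    simp [Finset.ne_of_mem_erase hl]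

/-- The Gaussian moments in direction `e`, in polar coordinates: the radial integral splits off as a
Gamma factor, which leaves the moments of the uniform distribution on the sphere. -/
theorem integral_inner_pow_polar {d : ℕ} (hd : 1 ≤ d) (e : EuclideanSpace ℝ (Fin d)) (m : ℕ) :
    ∫ y : EuclideanSpace ℝ (Fin d), inner ℝ e y ^ m * Real.exp (-‖y‖ ^ 2)
      = sphereArea d * (∫ X : UnitSphere d, inner ℝ e (X : EuclideanSpace ℝ (Fin d)) ^ m
          ∂(uniformSphere d)) * (Real.Gamma ((m + d) / 2) / 2) := by
  have : Nonempty (Fin d) := ⟨⟨0, hd⟩⟩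
  rw [integral_eq_integral_toSphere_prod]
  have h1 : ∀ p : UnitSphere d × Set.Ioi (0 : ℝ),
      inner ℝ e ((p.2 : ℝ) • (p.1 : EuclideanSpace ℝ (Fin d))) ^ m
        * Real.exp (-‖(p.2 : ℝ) • (p.1 : EuclideanSpace ℝ (Fin d))‖ ^ 2)
      = inner ℝ e (p.1 : EuclideanSpace ℝ (Fin d)) ^ m
        * ((p.2 : ℝ) ^ m * Real.exp (-(p.2 : ℝ) ^ 2)) := by
    intro p
    have : ‖(p.1 : EuclideanSpace ℝ (Fin d))‖ = 1 := by simp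
    rw [inner_smul_right, norm_smul, this, mul_one, Real.norm_eq_abs, sq_abs, mul_pow]
    ring
  simp_rw [h1]
  rw [integral_prod_mul (fun X : UnitSphere d => inner ℝ e (X : EuclideanSpace ℝ (Fin d)) ^ m)
    (fun r : Set.Ioi (0 : ℝ) => (r : ℝ) ^ m * Real.exp (-(r : ℝ) ^ 2)),
    integral_toSphere_eq hd, smul_eq_mul]
  congr 1
  rw [integral_volumeIoiPow _ (fun r : ℝ => r ^ m * Real.exp (-r ^ 2))]
  have h := integral_rpow_mul_exp_neg_rpow (p := 2) (q := (d - 1 + m : ℕ)) (by norm_num)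
    (by have : (0 : ℝ) ≤ (d - 1 + m : ℕ) := Nat.cast_nonneg _
        linarith)
  simp_rw [Real.rpow_natCast, Real.rpow_two] at h
  simp only [smul_eq_mul, finrank_euclideanSpace, Fintype.card_fin]
  simp_rw [← mul_assoc, ← pow_add]
  rw [h]
  have : (((d - 1 + m : ℕ) : ℝ) + 1) / 2 = (m + d) / 2 := by
    push_cast [Nat.cast_sub hd]; ring
  rw [this]; ring

theorem Gamma_natCast_add_half (m : ℕ) :
    Real.Gamma (m + 1 / 2) = ((2 * m).factorial : ℝ) / (4 ^ m * m.factorial)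
      * Real.Gamma (1 / 2) := by
  induction m with
  | zero => simp
  | succ m ih =>
    have e : ((m + 1 : ℕ) : ℝ) + 1 / 2 = (m + 1 / 2) + 1 := by push_cast; ring
    have e2 : 2 * (m + 1) = 2 * m + 1 + 1 := by ring
    rw [e, Real.Gamma_add_one (by positivity), ih, e2]
    simp only [Nat.factorial_succ]
    have h1 : (m.factorial : ℝ) ≠ 0 := by positivity
    push_cast
    field_simp
    ring

/-- The even moments of a coordinate of a uniform point of the sphere, from the comparison of the
Gaussian moments computed in polar and in Cartesian coordinates. -/
theorem integral_inner_pow_even {d : ℕ} (hd : 1 ≤ d) {e : EuclideanSpace ℝ (Fin d)}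
    (he : ‖e‖ = 1) (m : ℕ) :
    ∫ X : UnitSphere d, inner ℝ e (X : EuclideanSpace ℝ (Fin d)) ^ (2 * m) ∂(uniformSphere d)
      = ((2 * m).factorial : ℝ) * Real.Gamma (d / 2)
      / (4 ^ m * m.factorial * Real.Gamma (m + d / 2)) := by
  have := isProbabilityMeasure_uniformSphere hd
  have h := fun m : ℕ => (integral_inner_pow_polar hd e (2 * m)).symm.trans
    ((integral_inner_pow_eq_coord ⟨0, hd⟩ he (2 * m)).trans (integral_coord_pow ⟨0, hd⟩ m))
  have ec : ∀ m : ℕ, (((2 * m : ℕ) : ℝ) + d) / 2 = m + d / 2 := fun m => by push_cast; ring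
  simp_rw [ec] at h
  have h0 := h 0
  have hm := h m
  have hω := (sphereArea_pos hd).ne'
  have hd' : (0 : ℝ) < d := by exact_mod_cast hd
  have hG : 0 < Real.Gamma (d / 2) := Real.Gamma_pos_of_pos (by positivity)
  have hGm : 0 < Real.Gamma (m + d / 2) := Real.Gamma_pos_of_pos (by positivity)
  rw [Gamma_natCast_add_half] at hm
  simp only [Nat.cast_zero, mul_zero, zero_add, pow_zero, integral_const, probReal_univ, smul_eq_mul,
    mul_one] at h0
  have hm1 : (m.factorial : ℝ) ≠ 0 := by positivity
  set I := ∫ X : UnitSphere d, inner ℝ e (X : EuclideanSpace ℝ (Fin d)) ^ (2 * m)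
    ∂(uniformSphere d)
  rw [mul_assoc (_ / _), ← h0] at hm
  have hm' : I * Real.Gamma (m + d / 2)
      = ((2 * m).factorial : ℝ) / (4 ^ m * m.factorial) * Real.Gamma (d / 2) := by
    apply mul_left_cancel₀ hω
    linear_combination 2 * hm
  rw [eq_div_iff (by positivity)]
  generalize Real.Gamma (m + d / 2) = g at hm' ⊢
  field_simp at hm'
  linear_combination hm'

theorem integral_inner_pow_odd {d : ℕ} (hd : 1 ≤ d) (e : EuclideanSpace ℝ (Fin d)) (m : ℕ) :
    ∫ X : UnitSphere d, inner ℝ e (X : EuclideanSpace ℝ (Fin d)) ^ (2 * m + 1) ∂(uniformSphere d)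
      = 0 := by
  have h := integral_inner_pow_polar hd e (2 * m + 1)
  have h2 : ∫ y : EuclideanSpace ℝ (Fin d), inner ℝ e y ^ (2 * m + 1) * Real.exp (-‖y‖ ^ 2)
      = -∫ y : EuclideanSpace ℝ (Fin d), inner ℝ e y ^ (2 * m + 1) * Real.exp (-‖y‖ ^ 2) := by
    rw [← integral_neg, ← integral_neg_eq_self]
    congr 1; ext y
    rw [inner_neg_right, norm_neg, Odd.neg_pow ⟨m, rfl⟩]
    ring
  have h3 : ∫ y : EuclideanSpace ℝ (Fin d), inner ℝ e y ^ (2 * m + 1) * Real.exp (-‖y‖ ^ 2) = 0 := by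
    linarith
  have hd' : (0 : ℝ) < d := by exact_mod_cast hd
  have hG : 0 < Real.Gamma ((((2 * m + 1 : ℕ) : ℝ) + d) / 2) :=
    Real.Gamma_pos_of_pos (by positivity)
  rw [h3] at h
  have hω := (sphereArea_pos hd).ne'
  rcases mul_eq_zero.1 h.symm with h | h
  · exact (mul_eq_zero.1 h).resolve_left hω
  · linarith

/-- The characteristic function of the uniform distribution on the sphere is `ξ ↦ j_ν(‖ξ‖)`. -/
theorem integral_cexp_inner_uniformSphere {d : ℕ} (hd : 2 ≤ d) {ν : ℝ}
    (hν : ν = (d : ℝ) / 2 - 1) (ξ : EuclideanSpace ℝ (Fin d)) :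
    ∫ X : UnitSphere d, Complex.exp ((inner ℝ ξ (X : EuclideanSpace ℝ (Fin d)) : ℝ) * Complex.I)
      ∂(uniformSphere d) = (normalizedBesselJ ν ‖ξ‖ : ℂ) := by
  have hd1 : 1 ≤ d := by omega
  have hd2 : (2 : ℝ) ≤ d := by exact_mod_cast hd
  have hν0 : 0 ≤ ν := by rw [hν]; linarith
  have := isProbabilityMeasure_uniformSphere hd1
  by_cases hξ : ξ = 0
  · simp [hξ, normalizedBesselJ_zero hν0]
  set e : EuclideanSpace ℝ (Fin d) := ‖ξ‖⁻¹ • ξ with he_def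
  have hξ' : ‖ξ‖ ≠ 0 := norm_ne_zero_iff.2 hξ
  have he : ‖e‖ = 1 := by rw [he_def, norm_smul, norm_inv, norm_norm, inv_mul_cancel₀ hξ']
  have hξe : ξ = ‖ξ‖ • e := by rw [he_def, smul_smul, mul_inv_cancel₀ hξ', one_smul]
  have key := integral_cexp_eq_normalizedBesselJ (uniformSphere d)
    (Y := fun X : UnitSphere d => inner ℝ e (X : EuclideanSpace ℝ (Fin d)))
    (by fun_prop) (fun X => by
      have := abs_real_inner_le_norm e (X : EuclideanSpace ℝ (Fin d))
      simpa [he] using this)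
    hν0 (integral_inner_pow_odd hd1 e) (fun m => by
      have e1 : ν + 1 = d / 2 := by rw [hν]; ring
      rw [integral_inner_pow_even hd1 he, add_assoc, e1]) ‖ξ‖
  rw [← key]
  congr 1; ext X
  nth_rewrite 1 [hξe]
  rw [real_inner_smul_left]
  push_cast; rfl

/-! ### Fourier inversion for the law of the distance -/

/-- The integrand `t^{d-1} j_ν(r t) j_ν(t)^n` of the radial inversion formula. -/
noncomputable def walkKernel (d n : ℕ) (ν r t : ℝ) : ℝ :=
  t ^ (d - 1) * normalizedBesselJ ν (r * t) * normalizedBesselJ ν t ^ n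

theorem continuous_walkKernel (d n : ℕ) {ν : ℝ} (hν : 0 ≤ ν) :
    Continuous fun p : ℝ × ℝ => walkKernel d n ν p.1 p.2 := by
  have := continuous_normalizedBesselJ hν
  unfold walkKernel
  fun_prop

/-- The constant `ω_d² / (2π)^d = 2^{-2ν} / Γ(ν + 1)²`. -/
theorem sphereArea_sq_div {d : ℕ} (hd : 2 ≤ d) {ν : ℝ} (hν : ν = (d : ℝ) / 2 - 1) :
    sphereArea d ^ 2 / (2 * Real.pi) ^ d = ((2 : ℝ) ^ (-ν) / Real.Gamma (ν + 1)) ^ 2 := by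
  have hd1 : 1 ≤ d := by omega
  have hd' : (0 : ℝ) < d := by exact_mod_cast hd1
  have := isProbabilityMeasure_uniformSphere hd1
  have he : ‖EuclideanSpace.single (⟨0, hd1⟩ : Fin d) (1 : ℝ)‖ = 1 := by simp
  have h := (integral_inner_pow_polar hd1 _ 0).symm.trans
    ((integral_inner_pow_eq_coord ⟨0, hd1⟩ he (2 * 0)).trans (integral_coord_pow ⟨0, hd1⟩ 0))
  simp only [Nat.cast_zero, zero_add, pow_zero, integral_const, probReal_univ, smul_eq_mul,
    mul_one] at h
  have e1 : ν + 1 = d / 2 := by rw [hν]; ring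
  have hG : 0 < Real.Gamma (d / 2) := Real.Gamma_pos_of_pos (by positivity)
  have h2 : sphereArea d * Real.Gamma (d / 2) = 2 * Real.Gamma (1 / 2) ^ d := by
    obtain ⟨k, rfl⟩ : ∃ k, d = k + 1 := ⟨d - 1, by omega⟩
    rw [pow_succ]
    simp only [Nat.add_sub_cancel] at h
    linear_combination 2 * h
  have h3 : (sphereArea d * Real.Gamma (d / 2)) ^ 2 = 4 * Real.pi ^ d := by
    rw [h2, mul_pow, ← pow_mul, mul_comm d 2, pow_mul, Real.Gamma_one_half_eq,
      Real.sq_sqrt Real.pi_pos.le]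
    norm_num
  have h4 : ((2 : ℝ) ^ (-ν)) ^ 2 = 4 / 2 ^ d := by
    rw [← Real.rpow_natCast, ← Real.rpow_mul (by norm_num)]
    have : -ν * (2 : ℕ) = 2 - d := by rw [hν]; push_cast; ring
    rw [this, Real.rpow_sub (by norm_num), Real.rpow_natCast]
    norm_num
  rw [div_pow, h4, e1, mul_pow, div_div, div_eq_div_iff (by positivity) (by positivity)]
  rw [mul_pow] at h3
  linear_combination 2 ^ d * h3

/-- The truncated Bessel integral is the truncated radial inversion integral. -/
theorem besselIntegral_eq {d : ℕ} (hd : 2 ≤ d) {ν : ℝ} (hν : ν = (d : ℝ) / 2 - 1) (n : ℕ)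
    {x T : ℝ} (hx : 0 < x) (hT : 0 ≤ T) :
    besselIntegral ν n x T = sphereArea d ^ 2 / (2 * Real.pi) ^ d *
      (x ^ (d - 1) * ∫ t in (0 : ℝ)..T, walkKernel d n ν x t) := by
  have key : ∫ t in (0 : ℝ)..T, (t * x) ^ (ν + 1) * besselJ ν (t * x) * normalizedBesselJ ν t ^ n
      = ∫ t in (0 : ℝ)..T, (2 : ℝ) ^ (-ν) / Real.Gamma (ν + 1) *
        (x ^ (d - 1) * walkKernel d n ν x t) := by
    simp only [intervalIntegral.integral_of_le hT]
    refine setIntegral_congr_fun measurableSet_Ioc fun t ht => ?_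
    have ht0 : 0 < t := ht.1
    have h0 : 0 < t * x := by positivity
    have hd2 : (2 : ℝ) ≤ d := by exact_mod_cast hd
    have hG : Real.Gamma (ν + 1) ≠ 0 :=
      (Real.Gamma_pos_of_pos (by rw [hν]; linarith)).ne'
    have e1 : (t * x) ^ (ν + 1) * (t * x) ^ ν = t ^ (d - 1) * x ^ (d - 1) := by
      rw [← Real.rpow_add h0, ← mul_pow, ← Real.rpow_natCast, Nat.cast_sub (by omega)]
      congr 1
      rw [hν]; push_cast; ring
    have e2 : besselJ ν (t * x) = (t * x) ^ ν * 2 ^ (-ν) / Real.Gamma (ν + 1)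
        * normalizedBesselJ ν (x * t) := by
      rw [besselJ, normalizedBesselJ, Real.div_rpow h0.le (by norm_num), Real.rpow_neg (by norm_num),
        mul_comm x t]
      field_simp
    simp only [walkKernel, e2]
    linear_combination (2 ^ (-ν) / Real.Gamma (ν + 1) * normalizedBesselJ ν (x * t)
      * normalizedBesselJ ν t ^ n) * e1
  rw [besselIntegral, key, intervalIntegral.integral_const_mul, intervalIntegral.integral_const_mul,
    sphereArea_sq_div hd hν]
  ring

theorem isProbabilityMeasure_stepsLaw {d : ℕ} (hd : 1 ≤ d) (n : ℕ) :
    IsProbabilityMeasure (stepsLaw d n) := by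
  have := isProbabilityMeasure_uniformSphere hd
  unfold stepsLaw
  infer_instance

/-- By independence, the characteristic function of the sum of `n` steps is `ξ ↦ j_ν(‖ξ‖)^n`. -/
theorem integral_cexp_inner_stepsLaw {d : ℕ} (hd : 2 ≤ d) (n : ℕ) {ν : ℝ}
    (hν : ν = (d : ℝ) / 2 - 1) (ξ : EuclideanSpace ℝ (Fin d)) :
    ∫ X, Complex.exp ((inner ℝ ξ (∑ i, (X i : EuclideanSpace ℝ (Fin d))) : ℝ) * Complex.I)
      ∂(stepsLaw d n) = (normalizedBesselJ ν ‖ξ‖ : ℂ) ^ n := by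
  have := isProbabilityMeasure_uniformSphere (d := d) (by omega)
  have h : ∀ X : Fin n → UnitSphere d,
      Complex.exp ((inner ℝ ξ (∑ i, (X i : EuclideanSpace ℝ (Fin d))) : ℝ) * Complex.I)
      = ∏ i, Complex.exp ((inner ℝ ξ (X i : EuclideanSpace ℝ (Fin d)) : ℝ) * Complex.I) := by
    intro X
    rw [inner_sum, ← Complex.exp_sum]
    push_cast
    rw [Finset.sum_mul]
  simp_rw [h]
  rw [stepsLaw, integral_fintype_prod_eq_prod
    (fun _ (X : UnitSphere d) => Complex.exp ((inner ℝ ξ (X : EuclideanSpace ℝ (Fin d)) : ℝ)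
      * Complex.I))]
  simp [integral_cexp_inner_uniformSphere hd hν]

section Radial

variable {d : ℕ} {φ : ℝ → ℝ} {a b : ℝ}

theorem contDiff_comp_norm (ha : 0 < a) (hφ : ContDiff ℝ ((⊤ : ℕ∞) : WithTop ℕ∞) φ)
    (hsupp : ∀ r, r ∉ Set.Icc a b → φ r = 0) :
    ContDiff ℝ ((⊤ : ℕ∞) : WithTop ℕ∞)
      (fun y : EuclideanSpace ℝ (Fin d) => ((φ ‖y‖ : ℝ) : ℂ)) := by
  refine Complex.ofRealCLM.contDiff.comp ?_
  rw [contDiff_iff_contDiffAt]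
  intro y
  by_cases hy : y = 0
  · subst hy
    refine (contDiffAt_const (c := (0 : ℝ))).congr_of_eventuallyEq ?_
    filter_upwards [Metric.ball_mem_nhds (0 : EuclideanSpace ℝ (Fin d)) ha] with z hz
    refine hsupp _ fun h => ?_
    rw [mem_ball_zero_iff] at hz
    linarith [h.1]
  · exact hφ.contDiffAt.comp y (contDiffAt_norm ℝ hy)

theorem hasCompactSupport_comp_norm (hsupp : ∀ r, r ∉ Set.Icc a b → φ r = 0) :
    HasCompactSupport (fun y : EuclideanSpace ℝ (Fin d) => ((φ ‖y‖ : ℝ) : ℂ)) := by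
  refine HasCompactSupport.intro (isCompact_closedBall 0 b) fun y hy => ?_
  rw [mem_closedBall_zero_iff] at hy
  simp [hsupp ‖y‖ fun h => hy h.2]

/-- The Fourier transform of a radial function is a Hankel transform of its profile. -/
theorem integral_radial_mul_cexp (hd : 2 ≤ d) {ν : ℝ} (hν : ν = (d : ℝ) / 2 - 1)
    (hφi : Integrable fun y : EuclideanSpace ℝ (Fin d) => ((φ ‖y‖ : ℝ) : ℂ))
    (ξ : EuclideanSpace ℝ (Fin d)) :
    ∫ y : EuclideanSpace ℝ (Fin d),
      Complex.exp ((inner ℝ ξ y : ℝ) * Complex.I) * ((φ ‖y‖ : ℝ) : ℂ)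
    = ((sphereArea d * ∫ r in Set.Ioi (0 : ℝ), r ^ (d - 1) *
        (φ r * normalizedBesselJ ν (r * ‖ξ‖)) : ℝ) : ℂ) := by
  have : Nonempty (Fin d) := ⟨⟨0, by omega⟩⟩
  have hint : Integrable fun y : EuclideanSpace ℝ (Fin d) =>
      Complex.exp ((inner ℝ ξ y : ℝ) * Complex.I) * ((φ ‖y‖ : ℝ) : ℂ) := by
    refine hφi.bdd_mul (c := 1) (by fun_prop) (Eventually.of_forall fun y => ?_)
    rw [Complex.norm_exp_ofReal_mul_I]
  rw [integral_eq_integral_toSphere_prod]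
  rw [integrable_iff_integrable_toSphere_prod] at hint
  rw [integral_prod_symm _ hint]
  have h1 : ∀ r : Set.Ioi (0 : ℝ), ∫ u : UnitSphere d,
      Complex.exp ((inner ℝ ξ ((r : ℝ) • (u : EuclideanSpace ℝ (Fin d))) : ℝ) * Complex.I)
        * ((φ ‖(r : ℝ) • (u : EuclideanSpace ℝ (Fin d))‖ : ℝ) : ℂ)
        ∂(volume : Measure (EuclideanSpace ℝ (Fin d))).toSphere
      = ((sphereArea d * (φ r * normalizedBesselJ ν (r * ‖ξ‖)) : ℝ) : ℂ) := by
    intro r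
    have hr : (0 : ℝ) < r := r.2
    rw [integral_toSphere_eq (by omega)]
    have h2 : ∀ u : UnitSphere d,
      Complex.exp ((inner ℝ ξ ((r : ℝ) • (u : EuclideanSpace ℝ (Fin d))) : ℝ) * Complex.I)
        * ((φ ‖(r : ℝ) • (u : EuclideanSpace ℝ (Fin d))‖ : ℝ) : ℂ)
      = Complex.exp ((inner ℝ ((r : ℝ) • ξ) (u : EuclideanSpace ℝ (Fin d)) : ℝ) * Complex.I)
        * ((φ r : ℝ) : ℂ) := by
      intro u
      have hu : ‖(u : EuclideanSpace ℝ (Fin d))‖ = 1 := by simp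
      rw [norm_smul, hu, mul_one, Real.norm_of_nonneg hr.le, inner_smul_right, inner_smul_left]
      simp
    simp_rw [h2]
    rw [integral_mul_const, integral_cexp_inner_uniformSphere hd hν, norm_smul,
      Real.norm_of_nonneg hr.le, Complex.real_smul]
    push_cast; ring
  simp_rw [h1]
  rw [integral_complex_ofReal, integral_const_mul]
  congr 2
  rw [integral_volumeIoiPow _ (fun r : ℝ => φ r * normalizedBesselJ ν (r * ‖ξ‖))]
  simp

theorem sphereArea_eq_finrank_smul (d : ℕ) :
    sphereArea d = Module.finrank ℝ (EuclideanSpace ℝ (Fin d)) •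
      (volume : Measure (EuclideanSpace ℝ (Fin d))).real (Metric.ball 0 1) := by
  rw [sphereArea, Measure.toSphere_real_apply_univ, nsmul_eq_mul]

/-- The Hankel transform of the profile `φ`. -/
noncomputable def hankelProfile (d : ℕ) (ν : ℝ) (φ : ℝ → ℝ) (t : ℝ) : ℝ :=
  ∫ r in Set.Ioi (0 : ℝ), r ^ (d - 1) * (φ r * normalizedBesselJ ν (r * t))

/-- The expectation of a radial test function of the walk, by Fourier inversion in `ℝ^d` and polar
coordinates. -/
theorem integral_stepsLaw_radial (hd : 2 ≤ d) (n : ℕ) {ν : ℝ} (hν : ν = (d : ℝ) / 2 - 1)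
    (ha : 0 < a) (hφ : ContDiff ℝ ((⊤ : ℕ∞) : WithTop ℕ∞) φ)
    (hsupp : ∀ r, r ∉ Set.Icc a b → φ r = 0) :
    IntegrableOn (fun t => t ^ (d - 1) * (hankelProfile d ν φ t * normalizedBesselJ ν t ^ n))
      (Set.Ioi 0) ∧
    ∫ X, φ ‖∑ i, (X i : EuclideanSpace ℝ (Fin d))‖ ∂(stepsLaw d n)
      = sphereArea d ^ 2 / (2 * Real.pi) ^ d * ∫ t in Set.Ioi (0 : ℝ),
          t ^ (d - 1) * (hankelProfile d ν φ t * normalizedBesselJ ν t ^ n) := by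
  have : Nonempty (Fin d) := ⟨⟨0, by omega⟩⟩
  have hprob := isProbabilityMeasure_stepsLaw (d := d) (by omega) n
  have hpi : 0 < 2 * Real.pi := by positivity
  let E := EuclideanSpace ℝ (Fin d)
  let Φ : SchwartzMap E ℂ := (hasCompactSupport_comp_norm (d := d) hsupp).toSchwartzMap
    (contDiff_comp_norm ha hφ hsupp)
  have hΦ : ∀ y, Φ y = ((φ ‖y‖ : ℝ) : ℂ) := fun y => rfl
  let g : ℝ → ℝ := fun t => sphereArea d * hankelProfile d ν φ t
  let h : ℝ → ℝ := fun t => hankelProfile d ν φ t * normalizedBesselJ ν t ^ n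
  let S : (Fin n → UnitSphere d) → E := fun X => ∑ i, (X i : E)
  have hS : Measurable S := by
    refine Finset.measurable_sum _ fun i _ => ?_
    exact measurable_subtype_coe.comp (measurable_pi_apply i)
  have hFΦ : ∀ ξ : E, FourierTransform.fourier (Φ : E → ℂ) ξ
      = ((g ‖(2 * Real.pi) • ξ‖ : ℝ) : ℂ) := by
    intro ξ
    rw [Real.fourier_eq, show g ‖(2 * Real.pi) • ξ‖ = g ‖-((2 * Real.pi) • ξ)‖ by rw [norm_neg],
      show ((g ‖-((2 * Real.pi) • ξ)‖ : ℝ) : ℂ) = _ from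
        (integral_radial_mul_cexp hd hν Φ.integrable _).symm]
    congr 1; ext y
    rw [Circle.smul_def, Real.fourierChar_apply, smul_eq_mul, hΦ]
    congr 3
    rw [inner_neg_left, inner_smul_left, real_inner_comm]
    simp
  -- the inversion theorem applies to the Schwartz function `Φ`
  have hFi : Integrable (FourierTransform.fourier (Φ : E → ℂ)) := by
    rw [← SchwartzMap.fourier_coe]
    exact SchwartzMap.integrable _
  have hinv : ∀ y : E, ((φ ‖y‖ : ℝ) : ℂ) = ∫ ξ : E, FourierTransform.fourier (Φ : E → ℂ) ξ
      * Complex.exp ((inner ℝ ((2 * Real.pi) • ξ) y : ℝ) * Complex.I) := by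
    intro y
    have := congrFun (Φ.continuous.fourierInv_fourier_eq Φ.integrable hFi) y
    rw [← hΦ, ← this, Real.fourierInv_eq]
    congr 1; ext ξ
    rw [Circle.smul_def, Real.fourierChar_apply, smul_eq_mul, mul_comm]
    congr 3
    rw [inner_smul_left]
    simp
  have hchar : ∀ ξ : E, ∫ X, Complex.exp ((inner ℝ ((2 * Real.pi) • ξ) (S X) : ℝ) * Complex.I)
      ∂(stepsLaw d n) = ((normalizedBesselJ ν ‖(2 * Real.pi) • ξ‖ ^ n : ℝ) : ℂ) := by
    intro ξ
    rw [integral_cexp_inner_stepsLaw hd n hν]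
    push_cast; rfl
  have hchar_le : ∀ ξ : E, ‖((normalizedBesselJ ν ‖(2 * Real.pi) • ξ‖ ^ n : ℝ) : ℂ)‖ ≤ 1 := by
    intro ξ
    rw [← hchar]
    refine (norm_integral_le_of_norm_le_const (C := 1) (Eventually.of_forall fun X => ?_)).trans ?_
    · rw [Complex.norm_exp_ofReal_mul_I]
    · simp
  have hν0 : 0 ≤ ν := by
    have : (2 : ℝ) ≤ d := by exact_mod_cast hd
    rw [hν]; linarith
  have hjc := continuous_normalizedBesselJ hν0
  have hprod : ∀ ξ : E, FourierTransform.fourier (Φ : E → ℂ) ξ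
      * ((normalizedBesselJ ν ‖(2 * Real.pi) • ξ‖ ^ n : ℝ) : ℂ)
      = ((sphereArea d * h ‖(2 * Real.pi) • ξ‖ : ℝ) : ℂ) := by
    intro ξ
    rw [hFΦ]
    simp only [g, h]
    push_cast; ring
  have hint : Integrable fun ξ : E => sphereArea d * h ‖(2 * Real.pi) • ξ‖ := by
    have : Integrable fun ξ : E => ((normalizedBesselJ ν ‖(2 * Real.pi) • ξ‖ ^ n : ℝ) : ℂ)
        * FourierTransform.fourier (Φ : E → ℂ) ξ :=
      hFi.bdd_mul (c := 1) (by fun_prop) (Eventually.of_forall hchar_le)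
    have h2 := this.re
    refine h2.congr (Eventually.of_forall fun ξ => ?_)
    change (RCLike.re (_ * _)) = _
    rw [mul_comm, hprod]
    rfl
  have hint1 : Integrable fun ξ : E => h ‖ξ‖ := by
    have h1 := (integrable_comp_smul_iff volume (fun ξ : E => sphereArea d * h ‖ξ‖) hpi.ne').1 hint
    have hω := sphereArea_pos (d := d) (by omega)
    simpa [hω.ne'] using h1.const_mul (sphereArea d)⁻¹
  refine ⟨?_, ?_⟩
  · have := (integrable_fun_norm_addHaar (volume : Measure E)).1 hint1
    simpa [E] using this
  -- Fubini turns the inversion formula, averaged over the walk, into a pairing of the Fourier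
  -- transform of `Φ` with the characteristic function of the walk
  have key : ((∫ X, φ ‖S X‖ ∂(stepsLaw d n) : ℝ) : ℂ)
      = ((∫ ξ : E, sphereArea d * h ‖(2 * Real.pi) • ξ‖ : ℝ) : ℂ) := by
    rw [← integral_complex_ofReal, ← integral_complex_ofReal]
    simp_rw [hinv]
    rw [integral_integral_swap]
    · congr 1; ext ξ
      rw [integral_const_mul, hchar, hprod]
    · have h1 : Integrable (fun p : (Fin n → UnitSphere d) × E =>
          FourierTransform.fourier (Φ : E → ℂ) p.2) ((stepsLaw d n).prod volume) :=
        hFi.comp_snd _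
      have hm : Measurable fun p : (Fin n → UnitSphere d) × E =>
          Complex.exp ((inner ℝ ((2 * Real.pi) • p.2) (S p.1) : ℝ) * Complex.I) := by
        have : Measurable fun p : (Fin n → UnitSphere d) × E => S p.1 := hS.comp measurable_fst
        fun_prop
      refine (h1.mul_bdd (c := 1) hm.aestronglyMeasurable (Eventually.of_forall fun p => ?_))
      rw [Complex.norm_exp_ofReal_mul_I]
  have key2 : ∫ X, φ ‖S X‖ ∂(stepsLaw d n) = ∫ ξ : E, sphereArea d * h ‖(2 * Real.pi) • ξ‖ :=
    Complex.ofReal_injective key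
  rw [key2, Measure.integral_comp_smul volume (fun ξ : E => sphereArea d * h ‖ξ‖),
    integral_const_mul, integral_fun_norm_addHaar (volume : Measure E) h, ← smul_assoc,
    ← sphereArea_eq_finrank_smul]
  simp only [E, finrank_euclideanSpace, Fintype.card_fin, smul_eq_mul]
  rw [abs_of_pos (by positivity)]
  have hh : ∀ y, h y = hankelProfile d ν φ y * normalizedBesselJ ν y ^ n := fun _ => rfl
  simp_rw [hh]
  ring

/-- The expectation of a radial test function is the limit of its integrals against the truncated
Bessel integrals. -/
theorem tendsto_integral_mul_besselIntegral (hd : 2 ≤ d) (n : ℕ) {ν : ℝ}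
    (hν : ν = (d : ℝ) / 2 - 1) (ha : 0 < a) (hab : a ≤ b)
    (hφ : ContDiff ℝ ((⊤ : ℕ∞) : WithTop ℕ∞) φ) (hsupp : ∀ r, r ∉ Set.Icc a b → φ r = 0) :
    Tendsto (fun T => ∫ r in a..b, φ r * besselIntegral ν n r T) atTop
      (𝓝 (∫ X, φ ‖∑ i, (X i : EuclideanSpace ℝ (Fin d))‖ ∂(stepsLaw d n))) := by
  have hν0 : 0 ≤ ν := by
    have : (2 : ℝ) ≤ d := by exact_mod_cast hd
    rw [hν]; linarith
  obtain ⟨hi, he⟩ := integral_stepsLaw_radial hd n hν ha hφ hsupp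
  rw [he]
  have hlim := (intervalIntegral_tendsto_integral_Ioi 0 hi tendsto_id).const_mul
    (sphereArea d ^ 2 / (2 * Real.pi) ^ d)
  refine hlim.congr' ?_
  filter_upwards [eventually_ge_atTop 0] with T hT
  have hk := continuous_walkKernel d n hν0
  -- write the Hankel transform as an integral over `r`, and exchange the order of integration
  have hH : ∀ t, t ^ (d - 1) * (hankelProfile d ν φ t * normalizedBesselJ ν t ^ n)
      = ∫ r in a..b, r ^ (d - 1) * (φ r * walkKernel d n ν r t) := by
    intro t
    have h1 : hankelProfile d ν φ t
        = ∫ r in a..b, r ^ (d - 1) * (φ r * normalizedBesselJ ν (r * t)) := by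
      rw [hankelProfile, intervalIntegral.integral_of_le hab, ← integral_Icc_eq_integral_Ioc]
      refine setIntegral_eq_of_subset_of_forall_sdiff_eq_zero measurableSet_Ioi
        (fun r hr => ha.trans_le hr.1) fun r hr => ?_
      simp [hsupp r hr.2]
    rw [h1, ← intervalIntegral.integral_mul_const, ← intervalIntegral.integral_const_mul]
    congr 1; ext r
    simp only [walkKernel]; ring
  simp_rw [hH, id]
  rw [intervalIntegral_intervalIntegral_swap, ← intervalIntegral.integral_const_mul]
  · simp only [intervalIntegral.integral_of_le hab]
    refine setIntegral_congr_fun measurableSet_Ioc fun r hr => ?_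
    rw [besselIntegral_eq hd hν n (ha.trans hr.1) hT, intervalIntegral.integral_const_mul,
      intervalIntegral.integral_const_mul]
    ring
  · have hc : Continuous (Function.uncurry fun t r : ℝ =>
        r ^ (d - 1) * (φ r * walkKernel d n ν r t)) := by
      have h1 := hφ.continuous
      have h2 : Continuous fun p : ℝ × ℝ => walkKernel d n ν p.2 p.1 :=
        hk.comp (continuous_snd.prodMk continuous_fst)
      unfold Function.uncurry
      fun_prop
    refine (hc.continuousOn.integrableOn_compact
      ((isCompact_uIcc (a := (0 : ℝ)) (b := T)).prod (isCompact_uIcc (a := a) (b := b)))).mono_set ?_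
    exact Set.prod_mono Set.uIoc_subset_uIcc Set.uIoc_subset_uIcc

end Radial

/-! ### Oscillatory integrals -/

/-- The tails of `∫ t^{-s} f(t) dt` beyond any `T ≥ 1` are at most `B T^{-s}`, for a continuous
function `f`. -/
structure OscillatoryBound (s B : ℝ) (f : ℝ → ℂ) : Prop where
  continuous : Continuous f
  bound : ∀ T₁ T₂ : ℝ, 1 ≤ T₁ → T₁ ≤ T₂ →
    ‖∫ t in T₁..T₂, ((t ^ (-s) : ℝ) : ℂ) * f t‖ ≤ B * T₁ ^ (-s)

theorem continuousOn_rpow_neg (s : ℝ) {T₁ T₂ : ℝ} (h1 : 1 ≤ T₁) (h2 : T₁ ≤ T₂) :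
    ContinuousOn (fun t : ℝ => t ^ (-s)) (Set.uIcc T₁ T₂) := by
  intro t ht
  rw [Set.uIcc_of_le h2] at ht
  exact (Real.continuousAt_rpow_const _ _ (Or.inl (by linarith [ht.1]))).continuousWithinAt

theorem integral_rpow_neg {s : ℝ} (hs : s ≠ 0) {T₁ T₂ : ℝ} (h1 : 1 ≤ T₁) (h2 : T₁ ≤ T₂) :
    ∫ t in T₁..T₂, t ^ (-s - 1) = (T₁ ^ (-s) - T₂ ^ (-s)) / s := by
  rw [integral_rpow (Or.inr ⟨fun h => hs (by linarith), ?_⟩)]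
  · have e : -s - 1 + 1 = -s := by ring
    rw [e]; field_simp; ring
  · rw [Set.uIcc_of_le h2]
    exact fun h => by linarith [h.1]

namespace OscillatoryBound

variable {s B B' : ℝ} {f g : ℝ → ℂ}

theorem intervalIntegrable (hf : OscillatoryBound s B f) {T₁ T₂ : ℝ} (h1 : 1 ≤ T₁)
    (h2 : T₁ ≤ T₂) :
    IntervalIntegrable (fun t => ((t ^ (-s) : ℝ) : ℂ) * f t) volume T₁ T₂ :=
  ((Complex.continuous_ofReal.comp_continuousOn (continuousOn_rpow_neg s h1 h2)).mul
    hf.continuous.continuousOn).intervalIntegrable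

theorem add (hf : OscillatoryBound s B f) (hg : OscillatoryBound s B' g) :
    OscillatoryBound s (B + B') (fun t => f t + g t) := by
  refine ⟨hf.continuous.add hg.continuous, fun T₁ T₂ h1 h2 => ?_⟩
  simp_rw [mul_add]
  rw [intervalIntegral.integral_add (hf.intervalIntegrable h1 h2) (hg.intervalIntegrable h1 h2),
    add_mul]
  exact (norm_add_le _ _).trans (add_le_add (hf.bound _ _ h1 h2) (hg.bound _ _ h1 h2))

theorem const_mul (hf : OscillatoryBound s B f) (c : ℂ) :
    OscillatoryBound s (‖c‖ * B) (fun t => c * f t) := by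
  refine ⟨hf.continuous.const_mul c, fun T₁ T₂ h1 h2 => ?_⟩
  simp_rw [mul_left_comm _ c]
  rw [intervalIntegral.integral_const_mul, norm_mul, mul_assoc]
  exact mul_le_mul_of_nonneg_left (hf.bound _ _ h1 h2) (norm_nonneg c)

theorem zero : OscillatoryBound s 0 (fun _ => 0) := ⟨continuous_const, by simp⟩

theorem sum {ι : Type*} (J : Finset ι) {F : ι → ℝ → ℂ} {b : ι → ℝ}
    (h : ∀ j ∈ J, OscillatoryBound s (b j) (F j)) :
    OscillatoryBound s (∑ j ∈ J, b j) (fun t => ∑ j ∈ J, F j t) := by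
  classical
  induction J using Finset.induction_on with
  | empty => simpa using zero
  | insert j J hj ih =>
    simp_rw [Finset.sum_insert hj]
    exact (h j (Finset.mem_insert_self _ _)).add
      (ih fun i hi => h i (Finset.mem_insert_of_mem hi))

/-- Integration by parts bounds the tails of an oscillatory integral of nonzero frequency. -/
theorem cexp (hs : 0 < s) {ω δ : ℝ} (hδ : 0 < δ) (hω : δ ≤ |ω|) :
    OscillatoryBound s (2 / δ) (fun t => Complex.exp ((ω * t : ℝ) * Complex.I)) := by
  refine ⟨by fun_prop, fun T₁ T₂ h1 h2 => ?_⟩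
  have hω0 : ω ≠ 0 := fun h => by rw [h, abs_zero] at hω; linarith
  have hc : (ω * Complex.I : ℂ) ≠ 0 := by simp [hω0]
  have hv : ∀ t : ℝ, HasDerivAt
      (fun t : ℝ => Complex.exp ((ω * t : ℝ) * Complex.I) / (ω * Complex.I))
      (Complex.exp ((ω * t : ℝ) * Complex.I)) t := by
    intro t
    have h0 : HasDerivAt (fun t : ℝ => ((ω * t : ℝ) : ℂ) * Complex.I) (ω * Complex.I) t := by
      have := ((hasDerivAt_id t).const_mul ω).ofReal_comp.mul_const Complex.I
      simpa using this
    have := h0.cexp.div_const (ω * Complex.I)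
    rwa [mul_div_assoc, div_self hc, mul_one] at this
  have hnorm : ∀ t : ℝ, ‖Complex.exp ((ω * t : ℝ) * Complex.I) / (ω * Complex.I)‖ = 1 / |ω| := by
    intro t
    rw [norm_div, Complex.norm_exp_ofReal_mul_I]
    simp
  have hu : ∀ t ∈ Set.uIcc T₁ T₂, HasDerivAt (fun t : ℝ => ((t ^ (-s) : ℝ) : ℂ))
      (((-s) * t ^ (-s - 1) : ℝ) : ℂ) t := by
    intro t ht
    rw [Set.uIcc_of_le h2] at ht
    exact (Real.hasDerivAt_rpow_const (p := -s) (Or.inl (by linarith [ht.1]))).ofReal_comp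
  have hci : ContinuousOn (fun t : ℝ => t ^ (-s - 1)) (Set.uIcc T₁ T₂) := by
    have := continuousOn_rpow_neg (s + 1) h1 h2
    rwa [neg_add'] at this
  have hparts := intervalIntegral.integral_mul_deriv_eq_deriv_mul hu (fun t _ => hv t)
    ((Complex.continuous_ofReal.comp_continuousOn (hci.const_mul (-s))).intervalIntegrable)
    (Continuous.intervalIntegrable (by fun_prop) _ _)
  rw [hparts]
  have hT1 : 0 < T₁ ^ (-s) := Real.rpow_pos_of_pos (by linarith) _
  have hT2 : 0 < T₂ ^ (-s) := Real.rpow_pos_of_pos (by linarith) _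
  have hint : ‖∫ t in T₁..T₂, (((-s) * t ^ (-s - 1) : ℝ) : ℂ)
      * (Complex.exp ((ω * t : ℝ) * Complex.I) / (ω * Complex.I))‖
      ≤ ∫ t in T₁..T₂, s * t ^ (-s - 1) * (1 / |ω|) := by
    refine intervalIntegral.norm_integral_le_of_norm_le h2 (Eventually.of_forall fun t ht => ?_)
      (((hci.const_mul s).mul_const _).intervalIntegrable)
    rw [norm_mul, hnorm, Complex.norm_real, norm_mul, norm_neg, Real.norm_of_nonneg hs.le,
      Real.norm_of_nonneg (Real.rpow_nonneg (by linarith [ht.1]) _)]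
  rw [intervalIntegral.integral_mul_const, intervalIntegral.integral_const_mul,
    integral_rpow_neg hs.ne' h1 h2] at hint
  calc _ ≤ ‖((T₂ ^ (-s) : ℝ) : ℂ) * (Complex.exp ((ω * T₂ : ℝ) * Complex.I) / (ω * Complex.I))‖
        + ‖((T₁ ^ (-s) : ℝ) : ℂ) * (Complex.exp ((ω * T₁ : ℝ) * Complex.I) / (ω * Complex.I))‖
        + s * ((T₁ ^ (-s) - T₂ ^ (-s)) / s) * (1 / |ω|) :=
        (norm_sub_le _ _).trans (add_le_add (norm_sub_le _ _) hint)
    _ = 2 / |ω| * T₁ ^ (-s) := by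
        rw [norm_mul, norm_mul, hnorm, hnorm, Complex.norm_real, Complex.norm_real,
          Real.norm_of_nonneg hT1.le, Real.norm_of_nonneg hT2.le]
        field_simp
        ring
    _ ≤ 2 / δ * T₁ ^ (-s) := by gcongr

/-- The estimate for a real-valued function. -/
theorem abs_integral_le {f : ℝ → ℝ} (hf : OscillatoryBound s B fun t => (f t : ℂ)) {T₁ T₂ : ℝ}
    (h1 : 1 ≤ T₁) (h2 : T₁ ≤ T₂) :
    |∫ t in T₁..T₂, t ^ (-s) * f t| ≤ B * T₁ ^ (-s) := by
  have h := hf.bound T₁ T₂ h1 h2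
  simp_rw [← Complex.ofReal_mul] at h
  rw [intervalIntegral.integral_ofReal, Complex.norm_real] at h
  exact h

end OscillatoryBound

/-- The wave `C e^{it} + conj C e^{-it}`, with `2 C = a - b i`. -/
theorem wave_eq (a b t : ℝ) :
    ((a * Real.cos t + b * Real.sin t : ℝ) : ℂ)
      = (a - b * Complex.I) / 2 * Complex.exp ((t : ℝ) * Complex.I)
      + (a + b * Complex.I) / 2 * Complex.exp (-(t : ℝ) * Complex.I) := by
  rw [Complex.exp_mul_I, Complex.exp_mul_I, Complex.cos_neg, Complex.sin_neg]
  push_cast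
  linear_combination ((b : ℂ) * Complex.sin t) * Complex.I_sq

/-- The expansion of a product of waves into exponentials. -/
theorem wave_mul_wave_pow (C D : ℂ) (n : ℕ) (x t : ℝ) :
    (C * Complex.exp ((x * t : ℝ) * Complex.I) + D * Complex.exp (-(x * t : ℝ) * Complex.I))
      * (C * Complex.exp ((t : ℝ) * Complex.I) + D * Complex.exp (-(t : ℝ) * Complex.I)) ^ n
    = (∑ l ∈ Finset.range (n + 1), (C ^ l * D ^ (n - l) * n.choose l * C)
        * Complex.exp (((x + (2 * l - n)) * t : ℝ) * Complex.I))
      + ∑ l ∈ Finset.range (n + 1), (C ^ l * D ^ (n - l) * n.choose l * D)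
        * Complex.exp (((2 * l - n - x) * t : ℝ) * Complex.I) := by
  have h : ∀ l ∈ Finset.range (n + 1),
      Complex.exp ((t : ℝ) * Complex.I) ^ l * Complex.exp (-(t : ℝ) * Complex.I) ^ (n - l)
      = Complex.exp (((2 * l - n) * t : ℝ) * Complex.I) := by
    intro l hl
    rw [← Complex.exp_nat_mul, ← Complex.exp_nat_mul, ← Complex.exp_add]
    congr 1
    rw [Nat.cast_sub (Nat.lt_succ_iff.1 (Finset.mem_range.1 hl))]
    push_cast; ring
  rw [add_pow, add_mul, Finset.mul_sum, Finset.mul_sum]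
  congr 1
  · refine Finset.sum_congr rfl fun l hl => ?_
    have e : Complex.exp (((x + (2 * l - n)) * t : ℝ) * Complex.I)
        = Complex.exp ((x * t : ℝ) * Complex.I)
          * Complex.exp (((2 * l - n) * t : ℝ) * Complex.I) := by
      rw [← Complex.exp_add]; congr 1; push_cast; ring
    rw [e, ← h l hl]; ring
  · refine Finset.sum_congr rfl fun l hl => ?_
    have e : Complex.exp (((2 * l - n - x) * t : ℝ) * Complex.I)
        = Complex.exp (-(x * t : ℝ) * Complex.I)
          * Complex.exp (((2 * l - n) * t : ℝ) * Complex.I) := by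
      rw [← Complex.exp_add]; congr 1; push_cast; ring
    rw [e, ← h l hl]; ring

/-- The product of waves, away from its resonances `x = 2 l - n`. -/
theorem oscillatoryBound_wave {s : ℝ} (hs : 0 < s) (a b : ℝ) (n : ℕ) {δ : ℝ} (hδ : 0 < δ) :
    ∃ B : ℝ, ∀ x : ℝ, (∀ l ≤ n, δ ≤ |x - (2 * l - n)|) →
      OscillatoryBound s B fun t => (((a * Real.cos (x * t) + b * Real.sin (x * t))
        * (a * Real.cos t + b * Real.sin t) ^ n : ℝ) : ℂ) := by
  -- the constant is the sum of the bounds for the single exponentials, found by unification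
  apply Exists.intro
  intro x hx
  simp_rw [Complex.ofReal_mul, Complex.ofReal_pow, wave_eq, wave_mul_wave_pow]
  refine (OscillatoryBound.sum _ fun l hl => (OscillatoryBound.cexp hs hδ ?_).const_mul _).add
    (OscillatoryBound.sum _ fun l hl => (OscillatoryBound.cexp hs hδ ?_).const_mul _)
  · have hl' : l ≤ n := Nat.lt_succ_iff.1 (Finset.mem_range.1 hl)
    have := hx (n - l) (Nat.sub_le _ _)
    rw [Nat.cast_sub hl'] at this
    convert this using 2; ring
  · have hl' : l ≤ n := Nat.lt_succ_iff.1 (Finset.mem_range.1 hl)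
    have := hx l hl'
    rw [abs_sub_comm] at this
    exact this

/-- At the resonance `x = n` the stationary terms cancel in the symmetric sum over `x = n ± h`,
provided that `C D^n + C^n D = 0`. -/
theorem oscillatoryBound_wave_resonance {s : ℝ} (hs : 0 < s) (a b : ℝ) (n : ℕ)
    (hres : ((a - b * Complex.I) / 2) * ((a + b * Complex.I) / 2) ^ n
      + ((a - b * Complex.I) / 2) ^ n * ((a + b * Complex.I) / 2) = (0 : ℂ)) :
    ∃ B : ℝ, ∀ h : ℝ, |h| ≤ 1 →
      OscillatoryBound s B fun t => (((a * Real.cos ((n + h) * t) + b * Real.sin ((n + h) * t)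
        + (a * Real.cos ((n - h) * t) + b * Real.sin ((n - h) * t)))
        * (a * Real.cos t + b * Real.sin t) ^ n : ℝ) : ℂ) := by
  have hC := wave_eq a b
  set C : ℂ := (a - b * Complex.I) / 2
  set D : ℂ := (a + b * Complex.I) / 2
  -- the constant is the sum of the bounds for the single exponentials, found by unification
  apply Exists.intro
  intro h hh
  obtain ⟨hh1, hh2⟩ := abs_le.1 hh
  have hadd : ∀ p q r : ℝ, (((p + q) * r ^ n : ℝ) : ℂ) = (p : ℂ) * (r : ℂ) ^ n
      + (q : ℂ) * (r : ℂ) ^ n := fun p q r => by push_cast; ring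
  simp_rw [hadd, hC, wave_mul_wave_pow]
  -- the terms of frequency `± h`, namely `l = 0` in the sums with factor `C` and `l = n` in those
  -- with factor `D`, add up to a multiple of `C D^n + C^n D`
  have hcancel : ∀ x y t : ℝ, x = n + h → y = n - h →
      (∑ l ∈ Finset.range (n + 1), (C ^ l * D ^ (n - l) * n.choose l * C)
        * Complex.exp (((x + (2 * l - n)) * t : ℝ) * Complex.I))
      + (∑ l ∈ Finset.range (n + 1), (C ^ l * D ^ (n - l) * n.choose l * D)
        * Complex.exp (((2 * l - n - x) * t : ℝ) * Complex.I))
      + ((∑ l ∈ Finset.range (n + 1), (C ^ l * D ^ (n - l) * n.choose l * C)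
        * Complex.exp (((y + (2 * l - n)) * t : ℝ) * Complex.I))
      + (∑ l ∈ Finset.range (n + 1), (C ^ l * D ^ (n - l) * n.choose l * D)
        * Complex.exp (((2 * l - n - y) * t : ℝ) * Complex.I)))
      = ((∑ l ∈ Finset.range n, (C ^ (l + 1) * D ^ (n - (l + 1)) * n.choose (l + 1) * C)
        * Complex.exp (((x + (2 * (l + 1 : ℕ) - n)) * t : ℝ) * Complex.I))
      + (∑ l ∈ Finset.range n, (C ^ l * D ^ (n - l) * n.choose l * D)
        * Complex.exp (((2 * l - n - x) * t : ℝ) * Complex.I)))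
      + ((∑ l ∈ Finset.range n, (C ^ (l + 1) * D ^ (n - (l + 1)) * n.choose (l + 1) * C)
        * Complex.exp (((y + (2 * (l + 1 : ℕ) - n)) * t : ℝ) * Complex.I))
      + (∑ l ∈ Finset.range n, (C ^ l * D ^ (n - l) * n.choose l * D)
        * Complex.exp (((2 * l - n - y) * t : ℝ) * Complex.I))) := by
    intro x y t hx hy
    rw [Finset.sum_range_succ', Finset.sum_range_succ (n := n), Finset.sum_range_succ',
      Finset.sum_range_succ (n := n)]
    have e1 : (x + (2 * (0 : ℕ) - n)) * t = h * t := by rw [hx]; push_cast; ring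
    have e2 : (2 * (n : ℝ) - n - x) * t = -h * t := by rw [hx]; ring
    have e3 : (y + (2 * (0 : ℕ) - n)) * t = -h * t := by rw [hy]; push_cast; ring
    have e4 : (2 * (n : ℝ) - n - y) * t = h * t := by rw [hy]; ring
    rw [e1, e2, e3, e4]
    simp only [pow_zero, Nat.sub_zero, Nat.choose_zero_right, Nat.choose_self, Nat.sub_self,
      Nat.cast_one, one_mul, mul_one]
    linear_combination (Complex.exp ((h * t : ℝ) * Complex.I)
      + Complex.exp ((-h * t : ℝ) * Complex.I)) * hres
  simp_rw [fun t => hcancel (n + h) (n - h) t rfl rfl]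
  -- the remaining frequencies have absolute value at least `2 - |h| ≥ 1`
  have hn0 : ∀ l : ℕ, (0 : ℝ) ≤ l := fun l => l.cast_nonneg
  have hln : ∀ l ∈ Finset.range n, (l : ℝ) + 1 ≤ n := fun l hl => by
    exact_mod_cast Finset.mem_range.1 hl
  refine ((OscillatoryBound.sum _ fun l hl => (OscillatoryBound.cexp hs one_pos ?_).const_mul _).add
    (OscillatoryBound.sum _ fun l hl => (OscillatoryBound.cexp hs one_pos ?_).const_mul _)).add
    ((OscillatoryBound.sum _ fun l hl => (OscillatoryBound.cexp hs one_pos ?_).const_mul _).add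
    (OscillatoryBound.sum _ fun l hl => (OscillatoryBound.cexp hs one_pos ?_).const_mul _))
  · rw [le_abs]; left; push_cast; linarith [hn0 l]
  · rw [le_abs]; right; linarith [hln l hl]
  · rw [le_abs]; left; push_cast; linarith [hn0 l]
  · rw [le_abs]; right; linarith [hln l hl]

/-! ### Convergence of the truncated Bessel integrals -/

/-- Beyond any `T ≥ 1`, the function `g` varies by at most `B T^{-r}`. It is applied to truncated
integrals, as functions of the point of truncation. -/
def TailBound (r B : ℝ) (g : ℝ → ℝ) : Prop :=
  ∀ T₁ T₂ : ℝ, 1 ≤ T₁ → T₁ ≤ T₂ → |g T₂ - g T₁| ≤ B * T₁ ^ (-r)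

theorem TailBound.exists_tendsto {r B : ℝ} (hr : 0 < r) {g : ℝ → ℝ} (h : TailBound r B g) :
    ∃ L, Tendsto g atTop (𝓝 L) ∧ ∀ T, 1 ≤ T → |L - g T| ≤ B * T ^ (-r) := by
  have hlim : Tendsto (fun T : ℝ => B * T ^ (-r)) atTop (𝓝 0) := by
    simpa using (tendsto_rpow_neg_atTop hr).const_mul B
  have hc : CauchySeq g := by
    refine Metric.cauchySeq_iff'.2 fun ε hε => ?_
    obtain ⟨N, hN⟩ := ((hlim.eventually_lt_const hε).and (eventually_ge_atTop 1)).exists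
    refine ⟨N, fun T hT => ?_⟩
    rw [Real.dist_eq]
    exact (h N T hN.2 hT).trans_lt hN.1
  obtain ⟨L, hL⟩ := cauchySeq_tendsto_of_complete hc
  refine ⟨L, hL, fun T hT => ?_⟩
  refine le_of_tendsto (hL.sub_const (g T)).abs ?_
  filter_upwards [eventually_ge_atTop T] with T' hT'
  exact h T T' hT hT'

/-- Uniform tail bounds make the limit continuous. -/
theorem continuousAt_of_tailBound {r B : ℝ} (hr : 0 < r) {g : ℝ → ℝ → ℝ} {L : ℝ → ℝ} {x₀ : ℝ}
    (hB : ∀ᶠ x in 𝓝 x₀, TailBound r B (g x)) (hL : ∀ᶠ x in 𝓝 x₀, Tendsto (g x) atTop (𝓝 (L x)))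
    (hc : ∀ T, 1 ≤ T → ContinuousAt (fun x => g x T) x₀) : ContinuousAt L x₀ := by
  obtain ⟨V, hV, hVx⟩ := (hB.and hL).exists_mem
  have hlim : Tendsto (fun T : ℝ => B * T ^ (-r)) atTop (𝓝 0) := by
    simpa using (tendsto_rpow_neg_atTop hr).const_mul B
  refine Metric.continuousAt_iff'.2 fun ε hε => ?_
  obtain ⟨T, hT, hT1⟩ := ((hlim.eventually_lt_const (show 0 < ε / 3 by positivity)).and
    (eventually_ge_atTop 1)).exists
  have hclose : ∀ x ∈ V, |L x - g x T| < ε / 3 := by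
    intro x hx
    obtain ⟨L', hL', hb⟩ := (hVx x hx).1.exists_tendsto hr
    rw [tendsto_nhds_unique (hVx x hx).2 hL']
    exact (hb T hT1).trans_lt hT
  filter_upwards [hV, Metric.continuousAt_iff'.1 (hc T hT1) (ε / 3) (by positivity)] with x hx hx'
  rw [Real.dist_eq] at hx' ⊢
  have h1 := hclose x hx
  have h2 := hclose x₀ (mem_of_mem_nhds hV)
  rw [abs_lt] at *
  constructor <;> linarith [h1.1, h1.2, h2.1, h2.2, hx'.1, hx'.2]

/-- The truncated radial inversion integral, normalized by `x^{ν + 1/2}`: with this factor the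
integrand is a power of `t` times the bounded function `u(x t) u(t)^n`, where `u` is `besselU`. -/
noncomputable def truncatedHankel (d n : ℕ) (ν x T : ℝ) : ℝ :=
  x ^ (ν + 1 / 2) * ∫ t in (0 : ℝ)..T, walkKernel d n ν x t

theorem besselIntegral_eq_truncatedHankel {d : ℕ} (hd : 2 ≤ d) {ν : ℝ}
    (hν : ν = (d : ℝ) / 2 - 1) (n : ℕ) {x T : ℝ} (hx : 0 < x) (hT : 0 ≤ T) :
    besselIntegral ν n x T
      = sphereArea d ^ 2 / (2 * Real.pi) ^ d * x ^ (ν + 1 / 2) * truncatedHankel d n ν x T := by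
  rw [besselIntegral_eq hd hν n hx hT, truncatedHankel]
  have e : x ^ (d - 1) = x ^ (ν + 1 / 2) * x ^ (ν + 1 / 2) := by
    rw [← Real.rpow_add hx, ← Real.rpow_natCast, Nat.cast_sub (by omega)]
    congr 1; rw [hν]; push_cast; ring
  rw [e]; ring

theorem continuousAt_truncatedHankel (d n : ℕ) {ν : ℝ} (hν : 0 ≤ ν) (x T : ℝ) :
    ContinuousAt (fun x => truncatedHankel d n ν x T) x := by
  have hk := continuous_walkKernel d n hν
  refine ContinuousAt.mul
    (Real.continuousAt_rpow_const _ _ (Or.inr (by positivity))) ?_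
  have : Continuous fun x => ∫ t in (0 : ℝ)..T, walkKernel d n ν x t :=
    intervalIntegral.continuous_parametric_intervalIntegral_of_continuous' hk 0 T
  exact this.continuousAt

/-- The powers of `t` on the left and in `besselU` balance since `d - 1 = 2 (ν + 1/2)`. -/
theorem rpow_mul_walkKernel {d n : ℕ} (hd : 2 ≤ d) {ν : ℝ} (hν : ν = (d : ℝ) / 2 - 1)
    {x t : ℝ} (hx : 0 < x) (ht : 0 < t) :
    x ^ (ν + 1 / 2) * walkKernel d n ν x t
      = t ^ (-((n - 1) * (ν + 1 / 2))) * (besselU ν (x * t) * besselU ν t ^ n) := by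
  have e : t ^ (d - 1) = t ^ (-((n - 1) * (ν + 1 / 2))) * t ^ (ν + 1 / 2)
      * (t ^ (ν + 1 / 2)) ^ n := by
    rw [← Real.rpow_natCast (t ^ (ν + 1 / 2)), ← Real.rpow_mul ht.le, ← Real.rpow_add ht,
      ← Real.rpow_add ht, ← Real.rpow_natCast, Nat.cast_sub (by omega)]
    congr 1; rw [hν]; push_cast; ring
  rw [walkKernel, besselU, besselU, Real.mul_rpow hx.le ht.le, mul_pow, e]
  ring

theorem truncatedHankel_sub {d n : ℕ} (hd : 2 ≤ d) {ν : ℝ} (hν : ν = (d : ℝ) / 2 - 1)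
    {x T₁ T₂ : ℝ} (hx : 0 < x) (h1 : 1 ≤ T₁) (h2 : T₁ ≤ T₂) :
    truncatedHankel d n ν x T₂ - truncatedHankel d n ν x T₁
      = ∫ t in T₁..T₂, t ^ (-((n - 1) * (ν + 1 / 2))) * (besselU ν (x * t) * besselU ν t ^ n) := by
  have hd2 : (2 : ℝ) ≤ d := by exact_mod_cast hd
  have hν0 : 0 ≤ ν := by rw [hν]; linarith
  have hc : Continuous fun t => walkKernel d n ν x t :=
    (continuous_walkKernel d n hν0).comp (Continuous.prodMk_right x)
  rw [truncatedHankel, truncatedHankel, ← mul_sub,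
    intervalIntegral.integral_interval_sub_left (hc.intervalIntegrable (μ := volume) _ _)
    (hc.intervalIntegrable (μ := volume) _ _), ← intervalIntegral.integral_const_mul]
  refine intervalIntegral.integral_congr (μ := volume) fun t ht => ?_
  rw [Set.uIcc_of_le h2] at ht
  exact rpow_mul_walkKernel hd hν hx (by linarith [ht.1])

theorem abs_integral_rpow_neg_mul_le {s A T₁ T₂ : ℝ} (hs : 0 < s) (h1 : 1 ≤ T₁)
    (h2 : T₁ ≤ T₂) {q : ℝ → ℝ} (hA : 0 ≤ A) (hq : ∀ t, 1 ≤ t → |q t| ≤ A / t) :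
    |∫ t in T₁..T₂, t ^ (-s) * q t| ≤ A / s * T₁ ^ (-s) := by
  have hci : ContinuousOn (fun t : ℝ => t ^ (-s - 1)) (Set.uIcc T₁ T₂) := by
    have := continuousOn_rpow_neg (s + 1) h1 h2
    rwa [neg_add'] at this
  have h := intervalIntegral.norm_integral_le_of_norm_le (μ := volume) h2
    (f := fun t => t ^ (-s) * q t)
    (g := fun t => A * t ^ (-s - 1)) (Eventually.of_forall fun t ht => ?_)
    (hci.const_mul A).intervalIntegrable
  · rw [Real.norm_eq_abs, intervalIntegral.integral_const_mul, integral_rpow_neg hs.ne' h1 h2] at h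
    refine h.trans ?_
    have : 0 ≤ T₂ ^ (-s) := Real.rpow_nonneg (by linarith) _
    calc A * ((T₁ ^ (-s) - T₂ ^ (-s)) / s) ≤ A * (T₁ ^ (-s) / s) := by gcongr; linarith
      _ = _ := by ring
  · have ht0 : 0 < t := by linarith [ht.1]
    have ht1 : 0 < t ^ (-s) := Real.rpow_pos_of_pos ht0 _
    rw [norm_mul, Real.norm_of_nonneg ht1.le, Real.norm_eq_abs, Real.rpow_sub_one ht0.ne']
    calc t ^ (-s) * |q t| ≤ t ^ (-s) * (A / t) := by
          gcongr; exact hq t (by linarith [ht.1])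
      _ = _ := by ring

/-- The absolutely convergent case `(n - 1) (ν + 1/2) > 1`. -/
theorem exists_tailBound_of_one_lt {d n : ℕ} (hd : 2 ≤ d) {ν : ℝ} (hν : ν = (d : ℝ) / 2 - 1)
    (hs : 1 < ((n : ℝ) - 1) * (ν + 1 / 2)) :
    ∃ B : ℝ, ∀ x, 0 < x →
      TailBound ((n - 1) * (ν + 1 / 2) - 1) B (truncatedHankel d n ν x) := by
  have hd2 : (2 : ℝ) ≤ d := by exact_mod_cast hd
  have hν0 : 0 ≤ ν := by rw [hν]; linarith
  obtain ⟨M, hM0, hM⟩ := exists_abs_besselU_le hν0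
  refine ⟨M * M ^ n / ((n - 1) * (ν + 1 / 2) - 1), fun x hx T₁ T₂ h1 h2 => ?_⟩
  rw [truncatedHankel_sub hd hν hx h1 h2]
  set s := ((n : ℝ) - 1) * (ν + 1 / 2)
  have e : ∫ t in T₁..T₂, t ^ (-s) * (besselU ν (x * t) * besselU ν t ^ n)
      = ∫ t in T₁..T₂, t ^ (-(s - 1)) * (besselU ν (x * t) * besselU ν t ^ n / t) := by
    refine intervalIntegral.integral_congr fun t ht => ?_
    rw [Set.uIcc_of_le h2] at ht
    have ht0 : 0 < t := by linarith [ht.1]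
    have : -(s - 1) = -s + 1 := by ring
    rw [this, Real.rpow_add_one ht0.ne']
    field_simp
  rw [e]
  refine abs_integral_rpow_neg_mul_le (by linarith) h1 h2 (by positivity) fun t ht => ?_
  rw [abs_div, abs_of_pos (show 0 < t by linarith), abs_mul, abs_pow]
  gcongr
  · exact hM _ (by positivity)
  · exact hM _ (by linarith)

/-- Replacing `u` by its leading asymptotics in a product costs a factor `1 / t`. -/
theorem exists_abs_besselU_mul_sub_le {ν : ℝ} (hν : 0 ≤ ν) (n : ℕ) {a b M : ℝ} (hM0 : 0 < M)
    (hM : ∀ t : ℝ, 0 < t → |besselU ν t - (a * Real.cos t + b * Real.sin t)| ≤ M / t) :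
    ∃ A : ℝ, 0 < A ∧ ∀ x t : ℝ, 0 < x → 1 ≤ t →
      |besselU ν (x * t) * besselU ν t ^ n
        - (a * Real.cos (x * t) + b * Real.sin (x * t)) * (a * Real.cos t + b * Real.sin t) ^ n|
      ≤ A * (1 / x + 1) / t := by
  obtain ⟨N, hN0, hN⟩ := exists_abs_besselU_le hν
  set w : ℝ → ℝ := fun t => a * Real.cos t + b * Real.sin t with hw
  set K := max N (|a| + |b|) + 1 with hK
  have hK0 : 0 < K := by positivity
  have huK : ∀ t, 0 ≤ t → |besselU ν t| ≤ K := fun t ht =>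
    (hN t ht).trans ((le_max_left _ _).trans (by linarith))
  have hwK : ∀ t, |w t| ≤ K := fun t => by
    calc |w t| ≤ |a| * |Real.cos t| + |b| * |Real.sin t| := by
          rw [← abs_mul, ← abs_mul]; exact abs_add_le _ _
      _ ≤ |a| * 1 + |b| * 1 := by
          gcongr
          · exact Real.abs_cos_le_one t
          · exact Real.abs_sin_le_one t
      _ ≤ K := by rw [hK]; linarith [le_max_right N (|a| + |b|)]
  refine ⟨M * K ^ n + K * (M * n * K ^ (n - 1)), by positivity, fun x t hx ht => ?_⟩
  have ht0 : 0 < t := by linarith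
  have hpow : |besselU ν t ^ n - w t ^ n| ≤ M / t * n * K ^ (n - 1) := by
    refine (abs_pow_sub_pow_le _ _ _).trans ?_
    gcongr
    · exact hM t ht0
    · exact max_le (huK t ht0.le) (hwK t)
  have e : besselU ν (x * t) * besselU ν t ^ n - w (x * t) * w t ^ n
      = (besselU ν (x * t) - w (x * t)) * besselU ν t ^ n
        + w (x * t) * (besselU ν t ^ n - w t ^ n) := by ring
  change |besselU ν (x * t) * besselU ν t ^ n - w (x * t) * w t ^ n| ≤ _
  rw [e]
  calc _ ≤ |besselU ν (x * t) - w (x * t)| * |besselU ν t| ^ n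
        + |w (x * t)| * |besselU ν t ^ n - w t ^ n| := by
        rw [← abs_pow, ← abs_mul, ← abs_mul]; exact abs_add_le _ _
    _ ≤ M / (x * t) * K ^ n + K * (M / t * n * K ^ (n - 1)) := by
        gcongr
        · exact hM _ (by positivity)
        · exact huK t ht0.le
        · exact hwK _
    _ = (M * K ^ n * (1 / x) + K * (M * n * K ^ (n - 1)) * 1) / t := by
        field_simp
    _ ≤ _ := by
        gcongr
        have h1 : 0 ≤ M * K ^ n := by positivity
        have h2 : 0 ≤ K * (M * n * K ^ (n - 1)) := by positivity
        have h3 : 0 ≤ 1 / x := by positivity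
        nlinarith [mul_nonneg h2 h3]

theorem intervalIntegrable_rpow_neg_mul {s T₁ T₂ : ℝ} (h1 : 1 ≤ T₁) (h2 : T₁ ≤ T₂) {q : ℝ → ℝ}
    (hq : Continuous q) : IntervalIntegrable (fun t => t ^ (-s) * q t) volume T₁ T₂ :=
  ((continuousOn_rpow_neg s h1 h2).mul hq.continuousOn).intervalIntegrable

theorem integral_rpow_neg_mul_add {s T₁ T₂ : ℝ} (h1 : 1 ≤ T₁) (h2 : T₁ ≤ T₂) {p q r : ℝ → ℝ}
    (hp : Continuous p) (hq : Continuous q) (h : ∀ t, r t = p t + q t) :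
    ∫ t in T₁..T₂, t ^ (-s) * r t = (∫ t in T₁..T₂, t ^ (-s) * p t)
      + ∫ t in T₁..T₂, t ^ (-s) * q t := by
  rw [← intervalIntegral.integral_add (intervalIntegrable_rpow_neg_mul h1 h2 hp)
    (intervalIntegrable_rpow_neg_mul h1 h2 hq)]
  simp_rw [h, mul_add]

/-- The conditionally convergent case, away from the resonances `x = 2 l - n`. -/
theorem exists_tailBound_nonresonant {d n : ℕ} (hd : 2 ≤ d) (hn : 2 ≤ n) {ν : ℝ}
    (hν : ν = (d : ℝ) / 2 - 1) {δ : ℝ} (hδ : 0 < δ) :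
    ∃ B : ℝ, ∀ x, δ ≤ x → (∀ l ≤ n, δ ≤ |x - (2 * l - n)|) →
      TailBound ((n - 1) * (ν + 1 / 2)) B (truncatedHankel d n ν x) := by
  have hd2 : (2 : ℝ) ≤ d := by exact_mod_cast hd
  have hn2 : (2 : ℝ) ≤ n := by exact_mod_cast hn
  have hν0 : 0 ≤ ν := by rw [hν]; linarith
  obtain ⟨a, b, M, hM0, hM, -⟩ := exists_besselU_asymptotic hν0
  obtain ⟨A, hA0, hA⟩ := exists_abs_besselU_mul_sub_le hν0 n hM0 hM
  have hs : 0 < ((n : ℝ) - 1) * (ν + 1 / 2) := mul_pos (by linarith) (by linarith)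
  obtain ⟨B, hB⟩ := oscillatoryBound_wave hs a b n hδ
  refine ⟨B + A * (1 / δ + 1) / ((n - 1) * (ν + 1 / 2)), fun x hx hxl T₁ T₂ h1 h2 => ?_⟩
  have hx0 : 0 < x := by linarith
  rw [truncatedHankel_sub hd hν hx0 h1 h2]
  set s := ((n : ℝ) - 1) * (ν + 1 / 2)
  have hu := continuous_besselU hν0
  have hmain := (hB x hxl).abs_integral_le h1 h2
  have herr := abs_integral_rpow_neg_mul_le hs h1 h2 (A := A * (1 / δ + 1)) (by positivity)
    (fun t ht => (hA x t hx0 ht).trans (by gcongr))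
  rw [add_mul, integral_rpow_neg_mul_add h1 h2 (r := fun t => besselU ν (x * t) * besselU ν t ^ n)
    (p := fun t => (a * Real.cos (x * t) + b * Real.sin (x * t))
      * (a * Real.cos t + b * Real.sin t) ^ n)
    (q := fun t => besselU ν (x * t) * besselU ν t ^ n
      - (a * Real.cos (x * t) + b * Real.sin (x * t)) * (a * Real.cos t + b * Real.sin t) ^ n)
    (by fun_prop) (by fun_prop) (fun t => by ring)]
  exact (abs_add_le _ _).trans (add_le_add hmain herr)

/-- At the resonance `x = n`, the symmetric sum over `x = n ± h` has uniformly bounded tails. -/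
theorem exists_tailBound_resonant {d n : ℕ} (hd : 2 ≤ d) (hn : 2 ≤ n) {ν : ℝ}
    (hν : ν = (d : ℝ) / 2 - 1) {a b M : ℝ} (hM0 : 0 < M)
    (hM : ∀ t : ℝ, 0 < t → |besselU ν t - (a * Real.cos t + b * Real.sin t)| ≤ M / t)
    (hres : ((a - b * Complex.I) / 2) * ((a + b * Complex.I) / 2) ^ n
      + ((a - b * Complex.I) / 2) ^ n * ((a + b * Complex.I) / 2) = (0 : ℂ)) :
    ∃ B : ℝ, ∀ h, |h| ≤ 1 → TailBound ((n - 1) * (ν + 1 / 2)) B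
      fun T => truncatedHankel d n ν (n + h) T + truncatedHankel d n ν (n - h) T := by
  have hd2 : (2 : ℝ) ≤ d := by exact_mod_cast hd
  have hn2 : (2 : ℝ) ≤ n := by exact_mod_cast hn
  have hν0 : 0 ≤ ν := by rw [hν]; linarith
  obtain ⟨A, hA0, hA⟩ := exists_abs_besselU_mul_sub_le hν0 n hM0 hM
  have hs : 0 < ((n : ℝ) - 1) * (ν + 1 / 2) := mul_pos (by linarith) (by linarith)
  obtain ⟨B, hB⟩ := oscillatoryBound_wave_resonance hs a b n hres
  refine ⟨B + (A * (1 / 1 + 1) / ((n - 1) * (ν + 1 / 2))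
    + A * (1 / 1 + 1) / ((n - 1) * (ν + 1 / 2))), fun h hh T₁ T₂ h1 h2 => ?_⟩
  obtain ⟨hh1, hh2⟩ := abs_le.1 hh
  have hx : 1 ≤ n + h := by linarith
  have hy : 1 ≤ n - h := by linarith
  rw [add_sub_add_comm, truncatedHankel_sub hd hν (by linarith) h1 h2,
    truncatedHankel_sub hd hν (by linarith) h1 h2]
  set s := ((n : ℝ) - 1) * (ν + 1 / 2)
  have hu := continuous_besselU hν0
  have hmain := (hB h hh).abs_integral_le h1 h2
  have herr := fun x (hx : (1 : ℝ) ≤ x) =>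
    abs_integral_rpow_neg_mul_le hs h1 h2 (A := A * (1 / 1 + 1)) (by positivity)
    (fun t ht => (hA x t (by linarith) ht).trans (by gcongr))
  have hsplit := fun x : ℝ =>
    integral_rpow_neg_mul_add h1 h2 (s := s) (r := fun t => besselU ν (x * t) * besselU ν t ^ n)
    (p := fun t => (a * Real.cos (x * t) + b * Real.sin (x * t))
      * (a * Real.cos t + b * Real.sin t) ^ n)
    (q := fun t => besselU ν (x * t) * besselU ν t ^ n
      - (a * Real.cos (x * t) + b * Real.sin (x * t)) * (a * Real.cos t + b * Real.sin t) ^ n)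
    (by fun_prop) (by fun_prop) (fun t => by ring)
  rw [integral_rpow_neg_mul_add h1 h2
    (p := fun t => (a * Real.cos ((n + h) * t) + b * Real.sin ((n + h) * t))
      * (a * Real.cos t + b * Real.sin t) ^ n)
    (q := fun t => (a * Real.cos ((n - h) * t) + b * Real.sin ((n - h) * t))
      * (a * Real.cos t + b * Real.sin t) ^ n)
    (by fun_prop) (by fun_prop) (fun t => by ring)] at hmain
  have hx' := herr _ hx
  have hy' := herr _ hy
  rw [hsplit, hsplit, add_mul, add_mul]
  rw [abs_le] at hmain hx' hy' ⊢
  constructor <;> linarith [hmain.1, hmain.2, hx'.1, hx'.2, hy'.1, hy'.2]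

/-! ### The phase of the Bessel function of order zero -/

/-- The moments of `cos θ`, for `θ` uniform in `[0, π]`, which are those required by
`integral_cexp_eq_normalizedBesselJ` for `ν = 0`. -/
theorem integral_cos_pow_zero_pi (m : ℕ) :
    (∫ θ in (0 : ℝ)..Real.pi, Real.cos θ ^ (2 * m)) / Real.pi
        = ((2 * m).factorial : ℝ) / (4 ^ m * m.factorial * m.factorial) ∧
      ∫ θ in (0 : ℝ)..Real.pi, Real.cos θ ^ (2 * m + 1) = 0 := by
  have hpi := Real.pi_pos.ne'
  induction m with
  | zero => simp [hpi]
  | succ m ih =>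
    have e1 : 2 * (m + 1) = 2 * m + 2 := by ring
    have e2 : 2 * (m + 1) + 1 = 2 * m + 1 + 2 := by ring
    rw [e2, e1, integral_cos_pow, integral_cos_pow, ih.2]
    refine ⟨?_, by simp⟩
    have h := ih.1
    rw [div_eq_iff hpi] at h
    rw [h]
    simp only [Nat.factorial_succ, Real.sin_pi, Real.sin_zero]
    have h1 : (m.factorial : ℝ) ≠ 0 := by positivity
    push_cast
    field_simp
    ring

/-- Bessel's integral for `J_0`. -/
theorem normalizedBesselJ_zero_eq_integral (t : ℝ) :
    (normalizedBesselJ 0 t : ℂ) = (Real.pi : ℂ)⁻¹ *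
      ∫ θ in (0 : ℝ)..Real.pi, Complex.exp (t * Real.cos θ * Complex.I) := by
  have hpi := Real.pi_pos
  let μ : Measure ℝ := ENNReal.ofReal Real.pi⁻¹ • volume.restrict (Set.Ioc 0 Real.pi)
  have hμ : IsProbabilityMeasure μ := by
    constructor
    simp only [μ, Measure.smul_apply, Measure.restrict_apply_univ, Real.volume_Ioc, smul_eq_mul,
      sub_zero]
    rw [← ENNReal.ofReal_mul (by positivity), inv_mul_cancel₀ hpi.ne', ENNReal.ofReal_one]
  have hint : ∀ f : ℝ → ℝ, ∫ θ, f θ ∂μ = Real.pi⁻¹ * ∫ θ in (0 : ℝ)..Real.pi, f θ := by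
    intro f
    rw [integral_smul_measure, ENNReal.toReal_ofReal (by positivity),
      intervalIntegral.integral_of_le hpi.le, smul_eq_mul]
  rw [← integral_cexp_eq_normalizedBesselJ μ (Y := Real.cos) Real.measurable_cos
    Real.abs_cos_le_one le_rfl (fun m => ?_) (fun m => ?_) t]
  · rw [integral_smul_measure, ENNReal.toReal_ofReal (by positivity),
      intervalIntegral.integral_of_le hpi.le, Complex.real_smul]
    push_cast; rfl
  · rw [hint, (integral_cos_pow_zero_pi m).2, mul_zero]
  · rw [hint, ← div_eq_inv_mul, (integral_cos_pow_zero_pi m).1]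
    simp [Real.Gamma_nat_eq_factorial]

/-- The Laplace transform of `e^{-it} J_0(t)`. -/
theorem laplace_normalizedBesselJ_zero {ε : ℝ} (hε : 0 < ε) :
    ∫ t in Set.Ioi (0 : ℝ), Complex.exp (-(ε + Complex.I) * t) * normalizedBesselJ 0 t
      = (Real.pi : ℂ)⁻¹ * ∫ θ in (0 : ℝ)..Real.pi,
        1 / ((ε : ℂ) + (1 - Real.cos θ : ℝ) * Complex.I) := by
  have hpi := Real.pi_pos
  have hre : ∀ θ : ℝ, (-((ε : ℂ) + (1 - Real.cos θ : ℝ) * Complex.I)).re < 0 := by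
    intro θ; simp [hε]
  have h1 : ∀ θ : ℝ, 1 / ((ε : ℂ) + (1 - Real.cos θ : ℝ) * Complex.I)
      = ∫ t in Set.Ioi (0 : ℝ),
        Complex.exp (-((ε : ℂ) + (1 - Real.cos θ : ℝ) * Complex.I) * t) := by
    intro θ
    rw [integral_exp_mul_complex_Ioi (hre θ), Complex.ofReal_zero, mul_zero, Complex.exp_zero,
      neg_div_neg_eq]
  simp_rw [h1]
  rw [intervalIntegral_integral_swap, ← integral_const_mul]
  · refine integral_congr_ae (Eventually.of_forall fun t => ?_)
    simp only
    rw [normalizedBesselJ_zero_eq_integral, mul_left_comm, ← intervalIntegral.integral_const_mul]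
    congr 2; ext θ
    rw [← Complex.exp_add]
    congr 1; push_cast; ring
  · rw [Set.uIoc_of_le hpi.le]
    have hg : Integrable (fun t : ℝ => Real.exp (-ε * t)) (volume.restrict (Set.Ioi 0)) :=
      exp_neg_integrableOn_Ioi 0 hε
    have hg2 := hg.comp_snd (volume.restrict (Set.Ioc 0 Real.pi))
    refine hg2.mono' (Continuous.aestronglyMeasurable ?_) (Eventually.of_forall fun p => ?_)
    · unfold Function.uncurry; fun_prop
    · rw [Function.uncurry, Complex.norm_exp]
      simp

/-- Abelian asymptotics of the Laplace transform of `e^{-it} J_0(t)` at `ε = η²`, as `η → 0`. Of the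
leading term `t^{-1/2} (a cos t + b sin t)`, only the component along `e^{it}` contributes; it gives
`(a - b i) / 2` times `Γ(1/2) / η`. -/
theorem tendsto_laplace_normalizedBesselJ_zero {a b M : ℝ}
    (hM : ∀ t : ℝ, 0 < t → |besselU 0 t - (a * Real.cos t + b * Real.sin t)| ≤ M / t) :
    Tendsto (fun η : ℝ => (η : ℂ) * ∫ t in Set.Ioi (0 : ℝ),
      Complex.exp (-((η ^ 2 : ℝ) + Complex.I) * t) * normalizedBesselJ 0 t) (𝓝[>] 0)
      (𝓝 ((a - b * Complex.I) / 2 * (∫ s in Set.Ioi (0 : ℝ), Real.exp (-s) * s ^ (1 / 2 - 1 : ℝ) : ℝ)))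
      := by
  have hu := continuous_besselU (ν := 0) le_rfl
  obtain ⟨N, hN0, hN⟩ := exists_abs_besselU_le (ν := 0) le_rfl
  set C : ℂ := (a - b * Complex.I) / 2 with hC
  set D : ℂ := (a + b * Complex.I) / 2 with hD
  let w : ℝ → ℝ := fun s => Real.exp (-s) * s ^ (1 / 2 - 1 : ℝ)
  have hw : IntegrableOn w (Set.Ioi 0) := Real.GammaIntegral_convergent (by norm_num)
  have hwc : IntegrableOn (fun s => (w s : ℂ)) (Set.Ioi 0) := hw.ofReal
  let r : ℝ → ℝ := fun t => besselU 0 t - (a * Real.cos t + b * Real.sin t)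
  have hrc : Continuous r := by fun_prop
  have hrb : ∀ t, 0 ≤ t → |r t| ≤ N + (|a| + |b|) := by
    intro t ht
    calc |r t| ≤ |besselU 0 t| + (|a| * |Real.cos t| + |b| * |Real.sin t|) := by
          rw [← abs_mul, ← abs_mul]
          exact (abs_sub _ _).trans (by gcongr; exact abs_add_le _ _)
      _ ≤ N + (|a| * 1 + |b| * 1) := by
          gcongr
          · exact hN t ht
          · exact Real.abs_cos_le_one t
          · exact Real.abs_sin_le_one t
      _ = _ := by ring
  let E : ℝ → ℂ := fun t => Complex.exp (-(t : ℂ) * Complex.I)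
  have hEc : Continuous E := by fun_prop
  have hE : ∀ t, ‖E t‖ = 1 := fun t => by
    simp only [E]
    rw [← Complex.ofReal_neg, Complex.norm_exp_ofReal_mul_I]
  -- the remainder does not contribute in the limit
  have hlim1 : Tendsto (fun η : ℝ => ∫ s in Set.Ioi (0 : ℝ),
      (w s : ℂ) * (E (s / η ^ 2) * (r (s / η ^ 2) : ℂ))) (𝓝[>] 0) (𝓝 0) := by
    have h0 : (0 : ℂ) = ∫ s in Set.Ioi (0 : ℝ), (0 : ℂ) := by simp
    rw [h0]
    refine tendsto_integral_filter_of_dominated_convergence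
      (fun s => |w s| * (N + (|a| + |b|))) ?_ ?_ (hw.abs.mul_const _) ?_
    · filter_upwards [self_mem_nhdsWithin] with η hη
      refine hwc.aestronglyMeasurable.mul (Continuous.aestronglyMeasurable ?_)
      have : Continuous fun s : ℝ => s / η ^ 2 := by fun_prop
      exact (hEc.comp this).mul (Complex.continuous_ofReal.comp (hrc.comp this))
    · filter_upwards [self_mem_nhdsWithin] with η hη
      refine (ae_restrict_iff' measurableSet_Ioi).2 (Eventually.of_forall fun s hs => ?_)
      have hs0 : (0 : ℝ) < s := hs
      rw [norm_mul, norm_mul, hE, one_mul, Complex.norm_real, Complex.norm_real, Real.norm_eq_abs,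
        Real.norm_eq_abs]
      gcongr
      exact hrb _ (by positivity)
    · refine (ae_restrict_iff' measurableSet_Ioi).2 (Eventually.of_forall fun s hs => ?_)
      have hs0 : (0 : ℝ) < s := hs
      have hb : Tendsto (fun η : ℝ => |w s| * (M / s * η ^ 2)) (𝓝[>] 0) (𝓝 0) := by
        have : Tendsto (fun η : ℝ => |w s| * (M / s * η ^ 2)) (𝓝 0)
            (𝓝 (|w s| * (M / s * 0 ^ 2))) := Continuous.tendsto (by fun_prop) 0
        rw [zero_pow two_ne_zero, mul_zero, mul_zero] at this
        exact this.mono_left nhdsWithin_le_nhds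
      refine squeeze_zero_norm' ?_ hb
      filter_upwards [self_mem_nhdsWithin] with η hη
      have hη0 : (0 : ℝ) < η := hη
      rw [norm_mul, norm_mul, hE, one_mul, Complex.norm_real, Complex.norm_real, Real.norm_eq_abs,
        Real.norm_eq_abs]
      gcongr
      refine (hM _ (by positivity)).trans (le_of_eq ?_)
      field_simp
  -- the wave of nonzero frequency does not contribute, by the Riemann-Lebesgue lemma
  have hlim2 : Tendsto (fun η : ℝ => ∫ s in Set.Ioi (0 : ℝ),
      (w s : ℂ) * E (2 * (s / η ^ 2))) (𝓝[>] 0) (𝓝 0) := by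
    have hRL := Real.tendsto_integral_exp_smul_cocompact
      ((Set.Ioi (0 : ℝ)).indicator fun s => (w s : ℂ))
    have hη : Tendsto (fun η : ℝ => (Real.pi * η ^ 2)⁻¹) (𝓝[>] 0) (Filter.cocompact ℝ) := by
      refine Tendsto.mono_right ?_ atTop_le_cocompact
      refine tendsto_inv_nhdsGT_zero.comp ?_
      refine tendsto_nhdsWithin_iff.2 ⟨?_, ?_⟩
      · have : Tendsto (fun η : ℝ => Real.pi * η ^ 2) (𝓝 0) (𝓝 (Real.pi * 0 ^ 2)) :=
          Continuous.tendsto (by fun_prop) 0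
        rw [zero_pow two_ne_zero, mul_zero] at this
        exact this.mono_left nhdsWithin_le_nhds
      · filter_upwards [self_mem_nhdsWithin] with η hη
        have hη0 : (0 : ℝ) < η := hη
        exact Set.mem_Ioi.2 (by positivity)
    refine (hRL.comp hη).congr fun η => ?_
    simp only [Function.comp]
    rw [← integral_indicator measurableSet_Ioi]
    congr 1; ext s
    by_cases hs : s ∈ Set.Ioi (0 : ℝ)
    · rw [Set.indicator_of_mem hs, Set.indicator_of_mem hs, Circle.smul_def,
        Real.fourierChar_apply, smul_eq_mul, mul_comm]
      congr 2
      have := Real.pi_pos.ne'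
      rw [← Complex.ofReal_neg]
      congr 2
      field_simp
    · rw [Set.indicator_of_notMem hs, Set.indicator_of_notMem hs, smul_zero]
  have hsum := ((hlim2.const_mul D).add hlim1).const_add (C * (∫ s in Set.Ioi (0 : ℝ), w s : ℝ))
  rw [mul_zero, add_zero, add_zero] at hsum
  refine hsum.congr' ?_
  filter_upwards [self_mem_nhdsWithin] with η hη
  have hη0 : (0 : ℝ) < η := hη
  have hcont : Continuous fun s : ℝ => s / η ^ 2 := by fun_prop
  have hi1 : IntegrableOn (fun s => (w s : ℂ) * E (2 * (s / η ^ 2))) (Set.Ioi 0) :=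
    hwc.mul_bdd (c := 1) (Continuous.aestronglyMeasurable (hEc.comp (hcont.const_mul 2)))
      (Eventually.of_forall fun s => (hE _).le)
  have hi2 : IntegrableOn (fun s => (w s : ℂ) * (E (s / η ^ 2) * (r (s / η ^ 2) : ℂ)))
      (Set.Ioi 0) := by
    refine Integrable.mul_bdd (c := N + (|a| + |b|)) hwc (Continuous.aestronglyMeasurable
      ((hEc.comp hcont).mul (Complex.continuous_ofReal.comp (hrc.comp hcont)))) ?_
    refine (ae_restrict_iff' measurableSet_Ioi).2 (Eventually.of_forall fun s hs => ?_)
    have hs0 : (0 : ℝ) < s := hs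
    rw [norm_mul, hE, one_mul, Complex.norm_real, Real.norm_eq_abs]
    exact hrb _ (by positivity)
  have hi3 : IntegrableOn (fun s => D * ((w s : ℂ) * E (2 * (s / η ^ 2)))
      + (w s : ℂ) * (E (s / η ^ 2) * (r (s / η ^ 2) : ℂ))) (Set.Ioi 0) := (hi1.const_mul D).add hi2
  -- rescaling by `t = s / η²`
  have hscale : (η : ℂ) * ∫ t in Set.Ioi (0 : ℝ),
      Complex.exp (-((η ^ 2 : ℝ) + Complex.I) * t) * normalizedBesselJ 0 t
      = ∫ s in Set.Ioi (0 : ℝ), (w s : ℂ) * (E (s / η ^ 2) * (besselU 0 (s / η ^ 2) : ℂ)) := by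
    have h := integral_comp_mul_left_Ioi
      (fun s : ℝ => (w s : ℂ) * (E (s / η ^ 2) * (besselU 0 (s / η ^ 2) : ℂ))) 0
      (b := η ^ 2) (by positivity)
    rw [mul_zero, eq_inv_smul_iff₀ (by positivity)] at h
    rw [← h, Complex.real_smul, ← integral_const_mul, ← integral_const_mul]
    refine setIntegral_congr_fun measurableSet_Ioi fun t ht => ?_
    have ht0 : (0 : ℝ) < t := ht
    have e1 : (η ^ 2 : ℝ) * (η ^ 2 : ℝ) ^ (1 / 2 - 1 : ℝ) = η := by
      rw [← Real.rpow_one_add' (by positivity) (by norm_num), ← Real.rpow_natCast,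
        ← Real.rpow_mul hη0.le]
      norm_num
    have e2 : t ^ (1 / 2 - 1 : ℝ) * t ^ (0 + 1 / 2 : ℝ) = 1 := by
      rw [← Real.rpow_add ht0]; norm_num
    have e3 : η ^ 2 * (w (η ^ 2 * t) * besselU 0 t)
        = η * (Real.exp (-(η ^ 2 * t)) * normalizedBesselJ 0 t) := by
      simp only [w, besselU]
      rw [Real.mul_rpow (by positivity) ht0.le]
      linear_combination (Real.exp (-(η ^ 2 * t)) * normalizedBesselJ 0 t) * (η * e2
        + t ^ (1 / 2 - 1 : ℝ) * t ^ (0 + 1 / 2 : ℝ) * e1)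
    have e4 : Complex.exp (-((η ^ 2 : ℝ) + Complex.I) * t)
        = (Real.exp (-(η ^ 2 * t)) : ℂ) * E t := by
      simp only [E]
      rw [Complex.ofReal_exp, ← Complex.exp_add]
      congr 1; push_cast; ring
    have e5 : ((η ^ 2 : ℝ) : ℂ) * ((w (η ^ 2 * t) : ℂ) * (besselU 0 t : ℂ))
        = (η : ℂ) * ((Real.exp (-(η ^ 2 * t)) : ℂ) * (normalizedBesselJ 0 t : ℂ)) := by
      exact_mod_cast e3
    rw [mul_div_cancel_left₀ _ (by positivity : (η ^ 2 : ℝ) ≠ 0), e4]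
    linear_combination -E t * e5
  rw [hscale, ← integral_complex_ofReal, ← integral_const_mul, ← integral_const_mul,
    ← integral_add (hi1.const_mul D) hi2, ← integral_add (hwc.const_mul C) hi3]
  congr 1; ext s
  have hEE : ∀ t : ℝ, E t * ((a * Real.cos t + b * Real.sin t : ℝ) : ℂ) = C + D * E (2 * t) := by
    intro t
    rw [wave_eq]
    simp only [E]
    have e1 : Complex.exp (-(t : ℂ) * Complex.I) * Complex.exp ((t : ℂ) * Complex.I) = 1 := by
      rw [← Complex.exp_add, neg_mul, neg_add_cancel, Complex.exp_zero]
    have e2 : Complex.exp (-((2 * t : ℝ) : ℂ) * Complex.I)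
        = Complex.exp (-(t : ℂ) * Complex.I) * Complex.exp (-(t : ℂ) * Complex.I) := by
      rw [← Complex.exp_add]; congr 1; push_cast; ring
    rw [e2]
    linear_combination C * e1
  have hur : (besselU 0 (s / η ^ 2) : ℂ) = (r (s / η ^ 2) : ℂ)
      + ((a * Real.cos (s / η ^ 2) + b * Real.sin (s / η ^ 2) : ℝ) : ℂ) := by
    rw [← Complex.ofReal_add]; congr 1; simp only [r]; ring
  rw [hur]
  linear_combination -(w s : ℂ) * hEE (s / η ^ 2)

/-- The real plus the imaginary part of `η ∫_0^π dθ / (η² + i (1 - cos θ))` tends to `0`. After the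
substitution `θ = η φ` the integrand tends to `(1 - φ²/2) / (1 + φ⁴/4)`, whose integral vanishes. -/
theorem tendsto_integral_stationary :
    Tendsto (fun η : ℝ => η * ∫ θ in (0 : ℝ)..Real.pi,
      (η ^ 2 - (1 - Real.cos θ)) / ((η ^ 2) ^ 2 + (1 - Real.cos θ) ^ 2)) (𝓝[>] 0) (𝓝 0) := by
  have hpi := Real.pi_pos
  -- the antiderivative of the limiting integrand is `artanh (φ / (1 + φ² / 2))`
  have hzero : ∫ φ in Set.Ioi (0 : ℝ), (1 - φ ^ 2 / 2) / (1 + (φ ^ 2 / 2) ^ 2) = 0 := by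
    let G : ℝ → ℝ := fun φ =>
      (Real.log (1 + φ + φ ^ 2 / 2) - Real.log (1 - φ + φ ^ 2 / 2)) / 2
    have hp : ∀ φ : ℝ, 0 < 1 + φ + φ ^ 2 / 2 := fun φ => by nlinarith [sq_nonneg (1 + φ)]
    have hm : ∀ φ : ℝ, 0 < 1 - φ + φ ^ 2 / 2 := fun φ => by nlinarith [sq_nonneg (1 - φ)]
    have hd : ∀ φ ∈ Set.Ici (0 : ℝ), HasDerivAt G
        ((1 - φ ^ 2 / 2) / (1 + (φ ^ 2 / 2) ^ 2)) φ := by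
      intro φ _
      have hsq : HasDerivAt (fun φ : ℝ => φ ^ 2 / 2) φ φ := by
        have := (hasDerivAt_pow 2 φ).div_const 2
        convert! this using 1; simp
      have h1 := (((hasDerivAt_id φ).const_add 1).add hsq).log (hp φ).ne'
      have h2 := (((hasDerivAt_id φ).const_sub 1).add hsq).log (hm φ).ne'
      convert! (h1.sub h2).div_const 2 using 1
      have h3 := (hp φ).ne'
      have h4 := (hm φ).ne'
      have h5 : 1 + (φ ^ 2 / 2) ^ 2 = (1 + φ + φ ^ 2 / 2) * (1 - φ + φ ^ 2 / 2) := by ring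
      simp only [Pi.add_apply, id]
      rw [h5, div_sub_div _ _ h3 h4, div_div, div_eq_div_iff (by positivity) (by positivity)]
      ring
    have hint : IntegrableOn (fun φ : ℝ => (1 - φ ^ 2 / 2) / (1 + (φ ^ 2 / 2) ^ 2))
        (Set.Ioi 0) := by
      refine Integrable.mono' (integrable_inv_one_add_sq.const_mul 4).integrableOn
        (Measurable.aestronglyMeasurable (by fun_prop)) (Eventually.of_forall fun φ => ?_)
      rw [Real.norm_eq_abs, abs_div, abs_of_pos (show 0 < 1 + (φ ^ 2 / 2) ^ 2 by positivity),
        ← div_eq_mul_inv, div_le_div_iff₀ (by positivity) (by positivity)]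
      have : |1 - φ ^ 2 / 2| ≤ 1 + φ ^ 2 / 2 := by
        rw [abs_le]; constructor <;> nlinarith [sq_nonneg φ]
      nlinarith [sq_nonneg (φ ^ 2 / 2 - 1), sq_nonneg φ]
    have hlim : Tendsto G atTop (𝓝 0) := by
      have h8 : Tendsto (fun φ : ℝ => 1 + 8 / φ) atTop (𝓝 1) := by
        simpa using (tendsto_const_nhds (x := (8 : ℝ))).div_atTop tendsto_id |>.const_add 1
      have hq : Tendsto (fun φ : ℝ => (1 + φ + φ ^ 2 / 2) / (1 - φ + φ ^ 2 / 2)) atTop (𝓝 1) := by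
        refine tendsto_of_tendsto_of_tendsto_of_le_of_le' tendsto_const_nhds h8 ?_ ?_
        · filter_upwards [eventually_ge_atTop 4] with φ hφ
          rw [le_div_iff₀ (hm φ)]; linarith
        · filter_upwards [eventually_ge_atTop 4] with φ hφ
          have hφ0 : 0 < φ := by linarith
          rw [div_le_iff₀ (hm φ)]
          have : 2 * φ ≤ 8 / φ * (1 - φ + φ ^ 2 / 2) := by
            rw [div_mul_eq_mul_div, le_div_iff₀ hφ0]; nlinarith
          nlinarith
      have := (hq.log one_ne_zero).div_const 2
      rw [Real.log_one, zero_div] at this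
      refine this.congr fun φ => ?_
      rw [Real.log_div (hp φ).ne' (hm φ).ne']
    rw [integral_Ioi_of_hasDerivAt_of_tendsto' hd hint hlim]
    simp [G]
  -- the integrand after the substitution `θ = η φ`
  let F : ℝ → ℝ → ℝ := fun η => (Set.Ioc 0 (Real.pi / η)).indicator fun φ =>
    (1 - (1 - Real.cos (η * φ)) / η ^ 2) / (1 + ((1 - Real.cos (η * φ)) / η ^ 2) ^ 2)
  have hF : Tendsto (fun η => ∫ φ in Set.Ioi (0 : ℝ), F η φ) (𝓝[>] 0)
      (𝓝 (∫ φ in Set.Ioi (0 : ℝ), (1 - φ ^ 2 / 2) / (1 + (φ ^ 2 / 2) ^ 2))) := by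
    refine tendsto_integral_filter_of_dominated_convergence
      (fun φ => Real.pi ^ 2 * (1 + φ ^ 2)⁻¹) ?_ ?_
      (integrable_inv_one_add_sq.const_mul _).integrableOn ?_
    · filter_upwards [self_mem_nhdsWithin] with η hη
      refine (Measurable.indicator ?_ measurableSet_Ioc).aestronglyMeasurable
      fun_prop
    · filter_upwards [self_mem_nhdsWithin] with η hη
      have hη0 : (0 : ℝ) < η := hη
      refine Eventually.of_forall fun φ => ?_
      by_cases hφ : φ ∈ Set.Ioc 0 (Real.pi / η)
      · simp only [F]
        rw [Set.indicator_of_mem hφ]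
        set y := (1 - Real.cos (η * φ)) / η ^ 2 with hy
        have hφ0 : 0 < φ := hφ.1
        have hφ1 : η * φ ≤ Real.pi := by
          have := (le_div_iff₀ hη0).1 hφ.2
          linarith
        have hcos := Real.cos_le_one_sub_mul_cos_sq (x := η * φ)
          (by rw [abs_of_pos (by positivity)]; exact hφ1)
        have hy1 : 2 / Real.pi ^ 2 * φ ^ 2 ≤ y := by
          rw [hy, le_div_iff₀ (by positivity)]
          nlinarith
        have hy0 : 0 ≤ y := le_trans (by positivity) hy1
        rw [Real.norm_eq_abs, abs_div, abs_of_pos (show 0 < 1 + y ^ 2 by positivity)]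
        have h1 : |1 - y| / (1 + y ^ 2) ≤ 2 / (1 + y) := by
          rw [div_le_div_iff₀ (by positivity) (by positivity)]
          have : |1 - y| ≤ 1 + y := by rw [abs_le]; constructor <;> linarith
          nlinarith [sq_nonneg (1 - y)]
        have h2 : 2 / Real.pi ^ 2 * (1 + φ ^ 2) ≤ 1 + y := by
          have : 2 / Real.pi ^ 2 ≤ 1 := by
            rw [div_le_one (by positivity)]
            nlinarith [Real.pi_gt_three]
          nlinarith
        calc |1 - y| / (1 + y ^ 2) ≤ 2 / (1 + y) := h1
          _ ≤ 2 / (2 / Real.pi ^ 2 * (1 + φ ^ 2)) := by gcongr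
          _ = _ := by field_simp
      · simp only [F]
        rw [Set.indicator_of_notMem hφ, norm_zero]
        positivity
    · refine (ae_restrict_iff' measurableSet_Ioi).2 (Eventually.of_forall fun φ hφ => ?_)
      have hφ0 : (0 : ℝ) < φ := hφ
      have hy : Tendsto (fun η : ℝ => (1 - Real.cos (η * φ)) / η ^ 2) (𝓝[>] 0)
          (𝓝 (φ ^ 2 / 2)) := by
        have h0 : Tendsto (fun η : ℝ => φ ^ 4 * (5 / 96) * η ^ 2) (𝓝[>] 0) (𝓝 0) := by
          have : Tendsto (fun η : ℝ => φ ^ 4 * (5 / 96) * η ^ 2) (𝓝 0)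
            (𝓝 (φ ^ 4 * (5 / 96) * 0 ^ 2)) := Continuous.tendsto (by fun_prop) 0
          rw [zero_pow two_ne_zero, mul_zero] at this
          exact this.mono_left nhdsWithin_le_nhds
        rw [tendsto_iff_norm_sub_tendsto_zero]
        refine squeeze_zero' (Eventually.of_forall fun _ => norm_nonneg _) ?_ h0
        have h1 : ∀ᶠ η : ℝ in 𝓝[>] 0, η < 1 / φ :=
          (Filter.Tendsto.eventually_lt_const (by positivity) tendsto_id).filter_mono
            nhdsWithin_le_nhds
        filter_upwards [self_mem_nhdsWithin, h1] with η hη h1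
        have hη0 : (0 : ℝ) < η := hη
        have h2 : |η * φ| ≤ 1 := by
          rw [abs_of_pos (by positivity)]
          exact ((lt_div_iff₀ hφ0).1 h1).le
        have h3 := Real.cos_bound h2
        rw [abs_of_pos (show 0 < η * φ by positivity)] at h3
        have e : (1 - Real.cos (η * φ)) / η ^ 2 - φ ^ 2 / 2
            = -(Real.cos (η * φ) - (1 - (η * φ) ^ 2 / 2)) / η ^ 2 := by
          field_simp; ring
        rw [e, Real.norm_eq_abs, abs_div, abs_neg, abs_of_pos (show 0 < η ^ 2 by positivity),
          div_le_iff₀ (by positivity)]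
        calc _ ≤ _ := h3
          _ = _ := by ring
      have hlim : Tendsto (fun η : ℝ => (1 - (1 - Real.cos (η * φ)) / η ^ 2)
          / (1 + ((1 - Real.cos (η * φ)) / η ^ 2) ^ 2)) (𝓝[>] 0)
          (𝓝 ((1 - φ ^ 2 / 2) / (1 + (φ ^ 2 / 2) ^ 2))) :=
        (hy.const_sub 1).div ((hy.pow 2).const_add 1) (by positivity)
      refine hlim.congr' ?_
      have h1 : ∀ᶠ η : ℝ in 𝓝[>] 0, η < Real.pi / φ :=
        (Filter.Tendsto.eventually_lt_const (by positivity) tendsto_id).filter_mono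
          nhdsWithin_le_nhds
      filter_upwards [self_mem_nhdsWithin, h1] with η hη h1
      have hη0 : (0 : ℝ) < η := hη
      have hmem : φ ∈ Set.Ioc 0 (Real.pi / η) := by
        refine ⟨hφ0, ?_⟩
        rw [le_div_iff₀ hη0]
        have := (lt_div_iff₀ hφ0).1 h1
        linarith
      simp only [F]
      rw [Set.indicator_of_mem hmem]
  rw [hzero] at hF
  refine hF.congr' ?_
  filter_upwards [self_mem_nhdsWithin] with η hη
  have hη0 : (0 : ℝ) < η := hη
  have h1 := intervalIntegral.integral_comp_mul_left (a := 0) (b := Real.pi / η) (c := η)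
    (fun θ : ℝ => (η ^ 2 - (1 - Real.cos θ)) / ((η ^ 2) ^ 2 + (1 - Real.cos θ) ^ 2)) hη0.ne'
  rw [mul_zero, mul_div_cancel₀ _ hη0.ne', eq_inv_smul_iff₀ hη0.ne', smul_eq_mul] at h1
  rw [← h1, setIntegral_indicator measurableSet_Ioc,
    Set.inter_eq_self_of_subset_right (fun φ hφ => hφ.1),
    ← intervalIntegral.integral_of_le (by positivity),
    ← mul_assoc, ← intervalIntegral.integral_const_mul]
  congr 1; ext φ
  field_simp

/-- The asymptotics of `J_0` have phase `π / 4`: the Laplace transform of `e^{-it} J_0(t)` near the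
origin is computed from the asymptotics of `J_0` on one side, and from Bessel's integral on the
other. -/
theorem besselU_zero_phase {a b M : ℝ}
    (hM : ∀ t : ℝ, 0 < t → |besselU 0 t - (a * Real.cos t + b * Real.sin t)| ≤ M / t) :
    a = b := by
  let ℓ : ℂ →L[ℝ] ℝ := Complex.reCLM + Complex.imCLM
  have hℓ : ∀ z : ℂ, ℓ z = z.re + z.im := fun z => rfl
  have h1 := (ℓ.continuous.tendsto _).comp (tendsto_laplace_normalizedBesselJ_zero hM)
  have h2 := tendsto_integral_stationary.const_mul Real.pi⁻¹
  rw [mul_zero] at h2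
  have h3 : Tendsto (fun η : ℝ => Real.pi⁻¹ * (η * ∫ θ in (0 : ℝ)..Real.pi,
      (η ^ 2 - (1 - Real.cos θ)) / ((η ^ 2) ^ 2 + (1 - Real.cos θ) ^ 2))) (𝓝[>] 0)
      (𝓝 (ℓ ((a - b * Complex.I) / 2 *
        (∫ s in Set.Ioi (0 : ℝ), Real.exp (-s) * s ^ (1 / 2 - 1 : ℝ) : ℝ)))) := by
    refine h1.congr' ?_
    filter_upwards [self_mem_nhdsWithin] with η hη
    have hη0 : (0 : ℝ) < η := hη
    simp only [Function.comp]
    have hre : ∀ p q : ℝ, ((p : ℂ) + q * Complex.I).re = p := fun p q => by simp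
    have him : ∀ p q : ℝ, ((p : ℂ) + q * Complex.I).im = q := fun p q => by simp
    have hne : ∀ θ : ℝ, ((η ^ 2 : ℝ) : ℂ) + (1 - Real.cos θ : ℝ) * Complex.I ≠ 0 := by
      intro θ h
      have := congrArg Complex.re h
      rw [hre] at this
      exact (pow_pos hη0 2).ne' this
    have hc : Continuous fun θ : ℝ => 1 / (((η ^ 2 : ℝ) : ℂ) + (1 - Real.cos θ : ℝ) * Complex.I) :=
      continuous_const.div (by fun_prop) hne
    rw [laplace_normalizedBesselJ_zero (by positivity)]
    have e : (η : ℂ) * ((Real.pi : ℂ)⁻¹ * ∫ θ in (0 : ℝ)..Real.pi,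
        1 / (((η ^ 2 : ℝ) : ℂ) + (1 - Real.cos θ : ℝ) * Complex.I))
        = (Real.pi⁻¹ * η : ℝ) • ∫ θ in (0 : ℝ)..Real.pi,
        1 / (((η ^ 2 : ℝ) : ℂ) + (1 - Real.cos θ : ℝ) * Complex.I) := by
      rw [Complex.real_smul]; push_cast; ring
    rw [e, map_smul, ← ContinuousLinearMap.intervalIntegral_comp_comm ℓ (hc.intervalIntegrable _ _),
      smul_eq_mul, mul_assoc]
    congr 3; ext θ
    rw [hℓ, one_div, Complex.inv_re, Complex.inv_im, Complex.normSq_apply, hre, him]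
    ring
  have h4 := tendsto_nhds_unique h2 h3
  -- `h4` now says that the real and imaginary parts of `(a - b i) Γ(1/2)` add up to zero
  have hG : ∫ s in Set.Ioi (0 : ℝ), Real.exp (-s) * s ^ (1 / 2 - 1 : ℝ) = Real.Gamma (1 / 2) :=
    (Real.Gamma_eq_integral (by norm_num)).symm
  have hG0 : 0 < Real.Gamma (1 / 2) := Real.Gamma_pos_of_pos (by norm_num)
  have h5 : (a - b * Complex.I) / 2 * (Real.Gamma (1 / 2) : ℂ)
      = ((a / 2 * Real.Gamma (1 / 2) : ℝ) : ℂ)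
        + ((-b / 2 * Real.Gamma (1 / 2) : ℝ) : ℂ) * Complex.I := by
    push_cast; ring
  rw [hG, h5, hℓ, Complex.add_re, Complex.add_im, Complex.ofReal_re, Complex.ofReal_im,
    Complex.re_ofReal_mul, Complex.im_ofReal_mul, Complex.I_re, Complex.I_im] at h4
  have h6 : (a - b) * Real.Gamma (1 / 2) = 0 := by linarith
  linarith [(mul_eq_zero.1 h6).resolve_right hG0.ne']

/-! ### Null events of the walk -/

theorem measurable_sum_steps (d n : ℕ) :
    Measurable fun X : Fin n → UnitSphere d => ∑ i, (X i : EuclideanSpace ℝ (Fin d)) :=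
  Finset.measurable_sum _ fun i _ => measurable_subtype_coe.comp (measurable_pi_apply i)

open scoped Pointwise in
theorem uniformSphere_singleton {d : ℕ} (hd : 2 ≤ d) (u : UnitSphere d) :
    uniformSphere d {u} = 0 := by
  have h : (volume : Measure (EuclideanSpace ℝ (Fin d))).toSphere {u} = 0 := by
    rw [Measure.toSphere_apply' _ (measurableSet_singleton u)]
    have hsub : Set.Ioo (0 : ℝ) 1 • (Subtype.val '' ({u} : Set (UnitSphere d)))
        ⊆ ((ℝ ∙ (u : EuclideanSpace ℝ (Fin d)) : Submodule ℝ (EuclideanSpace ℝ (Fin d))) :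
          Set (EuclideanSpace ℝ (Fin d))) := by
      rintro _ ⟨r, -, _, ⟨v, rfl, rfl⟩, rfl⟩
      exact Submodule.smul_mem _ _ (Submodule.mem_span_singleton_self _)
    have hne : (ℝ ∙ (u : EuclideanSpace ℝ (Fin d)) :
        Submodule ℝ (EuclideanSpace ℝ (Fin d))) ≠ ⊤ := by
      intro htop
      have h1 := finrank_span_le_card (R := ℝ) ({(u : EuclideanSpace ℝ (Fin d))} : Set _)
      rw [htop, finrank_top, finrank_euclideanSpace, Fintype.card_fin] at h1
      simp at h1
      omega
    rw [measure_mono_null hsub (Measure.addHaar_submodule _ _ hne), mul_zero]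
  rw [uniformSphere, Measure.smul_apply, h, smul_zero]

theorem uniformSphere_of_countable {d : ℕ} (hd : 2 ≤ d) {s : Set (UnitSphere d)}
    (hs : s.Countable) : uniformSphere d s = 0 := by
  rw [← Set.biUnion_of_singleton s]
  exact (measure_biUnion_null_iff hs).2 fun u _ => uniformSphere_singleton hd u

/-- Conditioning on all steps but the first. -/
theorem stepsLaw_null_of_forall {d m : ℕ} (hd : 2 ≤ d)
    {A : Set (EuclideanSpace ℝ (Fin d))} (hA : MeasurableSet A)
    (h : ∀ᵐ Y ∂(stepsLaw d m), uniformSphere d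
      {u | (u : EuclideanSpace ℝ (Fin d)) + ∑ i, (Y i : EuclideanSpace ℝ (Fin d)) ∈ A} = 0) :
    stepsLaw d (m + 1) {X | ∑ i, (X i : EuclideanSpace ℝ (Fin d)) ∈ A} = 0 := by
  have := isProbabilityMeasure_uniformSphere (d := d) (by omega)
  have hmp := measurePreserving_piFinSuccAbove (fun _ : Fin (m + 1) => uniformSphere d) 0
  let B : Set (UnitSphere d × (Fin m → UnitSphere d)) :=
    {p | (p.1 : EuclideanSpace ℝ (Fin d)) + ∑ i, (p.2 i : EuclideanSpace ℝ (Fin d)) ∈ A}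
  have hB : MeasurableSet B := by
    have : Measurable fun p : UnitSphere d × (Fin m → UnitSphere d) =>
        (p.1 : EuclideanSpace ℝ (Fin d)) + ∑ i, (p.2 i : EuclideanSpace ℝ (Fin d)) :=
      (measurable_subtype_coe.comp measurable_fst).add
        ((measurable_sum_steps d m).comp measurable_snd)
    exact this hA
  have e : {X : Fin (m + 1) → UnitSphere d | ∑ i, (X i : EuclideanSpace ℝ (Fin d)) ∈ A}
      = (MeasurableEquiv.piFinSuccAbove (fun _ => UnitSphere d) 0) ⁻¹' B := by
    ext X
    simp only [B, Set.mem_preimage, Set.mem_ofPred_eq, Fin.sum_univ_succ]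
    rfl
  rw [e, stepsLaw, hmp.measure_preimage hB.nullMeasurableSet, Measure.prod_apply_symm hB,
    lintegral_eq_zero_iff (measurable_measure_prodMk_right hB)]
  exact h

/-- The walk is almost surely not at the origin. -/
theorem stepsLaw_sum_eq_zero {d n : ℕ} (hd : 2 ≤ d) (hn : 1 ≤ n) :
    stepsLaw d n {X | ∑ i, (X i : EuclideanSpace ℝ (Fin d)) ∈ ({0} : Set _)} = 0 := by
  obtain ⟨m, rfl⟩ : ∃ m, n = m + 1 := ⟨n - 1, by omega⟩
  refine stepsLaw_null_of_forall hd (measurableSet_singleton _) (Eventually.of_forall fun Y => ?_)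
  refine uniformSphere_of_countable hd (Set.Subsingleton.countable fun u hu v hv => ?_)
  have hu' := eq_neg_of_add_eq_zero_left hu
  have hv' := eq_neg_of_add_eq_zero_left hv
  exact Subtype.ext (hu'.trans hv'.symm)

/-- In the plane, the distance has no atoms for `n ≥ 2`: given the other steps, with sum `v ≠ 0`,
the first step lies on the unit circle and on a circle around `-v`, which meet in at most two points. -/
theorem stepsLaw_two_norm_eq {n : ℕ} (hn : 2 ≤ n) (r : ℝ) :
    stepsLaw 2 n {X | ∑ i, (X i : EuclideanSpace ℝ (Fin 2)) ∈ {y | ‖y‖ = r}} = 0 := by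
  obtain ⟨m, rfl⟩ : ∃ m, n = m + 1 := ⟨n - 1, by omega⟩
  have hA : MeasurableSet {y : EuclideanSpace ℝ (Fin 2) | ‖y‖ = r} :=
    measurable_norm (measurableSet_singleton r)
  refine stepsLaw_null_of_forall le_rfl hA ?_
  have h0 : ∀ᵐ Y ∂(stepsLaw 2 m), ∑ i, (Y i : EuclideanSpace ℝ (Fin 2)) ≠ 0 :=
    measure_eq_zero_iff_ae_notMem.1 (stepsLaw_sum_eq_zero le_rfl (by omega))
  filter_upwards [h0] with Y hY
  set v := ∑ i, (Y i : EuclideanSpace ℝ (Fin 2))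
  set s : Set (UnitSphere 2) := {u | (u : EuclideanSpace ℝ (Fin 2)) + v ∈ {y | ‖y‖ = r}}
  refine uniformSphere_of_countable le_rfl ?_
  by_cases hs : s.Subsingleton
  · exact hs.countable
  obtain ⟨p, hp, q, hq, hpq⟩ := Set.not_subsingleton_iff.1 hs
  refine (Set.Finite.subset (Set.toFinite {p, q}) fun u hu => ?_).countable
  have hnorm : ∀ u : UnitSphere 2, dist (u : EuclideanSpace ℝ (Fin 2)) 0 = 1 := fun u => by simp
  have hdist : ∀ u ∈ s, dist (u : EuclideanSpace ℝ (Fin 2)) (-v) = r := by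
    intro u hu
    rw [dist_eq_norm, sub_neg_eq_add]
    exact hu
  rcases EuclideanGeometry.eq_of_dist_eq_of_dist_eq_of_finrank_eq_two (by simp)
    (show (0 : EuclideanSpace ℝ (Fin 2)) ≠ -v from fun h => hY (by rw [← neg_neg v, ← h, neg_zero]))
    (fun h => hpq (Subtype.ext h)) (hnorm p) (hnorm q) (hnorm u) (hdist p hp) (hdist q hq)
    (hdist u hu) with h | h
  · exact Or.inl (Subtype.ext h)
  · exact Or.inr (Subtype.ext h)

/-- Two steps have total length `2` only if they are equal. -/
theorem stepsLaw_norm_eq_two {d : ℕ} (hd : 2 ≤ d) :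
    stepsLaw d 2 {X | ∑ i, (X i : EuclideanSpace ℝ (Fin d)) ∈ {y | ‖y‖ = 2}} = 0 := by
  have hA : MeasurableSet {y : EuclideanSpace ℝ (Fin d) | ‖y‖ = 2} :=
    measurable_norm (measurableSet_singleton 2)
  refine stepsLaw_null_of_forall (m := 1) hd hA (Eventually.of_forall fun Y => ?_)
  refine uniformSphere_of_countable hd (Set.Countable.mono (fun u hu => ?_)
    (Set.countable_singleton (Y 0)))
  have hu' : ‖(u : EuclideanSpace ℝ (Fin d)) + ∑ i, (Y i : EuclideanSpace ℝ (Fin d))‖ = 2 := hu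
  rw [Fin.sum_univ_one] at hu'
  have h1 : ‖(u : EuclideanSpace ℝ (Fin d))‖ = 1 := by simp
  have h2 : ‖(Y 0 : EuclideanSpace ℝ (Fin d))‖ = 1 := by simp
  have hray : SameRay ℝ (u : EuclideanSpace ℝ (Fin d)) (Y 0) :=
    sameRay_iff_norm_add.2 (by rw [hu', h1, h2]; norm_num)
  exact Subtype.ext (hray.eq_of_norm_eq (h1.trans h2.symm))

/-! ### The density on its regular set -/

/-- The positive points at which the density is continuous: all but `x = 2` for `n = 2`,
`d ∈ {2, 3}`, and `x ∈ {1, 3}` for `n = 3`, `d = 2`. -/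
def regularSet (d n : ℕ) : Set ℝ :=
  {x | 0 < x ∧ ¬ (d = 2 ∧ n = 2 ∧ x = 2) ∧ ¬ (d = 2 ∧ n = 3 ∧ (x = 1 ∨ x = 3)) ∧
    ¬ (d = 3 ∧ n = 2 ∧ x = 2)}

theorem mem_regularSet_of_notMem {d n : ℕ} {x : ℝ} (hx : 0 < x) (h : x ∉ ({1, 2, 3} : Set ℝ)) :
    x ∈ regularSet d n := by
  simp only [Set.mem_insert_iff, Set.mem_singleton_iff, not_or] at h
  exact ⟨hx, fun h' => h.2.1 h'.2.2, fun h' => h'.2.2.elim h.1 h.2.2, fun h' => h.2.1 h'.2.2⟩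

theorem isOpen_regularSet (d n : ℕ) : IsOpen (regularSet d n) := by
  have hne : ∀ (q : Prop) (c : ℝ), IsOpen {x : ℝ | ¬ (q ∧ x = c)} := by
    intro q c
    by_cases hq : q
    · simpa [hq] using isOpen_ne
    · simp [hq]
  have h := (isOpen_Ioi (a := (0 : ℝ))).inter ((hne (d = 2 ∧ n = 2) 2).inter
    (((hne (d = 2 ∧ n = 3) 1).inter (hne (d = 2 ∧ n = 3) 3)).inter (hne (d = 3 ∧ n = 2) 2)))
  convert! h using 1
  ext x
  simp only [regularSet, Set.mem_inter_iff, Set.mem_ofPred_eq, Set.mem_Ioi]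
  tauto

/-- Either the inversion integral converges absolutely, or a regular point is not a resonance. The
first alternative means `3 ≤ (n - 1) (d - 1)`, so that the second concerns only
`(d, n) = (2, 2), (3, 2), (2, 3)`. -/
theorem one_lt_or_ne_of_mem_regularSet {d n : ℕ} (hd : 2 ≤ d) (hn : 2 ≤ n) {ν : ℝ}
    (hν : ν = (d : ℝ) / 2 - 1) {x : ℝ} (hx : x ∈ regularSet d n) :
    1 < ((n : ℝ) - 1) * (ν + 1 / 2) ∨ ∀ l ≤ n, x ≠ 2 * l - n := by
  obtain ⟨hx0, h22, h23, h32⟩ := hx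
  by_cases h : 3 ≤ (n - 1) * (d - 1)
  · left
    have h' : (3 : ℝ) ≤ ((n - 1 : ℕ) : ℝ) * ((d - 1 : ℕ) : ℝ) := by exact_mod_cast h
    rw [Nat.cast_sub (by omega), Nat.cast_sub (by omega)] at h'
    rw [hν]
    push_cast at h'
    linarith
  · right
    obtain ⟨e, rfl⟩ : ∃ e, d = e + 2 := ⟨d - 2, by omega⟩
    obtain ⟨m, rfl⟩ : ∃ m, n = m + 2 := ⟨n - 2, by omega⟩
    have h1 : (m + 1) * (e + 1) ≤ 2 := by
      have : (m + 2 - 1) * (e + 2 - 1) = (m + 1) * (e + 1) := rfl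
      omega
    have hcases : (m = 0 ∧ e = 0) ∨ (m = 0 ∧ e = 1) ∨ (m = 1 ∧ e = 0) := by
      have hm : m ≤ 1 := by nlinarith
      have he : e ≤ 1 := by nlinarith
      interval_cases m <;> interval_cases e <;> simp_all
    intro l hl hxl
    rcases hcases with ⟨rfl, rfl⟩ | ⟨rfl, rfl⟩ | ⟨rfl, rfl⟩
    · have : l ≤ 2 := hl
      interval_cases l <;> norm_num at hxl
      · linarith
      · linarith
      · exact h22 ⟨rfl, rfl, hxl⟩
    · have : l ≤ 2 := hl
      interval_cases l <;> norm_num at hxl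
      · linarith
      · linarith
      · exact h32 ⟨rfl, rfl, hxl⟩
    · have : l ≤ 3 := hl
      interval_cases l <;> norm_num at hxl
      · linarith
      · linarith
      · exact h23 ⟨rfl, rfl, Or.inl hxl⟩
      · exact h23 ⟨rfl, rfl, Or.inr hxl⟩

/-- Near a regular point, the inversion integrals converge uniformly. -/
theorem exists_eventually_tailBound {d n : ℕ} (hd : 2 ≤ d) (hn : 2 ≤ n) {ν : ℝ}
    (hν : ν = (d : ℝ) / 2 - 1) {x₀ : ℝ} (hx₀ : x₀ ∈ regularSet d n) :
    ∃ r B : ℝ, 0 < r ∧ ∀ᶠ x in 𝓝 x₀, TailBound r B (truncatedHankel d n ν x) := by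
  have hd2 : (2 : ℝ) ≤ d := by exact_mod_cast hd
  have hn2 : (2 : ℝ) ≤ n := by exact_mod_cast hn
  have hpos : 0 < x₀ := hx₀.1
  rcases one_lt_or_ne_of_mem_regularSet hd hn hν hx₀ with hs | hne
  · obtain ⟨B, hB⟩ := exists_tailBound_of_one_lt hd hν hs
    exact ⟨_, B, by linarith, (lt_mem_nhds hpos).mono hB⟩
  · have hδ : ∀ᶠ δ : ℝ in 𝓝[>] 0, δ < x₀ / 2 ∧
        ∀ l ∈ Finset.range (n + 1), δ < |x₀ - (2 * l - n)| / 2 := by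
      refine Eventually.filter_mono nhdsWithin_le_nhds ((gt_mem_nhds (by positivity)).and
        ((Filter.eventually_all_finset _).2 fun l hl => gt_mem_nhds ?_))
      have : x₀ - (2 * l - n) ≠ 0 :=
        sub_ne_zero.2 (hne l (Nat.lt_succ_iff.1 (Finset.mem_range.1 hl)))
      positivity
    obtain ⟨δ, ⟨hδ1, hδ2⟩, hδ0⟩ := (hδ.and self_mem_nhdsWithin).exists
    have hδ0 : 0 < δ := hδ0
    obtain ⟨B, hB⟩ := exists_tailBound_nonresonant hd hn hν hδ0
    have hr : 0 < ((n : ℝ) - 1) * (ν + 1 / 2) := mul_pos (by linarith) (by rw [hν]; linarith)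
    refine ⟨_, B, hr, ?_⟩
    filter_upwards [Metric.ball_mem_nhds x₀ hδ0] with x hx
    rw [Metric.mem_ball, Real.dist_eq] at hx
    refine hB x ?_ fun l hl => ?_
    · linarith [(abs_lt.1 hx).1]
    · have h1 := hδ2 l (Finset.mem_range.2 (Nat.lt_succ_of_le hl))
      have h2 : |x₀ - (2 * l - n)| ≤ |x - (2 * l - n)| + |x - x₀| := by
        have e : x₀ - (2 * (l : ℝ) - n) = (x - (2 * l - n)) - (x - x₀) := by ring
        rw [e]; exact abs_sub _ _
      linarith

/-- The limit of the normalized truncated integrals. It is an arbitrary value where they do not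
converge. -/
noncomputable def hankelLimit (d n : ℕ) (ν x : ℝ) : ℝ :=
  limUnder atTop fun T => truncatedHankel d n ν x T

/-- The density at the positive points where the inversion integral converges. -/
noncomputable def densityLimit (d n : ℕ) (ν x : ℝ) : ℝ :=
  sphereArea d ^ 2 / (2 * Real.pi) ^ d * x ^ (ν + 1 / 2) * hankelLimit d n ν x

section Density

variable {d n : ℕ} {ν : ℝ}

theorem tendsto_hankelLimit (hd : 2 ≤ d) (hn : 2 ≤ n) (hν : ν = (d : ℝ) / 2 - 1) {x : ℝ}
    (hx : x ∈ regularSet d n) :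
    Tendsto (fun T => truncatedHankel d n ν x T) atTop (𝓝 (hankelLimit d n ν x)) := by
  obtain ⟨r, B, hr, hB⟩ := exists_eventually_tailBound hd hn hν hx
  obtain ⟨L, hL, -⟩ := hB.self_of_nhds.exists_tendsto hr
  exact tendsto_nhds_limUnder ⟨L, hL⟩

theorem tendsto_densityLimit (hd : 2 ≤ d) (hν : ν = (d : ℝ) / 2 - 1) {x : ℝ} (hx : 0 < x)
    (h : Tendsto (fun T => truncatedHankel d n ν x T) atTop (𝓝 (hankelLimit d n ν x))) :
    Tendsto (fun T => besselIntegral ν n x T) atTop (𝓝 (densityLimit d n ν x)) := by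
  refine (h.const_mul _).congr' ?_
  filter_upwards [eventually_ge_atTop 0] with T hT
  rw [besselIntegral_eq_truncatedHankel hd hν n hx hT]

theorem nonneg_of_dim (hd : 2 ≤ d) (hν : ν = (d : ℝ) / 2 - 1) : 0 ≤ ν := by
  have : (2 : ℝ) ≤ d := by exact_mod_cast hd
  rw [hν]; linarith

theorem continuousAt_hankelLimit (hd : 2 ≤ d) (hn : 2 ≤ n) (hν : ν = (d : ℝ) / 2 - 1) {x : ℝ}
    (hx : x ∈ regularSet d n) : ContinuousAt (hankelLimit d n ν) x := by
  obtain ⟨r, B, hr, hB⟩ := exists_eventually_tailBound hd hn hν hx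
  refine continuousAt_of_tailBound hr hB ?_
    fun T _ => continuousAt_truncatedHankel d n (nonneg_of_dim hd hν) x T
  filter_upwards [(isOpen_regularSet d n).mem_nhds hx] with y hy
  exact tendsto_hankelLimit hd hn hν hy

theorem continuousAt_densityLimit (hd : 2 ≤ d) (hn : 2 ≤ n) (hν : ν = (d : ℝ) / 2 - 1) {x : ℝ}
    (hx : x ∈ regularSet d n) : ContinuousAt (densityLimit d n ν) x :=
  ((Real.continuousAt_rpow_const _ _ (Or.inl hx.1.ne')).const_mul _).mul
    (continuousAt_hankelLimit hd hn hν hx)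

/-- Near a regular point, the law of the distance integrates smooth test functions like
`densityLimit`. -/
theorem exists_integral_eq_integral_densityLimit (hd : 2 ≤ d) (hn : 2 ≤ n)
    (hν : ν = (d : ℝ) / 2 - 1) {x₀ : ℝ} (hx₀ : x₀ ∈ regularSet d n) :
    ∃ α β : ℝ, α < x₀ ∧ x₀ < β ∧ Set.Icc α β ⊆ regularSet d n ∧
      ∀ (a b : ℝ) (φ : ℝ → ℝ), α ≤ a → a ≤ b → b ≤ β → ContDiff ℝ ((⊤ : ℕ∞) : WithTop ℕ∞) φ →
        (∀ r, r ∉ Set.Icc a b → φ r = 0) →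
        ∫ r, φ r ∂(walkDistanceLaw d n) = ∫ r in a..b, φ r * densityLimit d n ν r := by
  obtain ⟨r, B, hr, hB⟩ := exists_eventually_tailBound hd hn hν hx₀
  obtain ⟨δ, hδ, hball⟩ := Metric.eventually_nhds_iff_ball.1
    (hB.and ((isOpen_regularSet d n).mem_nhds hx₀))
  have hmem : ∀ x ∈ Set.Icc (x₀ - δ / 2) (x₀ + δ / 2), x ∈ Metric.ball x₀ δ := by
    intro x hx
    rw [Metric.mem_ball, Real.dist_eq, abs_lt]
    constructor <;> linarith [hx.1, hx.2]
  refine ⟨x₀ - δ / 2, x₀ + δ / 2, by linarith, by linarith, fun x hx => (hball x (hmem x hx)).2,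
    fun a b φ ha hab hb hφ hsupp => ?_⟩
  have hreg : ∀ x ∈ Set.Icc a b, TailBound r B (truncatedHankel d n ν x) ∧ x ∈ regularSet d n :=
    fun x hx => hball x (hmem x ⟨ha.trans hx.1, hx.2.trans hb⟩)
  have ha0 : 0 < a := (hreg a ⟨le_rfl, hab⟩).2.1
  have hν0 := nonneg_of_dim hd hν
  -- pass to the limit in the weak inversion formula, by dominated convergence on `[a, b]`
  rw [walkDistanceLaw, integral_map (measurable_sum_steps d n).norm.aemeasurable
    hφ.continuous.aestronglyMeasurable]
  refine tendsto_nhds_unique (tendsto_integral_mul_besselIntegral hd n hν ha0 hab hφ hsupp) ?_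
  set κ := sphereArea d ^ 2 / (2 * Real.pi) ^ d
  have hκ : 0 ≤ κ := by positivity
  have huIoc : ∀ x, x ∈ Set.uIoc a b → x ∈ Set.Icc a b := fun x hx => by
    rw [Set.uIoc_of_le hab] at hx; exact ⟨hx.1.le, hx.2⟩
  have hLc : ContinuousOn (hankelLimit d n ν) (Set.uIcc a b) := fun x hx => by
    rw [Set.uIcc_of_le hab] at hx
    exact (continuousAt_hankelLimit hd hn hν (hreg x hx).2).continuousWithinAt
  have hpc : ContinuousOn (fun x : ℝ => x ^ (ν + 1 / 2)) (Set.uIcc a b) := fun x hx =>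
    (Real.continuousAt_rpow_const _ _ (Or.inr (by positivity))).continuousWithinAt
  have hφc := hφ.continuous
  refine intervalIntegral.tendsto_integral_filter_of_dominated_convergence
    (fun x => |φ x| * (κ * x ^ (ν + 1 / 2) * (|hankelLimit d n ν x| + |B|))) ?_ ?_ ?_ ?_
  · filter_upwards [eventually_ge_atTop 0] with T hT
    have hc : ContinuousOn (fun x => φ x * (κ * x ^ (ν + 1 / 2) * truncatedHankel d n ν x T))
        (Set.uIoc a b) := fun x hx =>
      (hφc.continuousAt.mul (((Real.continuousAt_rpow_const _ _ (Or.inr (by positivity))).const_mul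
        κ).mul (continuousAt_truncatedHankel d n hν0 x T))).continuousWithinAt
    refine (hc.aestronglyMeasurable measurableSet_uIoc).congr ?_
    refine (ae_restrict_iff' measurableSet_uIoc).2 (Eventually.of_forall fun x hx => ?_)
    simp only
    rw [besselIntegral_eq_truncatedHankel hd hν n (hreg x (huIoc x hx)).2.1 hT]
  · filter_upwards [eventually_ge_atTop 1] with T hT
    refine Eventually.of_forall fun x hx => ?_
    obtain ⟨hx1, hx2⟩ := hreg x (huIoc x hx)
    have hx0 : 0 < x := hx2.1
    rw [besselIntegral_eq_truncatedHankel hd hν n hx0 (by linarith), norm_mul, norm_mul,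
      Real.norm_eq_abs, Real.norm_eq_abs, Real.norm_eq_abs,
      abs_of_nonneg (show 0 ≤ sphereArea d ^ 2 / (2 * Real.pi) ^ d * x ^ (ν + 1 / 2) by positivity)]
    obtain ⟨L, hL, hb'⟩ := hx1.exists_tendsto hr
    have hLx := tendsto_nhds_unique hL (tendsto_hankelLimit hd hn hν hx2)
    gcongr
    have h1 := hb' T hT
    have h2 : T ^ (-r) ≤ 1 := Real.rpow_le_one_of_one_le_of_nonpos hT (by linarith)
    have h3 : 0 ≤ T ^ (-r) := Real.rpow_nonneg (by linarith) _
    have h4 : B * T ^ (-r) ≤ |B| := by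
      calc B * T ^ (-r) ≤ |B| * T ^ (-r) := by gcongr; exact le_abs_self B
        _ ≤ |B| * 1 := by gcongr
        _ = |B| := mul_one _
    rw [← hLx]
    have h5 : |truncatedHankel d n ν x T| ≤ |L| + |L - truncatedHankel d n ν x T| := by
      have e : truncatedHankel d n ν x T = L - (L - truncatedHankel d n ν x T) := by ring
      nth_rewrite 1 [e]; exact abs_sub _ _
    linarith
  · exact (hφc.abs.continuousOn.mul ((hpc.const_mul κ).mul
      (hLc.abs.add continuousOn_const))).intervalIntegrable
  · refine Eventually.of_forall fun x hx => ?_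
    obtain ⟨-, hx2⟩ := hreg x (huIoc x hx)
    exact (tendsto_densityLimit hd hν hx2.1 (tendsto_hankelLimit hd hn hν hx2)).const_mul _

/-- A smooth function that is positive exactly on `(a, b)`, and equals `1` at distance at least
`1 / k` from the endpoints. -/
noncomputable def smoothPlateau (a b k x : ℝ) : ℝ :=
  Real.smoothTransition (k * (x - a)) * Real.smoothTransition (k * (b - x))

theorem contDiff_smoothPlateau (a b k : ℝ) :
    ContDiff ℝ ((⊤ : ℕ∞) : WithTop ℕ∞) (smoothPlateau a b k) :=
  (Real.smoothTransition.contDiff.comp (contDiff_const.mul (contDiff_id.sub contDiff_const))).mul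
    (Real.smoothTransition.contDiff.comp (contDiff_const.mul (contDiff_const.sub contDiff_id)))

theorem smoothPlateau_eq_zero {a b k x : ℝ} (hk : 0 < k) (hx : x ∉ Set.Ioo a b) :
    smoothPlateau a b k x = 0 := by
  rw [smoothPlateau]
  by_cases h : x ≤ a
  · rw [Real.smoothTransition.zero_of_nonpos
      (mul_nonpos_of_nonneg_of_nonpos hk.le (by linarith)), zero_mul]
  · have h2 : b ≤ x := by
      by_contra h3
      exact hx ⟨not_le.1 h, not_le.1 h3⟩
    rw [Real.smoothTransition.zero_of_nonpos (x := k * (b - x))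
      (mul_nonpos_of_nonneg_of_nonpos hk.le (by linarith)), mul_zero]

theorem smoothPlateau_nonneg (a b k x : ℝ) : 0 ≤ smoothPlateau a b k x :=
  mul_nonneg (Real.smoothTransition.nonneg _) (Real.smoothTransition.nonneg _)

theorem smoothPlateau_pos {a b k x : ℝ} (hk : 0 < k) (hx : x ∈ Set.Ioo a b) :
    0 < smoothPlateau a b k x :=
  mul_pos (Real.smoothTransition.pos_of_pos (mul_pos hk (sub_pos.2 hx.1)))
    (Real.smoothTransition.pos_of_pos (mul_pos hk (sub_pos.2 hx.2)))

theorem smoothPlateau_le_one (a b k x : ℝ) : smoothPlateau a b k x ≤ 1 :=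
  mul_le_one₀ (Real.smoothTransition.le_one _) (Real.smoothTransition.nonneg _)
    (Real.smoothTransition.le_one _)

theorem tendsto_smoothPlateau (a b x : ℝ) :
    Tendsto (fun k => smoothPlateau a b k x) atTop
      (𝓝 ((Set.Ioo a b).indicator (fun _ => (1 : ℝ)) x)) := by
  by_cases hx : x ∈ Set.Ioo a b
  · rw [Set.indicator_of_mem hx]
    have h1 := sub_pos.2 hx.1
    have h2 := sub_pos.2 hx.2
    refine tendsto_const_nhds.congr' ?_
    filter_upwards [eventually_ge_atTop (1 / (x - a)), eventually_ge_atTop (1 / (b - x))]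
      with k hk1 hk2
    rw [smoothPlateau, Real.smoothTransition.one_of_one_le ((div_le_iff₀ h1).1 hk1),
      Real.smoothTransition.one_of_one_le ((div_le_iff₀ h2).1 hk2), one_mul]
  · rw [Set.indicator_of_notMem hx]
    refine tendsto_const_nhds.congr' ?_
    filter_upwards [eventually_gt_atTop 0] with k hk
    rw [smoothPlateau_eq_zero hk hx]

theorem isProbabilityMeasure_walkDistanceLaw (hd : 2 ≤ d) :
    IsProbabilityMeasure (walkDistanceLaw d n) := by
  have := isProbabilityMeasure_stepsLaw (d := d) (by omega) n
  exact Measure.isProbabilityMeasure_map (measurable_sum_steps d n).norm.aemeasurable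

/-- A negative value would be negative on an interval, by continuity, and a bump function on that
interval would have negative expectation. -/
theorem densityLimit_nonneg (hd : 2 ≤ d) (hn : 2 ≤ n) (hν : ν = (d : ℝ) / 2 - 1) {x : ℝ}
    (hx : x ∈ regularSet d n) : 0 ≤ densityLimit d n ν x := by
  by_contra! hneg
  obtain ⟨α, β, hα, hβ, hsub, hint⟩ := exists_integral_eq_integral_densityLimit hd hn hν hx
  obtain ⟨δ, hδ, hball⟩ := Metric.eventually_nhds_iff_ball.1
    ((continuousAt_densityLimit hd hn hν hx).eventually_lt_const hneg)
  set a := max α (x - δ / 2)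
  set b := min β (x + δ / 2)
  have hax : a < x := max_lt hα (by linarith)
  have hxb : x < b := lt_min hβ (by linarith)
  have hneg' : ∀ y ∈ Set.Icc a b, densityLimit d n ν y < 0 := by
    intro y hy
    refine hball y ?_
    rw [Metric.mem_ball, Real.dist_eq, abs_lt]
    constructor
    · linarith [hy.1, le_max_right α (x - δ / 2)]
    · linarith [hy.2, min_le_right β (x + δ / 2)]
  have h := hint a b (smoothPlateau a b 1) (le_max_left _ _) (hax.trans hxb).le (min_le_left _ _)
    (contDiff_smoothPlateau a b 1)
    fun r hr => smoothPlateau_eq_zero one_pos fun h => hr ⟨h.1.le, h.2.le⟩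
  have h1 : 0 ≤ ∫ r, smoothPlateau a b 1 r ∂(walkDistanceLaw d n) :=
    integral_nonneg fun r => smoothPlateau_nonneg a b 1 r
  have hcont : ContinuousOn (fun r => -(smoothPlateau a b 1 r * densityLimit d n ν r))
      (Set.Icc a b) := by
    refine ((contDiff_smoothPlateau a b 1).continuous.continuousOn.mul fun y hy => ?_).neg
    exact (continuousAt_densityLimit hd hn hν (hsub ⟨(le_max_left _ _).trans hy.1,
      hy.2.trans (min_le_left _ _)⟩)).continuousWithinAt
  have h2 : 0 < ∫ r in a..b, -(smoothPlateau a b 1 r * densityLimit d n ν r) := by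
    refine intervalIntegral.intervalIntegral_pos_of_pos_on
      (ContinuousOn.intervalIntegrable (by rwa [Set.uIcc_of_le (hax.trans hxb).le])) ?_
      (hax.trans hxb)
    intro r hr
    have := mul_neg_of_pos_of_neg (smoothPlateau_pos one_pos hr) (hneg' r ⟨hr.1.le, hr.2.le⟩)
    linarith
  rw [intervalIntegral.integral_neg] at h2
  linarith

/-- Near a regular point the law has density `densityLimit`: approximating indicators by smooth
plateaus gives the measure of every small interval. -/
theorem exists_law_restrict_eq (hd : 2 ≤ d) (hn : 2 ≤ n) (hν : ν = (d : ℝ) / 2 - 1) {x₀ : ℝ}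
    (hx₀ : x₀ ∈ regularSet d n) :
    ∃ α β : ℝ, α < x₀ ∧ x₀ < β ∧ (walkDistanceLaw d n).restrict (Set.Ioo α β)
      = (volume.withDensity fun x => ENNReal.ofReal (densityLimit d n ν x)).restrict
        (Set.Ioo α β) := by
  have := isProbabilityMeasure_walkDistanceLaw (n := n) hd
  obtain ⟨α, β, hα, hβ, hsub, hint⟩ := exists_integral_eq_integral_densityLimit hd hn hν hx₀
  have hcont : ∀ a b, α ≤ a → b ≤ β → ContinuousOn (densityLimit d n ν) (Set.Icc a b) :=
    fun a b ha hb y hy =>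
      (continuousAt_densityLimit hd hn hν (hsub ⟨ha.trans hy.1, hy.2.trans hb⟩)).continuousWithinAt
  have key : ∀ a b, α ≤ a → a < b → b ≤ β → walkDistanceLaw d n (Set.Ioo a b)
      = ENNReal.ofReal (∫ r in a..b, densityLimit d n ν r) := by
    intro a b ha hab hb
    have h1 : Tendsto (fun k => ∫ r, smoothPlateau a b k r ∂(walkDistanceLaw d n)) atTop
        (𝓝 (∫ r, (Set.Ioo a b).indicator (fun _ => (1 : ℝ)) r ∂(walkDistanceLaw d n))) := by
      refine tendsto_integral_filter_of_dominated_convergence (fun _ => 1)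
        (Eventually.of_forall fun k =>
          (contDiff_smoothPlateau a b k).continuous.aestronglyMeasurable)
        (Eventually.of_forall fun k => Eventually.of_forall fun r => ?_) (integrable_const _)
        (Eventually.of_forall fun r => tendsto_smoothPlateau a b r)
      rw [Real.norm_of_nonneg (smoothPlateau_nonneg a b k r)]
      exact smoothPlateau_le_one a b k r
    have hci : IntervalIntegrable (densityLimit d n ν) volume a b :=
      ContinuousOn.intervalIntegrable (by rw [Set.uIcc_of_le hab.le]; exact hcont a b ha hb)
    have h2 : Tendsto (fun k => ∫ r in a..b, smoothPlateau a b k r * densityLimit d n ν r) atTop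
        (𝓝 (∫ r in a..b, (Set.Ioo a b).indicator (fun _ => (1 : ℝ)) r * densityLimit d n ν r)) := by
      refine intervalIntegral.tendsto_integral_filter_of_dominated_convergence
        (fun r => |densityLimit d n ν r|) (Eventually.of_forall fun k => ?_)
        (Eventually.of_forall fun k => Eventually.of_forall fun r _ => ?_) hci.abs
        (Eventually.of_forall fun r _ => (tendsto_smoothPlateau a b r).mul_const _)
      · refine (contDiff_smoothPlateau a b k).continuous.aestronglyMeasurable.mul ?_
        rw [Set.uIoc_of_le hab.le]
        exact hci.1.aestronglyMeasurable
      · rw [norm_mul, Real.norm_of_nonneg (smoothPlateau_nonneg a b k r), Real.norm_eq_abs]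
        exact mul_le_of_le_one_left (abs_nonneg _) (smoothPlateau_le_one a b k r)
    have h3 := tendsto_nhds_unique (h1.congr' ?_) h2
    · rw [integral_indicator measurableSet_Ioo, integral_const, smul_eq_mul, mul_one,
        measureReal_restrict_apply_univ] at h3
      have h4 : ∫ r in a..b, (Set.Ioo a b).indicator (fun _ => (1 : ℝ)) r * densityLimit d n ν r
          = ∫ r in a..b, densityLimit d n ν r := by
        rw [intervalIntegral.integral_of_le hab.le, intervalIntegral.integral_of_le hab.le,
          integral_Ioc_eq_integral_Ioo, integral_Ioc_eq_integral_Ioo]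
        refine setIntegral_congr_fun measurableSet_Ioo fun r hr => ?_
        rw [Set.indicator_of_mem hr, one_mul]
      rw [← h4, ← h3, measureReal_def, ENNReal.ofReal_toReal (measure_ne_top _ _)]
    · filter_upwards [eventually_gt_atTop 0] with k hk
      exact hint a b _ ha hab.le hb (contDiff_smoothPlateau a b k)
        fun r hr => smoothPlateau_eq_zero hk fun h => hr ⟨h.1.le, h.2.le⟩
  refine ⟨α, β, hα, hβ, Real.measure_ext_Ioo_rat fun p q => ?_⟩
  rw [Measure.restrict_apply measurableSet_Ioo, Measure.restrict_apply measurableSet_Ioo,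
    Set.Ioo_inter_Ioo]
  set a := max (p : ℝ) α
  set b := min (q : ℝ) β
  by_cases hab : a < b
  · have ha : α ≤ a := le_max_right _ _
    have hb : b ≤ β := min_le_right _ _
    rw [key a b ha hab hb, withDensity_apply _ measurableSet_Ioo,
      intervalIntegral.integral_of_le hab.le, integral_Ioc_eq_integral_Ioo]
    refine ofReal_integral_eq_lintegral_ofReal ?_ ?_
    · exact ((hcont a b ha hb).integrableOn_Icc).mono_set Set.Ioo_subset_Icc_self
    · refine (ae_restrict_iff' measurableSet_Ioo).2 (Eventually.of_forall fun r hr => ?_)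
      exact densityLimit_nonneg hd hn hν (hsub ⟨ha.trans hr.1.le, hr.2.le.trans hb⟩)
  · rw [Set.Ioo_eq_empty hab, measure_empty, measure_empty]

/-- The local identities of measures patch together, since the regular set is Lindelöf. -/
theorem law_restrict_regularSet (hd : 2 ≤ d) (hn : 2 ≤ n) (hν : ν = (d : ℝ) / 2 - 1) :
    (walkDistanceLaw d n).restrict (regularSet d n)
      = (volume.withDensity fun x => ENNReal.ofReal (densityLimit d n ν x)).restrict
        (regularSet d n) := by
  choose! α β hα hβ h using fun x (hx : x ∈ regularSet d n) =>
    exists_law_restrict_eq hd hn hν hx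
  obtain ⟨t, htU, htc, ht⟩ := TopologicalSpace.countable_cover_nhdsWithin
    (f := fun x => Set.Ioo (α x) (β x)) (s := regularSet d n)
    (fun x hx => mem_nhdsWithin_of_mem_nhds (Ioo_mem_nhds (hα x hx) (hβ x hx)))
  exact Measure.restrict_congr_mono ht
    ((Measure.restrict_biUnion_congr htc).2 fun x hx => h x (htU hx))

theorem walkDistanceLaw_singleton (r : ℝ)
    (h : stepsLaw d n {X | ∑ i, (X i : EuclideanSpace ℝ (Fin d)) ∈ {y | ‖y‖ = r}} = 0) :
    walkDistanceLaw d n {r} = 0 := by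
  rw [walkDistanceLaw, Measure.map_apply (measurable_sum_steps d n).norm
    (measurableSet_singleton r)]
  exact h

/-- The points outside the regular set are `x ≤ 0` and at most two of the points `1, 2, 3`, none of
which is an atom. -/
theorem walkDistanceLaw_compl_regularSet (hd : 2 ≤ d) (hn : 2 ≤ n) :
    walkDistanceLaw d n (regularSet d n)ᶜ = 0 := by
  have h0 : walkDistanceLaw d n (Set.Iic 0) = 0 := by
    rw [walkDistanceLaw, Measure.map_apply (measurable_sum_steps d n).norm measurableSet_Iic]
    refine measure_mono_null (fun X hX => ?_) (stepsLaw_sum_eq_zero hd (by omega : 1 ≤ n))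
    exact norm_le_zero_iff.1 hX
  have hplane : d = 2 → ∀ r, walkDistanceLaw d n {r} = 0 := by
    rintro rfl r
    exact walkDistanceLaw_singleton r (stepsLaw_two_norm_eq hn r)
  have htwo : n = 2 → walkDistanceLaw d n {2} = 0 := by
    rintro rfl
    exact walkDistanceLaw_singleton 2 (stepsLaw_norm_eq_two hd)
  have hsub : (regularSet d n)ᶜ ⊆ Set.Iic 0 ∪ (⋃ r ∈ {r : ℝ | r ∈ ({1, 2, 3} : Set ℝ) ∧
      r ∉ regularSet d n ∧ 0 < r}, {r}) := by
    intro x hx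
    by_cases hx0 : 0 < x
    · right
      have h123 : x ∈ ({1, 2, 3} : Set ℝ) := by
        by_contra h
        exact hx (mem_regularSet_of_notMem hx0 h)
      simp only [Set.mem_iUnion]
      exact ⟨x, ⟨h123, hx, hx0⟩, rfl⟩
    · exact Or.inl (not_lt.1 hx0)
  refine measure_mono_null hsub (measure_union_null h0 ?_)
  have hc : {r : ℝ | r ∈ ({1, 2, 3} : Set ℝ) ∧ r ∉ regularSet d n ∧ 0 < r}.Countable :=
    (Set.toFinite ({1, 2, 3} : Set ℝ)).countable.mono fun r hr => hr.1
  refine (measure_biUnion_null_iff hc).2 fun r hr => ?_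
  obtain ⟨-, hr1, hr0⟩ := hr
  by_cases h2 : d = 2
  · exact hplane h2 r
  · have : d = 3 ∧ n = 2 ∧ r = 2 := by
      by_contra h3
      exact hr1 ⟨hr0, fun h => h2 h.1, fun h => h2 h.1, h3⟩
    rw [this.2.2]
    exact htwo this.2.1

/-! ### The resonance at the end of the support -/

/-- At a resonance `x = n` whose stationary terms cancel, the limit exists. It is nonnegative as a
limit of averages of nonnegative values at the regular points `n ± h`. -/
theorem hankelLimit_resonant (hd : 2 ≤ d) (hn : 2 ≤ n) (hν : ν = (d : ℝ) / 2 - 1)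
    (h : (d = 3 ∧ n = 2) ∨ (d = 2 ∧ n = 3)) :
    Tendsto (fun T => truncatedHankel d n ν n T) atTop (𝓝 (hankelLimit d n ν n)) ∧
      0 ≤ hankelLimit d n ν n := by
  have hν0 := nonneg_of_dim hd hν
  have hn2 : (2 : ℝ) ≤ n := by exact_mod_cast hn
  obtain ⟨a, b, M, hM0, hM, ha⟩ := exists_besselU_asymptotic hν0
  -- with `a = 0`, or with `a = b`, the two stationary terms cancel
  have hres : ((a - b * Complex.I) / 2) * ((a + b * Complex.I) / 2) ^ n
      + ((a - b * Complex.I) / 2) ^ n * ((a + b * Complex.I) / 2) = (0 : ℂ) := by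
    rcases h with ⟨rfl, rfl⟩ | ⟨rfl, rfl⟩
    · rw [ha (by rw [hν]; norm_num)]
      push_cast; ring
    · have hν' : ν = 0 := by rw [hν]; norm_num
      subst hν'
      rw [besselU_zero_phase hM]
      linear_combination ((b : ℂ) ^ 4 / 8 * (1 - Complex.I ^ 2)) * Complex.I_sq
  obtain ⟨B, hB⟩ := exists_tailBound_resonant hd hn hν hM0 hM hres
  have hs : 0 < ((n : ℝ) - 1) * (ν + 1 / 2) := mul_pos (by linarith) (by linarith)
  have hsmall : ∀ᶠ h : ℝ in 𝓝 0, |h| ≤ 1 := by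
    filter_upwards [Metric.closedBall_mem_nhds (0 : ℝ) one_pos] with h hh
    simpa using hh
  -- `L h` is the sum of the limits at `n + h` and `n - h`, continuous at `h = 0`
  choose! L hL _ using fun h (hh : |h| ≤ 1) => (hB h hh).exists_tendsto hs
  have hL0 : Tendsto (fun T => truncatedHankel d n ν n T) atTop (𝓝 (L 0 / 2)) := by
    have := (hL 0 (by simp)).div_const 2
    refine this.congr fun T => ?_
    rw [add_zero, sub_zero]; ring
  have hlim : Tendsto (fun T => truncatedHankel d n ν n T) atTop (𝓝 (hankelLimit d n ν n)) :=
    tendsto_nhds_limUnder ⟨_, hL0⟩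
  refine ⟨hlim, ?_⟩
  rw [tendsto_nhds_unique hlim hL0]
  have hc : ContinuousAt L 0 := by
    refine continuousAt_of_tailBound hs (hsmall.mono hB) (hsmall.mono hL) fun T _ => ?_
    refine ContinuousAt.add ?_ ?_
    · exact ContinuousAt.comp (f := fun h : ℝ => n + h)
        (g := fun x => truncatedHankel d n ν x T) (continuousAt_truncatedHankel d n hν0 _ T)
        (by fun_prop)
    · exact ContinuousAt.comp (f := fun h : ℝ => n - h)
        (g := fun x => truncatedHankel d n ν x T) (continuousAt_truncatedHankel d n hν0 _ T)
        (by fun_prop)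
  have hreg : ∀ h : ℝ, 0 < |h| → |h| < 1 → (n : ℝ) + h ∈ regularSet d n := by
    intro y hy0 hy1
    have hy : y ≠ 0 := abs_pos.1 hy0
    obtain ⟨hy2, hy3⟩ := abs_lt.1 hy1
    refine ⟨by linarith, ?_, ?_, ?_⟩
    · rintro ⟨-, rfl, he⟩
      push_cast at he
      exact hy (by linarith)
    · rintro ⟨-, rfl, he | he⟩ <;> push_cast at he
      · linarith
      · exact hy (by linarith)
    · rintro ⟨-, rfl, he⟩
      push_cast at he
      exact hy (by linarith)
  have hpos : ∀ x ∈ regularSet d n, 0 ≤ hankelLimit d n ν x := by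
    intro x hx
    have h1 := densityLimit_nonneg hd hn hν hx
    have h2 : 0 < sphereArea d ^ 2 / (2 * Real.pi) ^ d * x ^ (ν + 1 / 2) := by
      have := sphereArea_pos (d := d) (by omega)
      have := Real.rpow_pos_of_pos hx.1 (ν + 1 / 2)
      positivity
    exact nonneg_of_mul_nonneg_right h1 h2
  have hLnonneg : ∀ᶠ y : ℝ in 𝓝[>] 0, 0 ≤ L y := by
    have h1 : ∀ᶠ y : ℝ in 𝓝[>] 0, y < 1 :=
      (gt_mem_nhds one_pos).filter_mono nhdsWithin_le_nhds
    filter_upwards [self_mem_nhdsWithin, h1] with y hy hy1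
    have hy0 : (0 : ℝ) < y := hy
    have hya : |y| = y := abs_of_pos hy0
    have hp := hreg y (by rw [hya]; exact hy0) (by rw [hya]; exact hy1)
    have hm := hreg (-y) (by rw [abs_neg, hya]; exact hy0) (by rw [abs_neg, hya]; exact hy1)
    rw [← sub_eq_add_neg] at hm
    rw [tendsto_nhds_unique (hL y (by rw [hya]; exact hy1.le))
      ((tendsto_hankelLimit hd hn hν hp).add (tendsto_hankelLimit hd hn hν hm))]
    exact add_nonneg (hpos _ hp) (hpos _ hm)
  have : 0 ≤ L 0 := ge_of_tendsto (hc.tendsto.mono_left nhdsWithin_le_nhds) hLnonneg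
  linarith

end Density

theorem mainTheorem9 (d n : ℕ) (hd : 2 ≤ d) (hn : 2 ≤ n) (ν : ℝ) (hν : ν = (d : ℝ) / 2 - 1) :
    ∃ p : ℝ → ℝ, IsWalkDensity d n p ∧
      (∀ x : ℝ, 0 < x →
        ¬ (d = 2 ∧ n = 2 ∧ x = 2) → ¬ (d = 2 ∧ n = 3 ∧ x = 1) →
        Tendsto (fun T : ℝ => besselIntegral ν n x T) atTop (𝓝 (p x))) ∧
      (∀ x : ℝ, 0 < x →
        ¬ (d = 2 ∧ n = 2 ∧ x = 2) → ¬ (d = 2 ∧ n = 3 ∧ (x = 1 ∨ x = 3)) →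
        ¬ (d = 3 ∧ n = 2 ∧ x = 2) → ContinuousAt p x) := by
  classical
  -- the points at which the integral converges: the regular ones and the resonance `x = n`
  let V : Set ℝ := {x | 0 < x ∧ ¬ (d = 2 ∧ n = 2 ∧ x = 2) ∧ ¬ (d = 2 ∧ n = 3 ∧ x = 1)}
  let p : ℝ → ℝ := V.indicator (densityLimit d n ν)
  have hUV : regularSet d n ⊆ V := fun x hx => ⟨hx.1, hx.2.1, fun h => hx.2.2.1
    ⟨h.1, h.2.1, Or.inl h.2.2⟩⟩
  have hV : ∀ x ∈ V, x ∈ regularSet d n ∨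
      ((d = 3 ∧ n = 2) ∨ (d = 2 ∧ n = 3)) ∧ x = n := by
    intro x hx
    by_cases h : x ∈ regularSet d n
    · exact Or.inl h
    right
    by_cases h32 : d = 3 ∧ n = 2 ∧ x = 2
    · exact ⟨Or.inl ⟨h32.1, h32.2.1⟩, by rw [h32.2.2, h32.2.1]; norm_num⟩
    by_cases h23 : d = 2 ∧ n = 3 ∧ x = 3
    · exact ⟨Or.inr ⟨h23.1, h23.2.1⟩, by rw [h23.2.2, h23.2.1]; norm_num⟩
    exact absurd ⟨hx.1, hx.2.1, fun h' => h'.2.2.elim (fun h1 => hx.2.2 ⟨h'.1, h'.2.1, h1⟩)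
      (fun h3 => h23 ⟨h'.1, h'.2.1, h3⟩), h32⟩ h
  have hlim : ∀ x ∈ V, Tendsto (fun T : ℝ => besselIntegral ν n x T) atTop
      (𝓝 (densityLimit d n ν x)) ∧ 0 ≤ densityLimit d n ν x := by
    intro x hx
    rcases hV x hx with h | ⟨h, rfl⟩
    · exact ⟨tendsto_densityLimit hd hν hx.1 (tendsto_hankelLimit hd hn hν h),
        densityLimit_nonneg hd hn hν h⟩
    · obtain ⟨h1, h2⟩ := hankelLimit_resonant hd hn hν h
      refine ⟨tendsto_densityLimit hd hν hx.1 h1, mul_nonneg (mul_nonneg ?_ ?_) h2⟩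
      · positivity
      · exact Real.rpow_nonneg hx.1.le _
  -- `p` differs from a function supported in the regular set at finitely many points only
  have hpU : ∀ x, x ∉ ({1, 2, 3} : Set ℝ) →
      p x = (regularSet d n).indicator (densityLimit d n ν) x := by
    intro x hx
    by_cases h0 : 0 < x
    · have h1 := mem_regularSet_of_notMem (d := d) (n := n) h0 hx
      rw [Set.indicator_of_mem h1, show p x = densityLimit d n ν x from
        Set.indicator_of_mem (hUV h1) _]
    · rw [Set.indicator_of_notMem fun h => h0 h.1, show p x = 0 from
        Set.indicator_of_notMem (fun h => h0 h.1) _]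
  have hcount : ({1, 2, 3} : Set ℝ).Countable := (Set.toFinite _).countable
  have hUo := isOpen_regularSet d n
  refine ⟨p, ⟨?_, ?_, ?_, ?_⟩, ?_, ?_⟩
  · have hm : Measurable ((regularSet d n).indicator (densityLimit d n ν)) := by
      rw [← Set.piecewise_eq_indicator]
      exact ContinuousOn.measurable_piecewise
        (fun x hx => (continuousAt_densityLimit hd hn hν hx).continuousWithinAt)
        continuousOn_const hUo.measurableSet
    refine hm.measurable_of_countable_ne (hcount.mono fun x hx => ?_)
    by_contra h
    exact hx (hpU x h).symm
  · exact fun x => Set.indicator_nonneg (fun y hy => (hlim y hy).2) x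
  · exact fun x hx => Set.indicator_of_notMem (fun h => absurd h.1 (not_lt.2 hx)) _
  · have hae : (fun x => ENNReal.ofReal (p x)) =ᵐ[volume]
        (regularSet d n).indicator fun x => ENNReal.ofReal (densityLimit d n ν x) := by
      filter_upwards [measure_eq_zero_iff_ae_notMem.1 (hcount.measure_zero volume)] with x hx
      rw [hpU x hx]
      by_cases h : x ∈ regularSet d n
      · rw [Set.indicator_of_mem h, Set.indicator_of_mem h]
      · rw [Set.indicator_of_notMem h, Set.indicator_of_notMem h, ENNReal.ofReal_zero]
    rw [withDensity_congr_ae hae, withDensity_indicator hUo.measurableSet,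
      ← restrict_withDensity hUo.measurableSet, ← law_restrict_regularSet hd hn hν]
    refine (Measure.restrict_eq_self_of_ae_mem ?_).symm
    filter_upwards [measure_eq_zero_iff_ae_notMem.1 (walkDistanceLaw_compl_regularSet hd hn)]
      with x hx
    exact not_not.1 hx
  · intro x hx h22 h23
    have hxV : x ∈ V := ⟨hx, h22, h23⟩
    rw [show p x = densityLimit d n ν x from Set.indicator_of_mem hxV _]
    exact (hlim x hxV).1
  · intro x hx h22 h23 h32
    have hxU : x ∈ regularSet d n := ⟨hx, h22, h23, h32⟩
    refine (continuousAt_densityLimit hd hn hν hxU).congr ?_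
    filter_upwards [hUo.mem_nhds hxU] with y hy
    exact (Set.indicator_of_mem (hUV hy) _).symm
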